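/- Let $n\ge 2$ and let $G=SO_0(n,1)$ act on the closed unit ball $\overline{\mathbb B}^n$ by the projective action $\mathsf{proj}$, the continuous extension of the isometric action in the Klein model: $\mathsf{proj}_A(v)=w/t$, where $(w,t)=A(v,1)$. "Smooth" always means smooth up to the boundary. A \emph{smooth compactification} (of the isometric action) is a homeomorphism $\varphi$ of $\overline{\mathbb B}^n$ that restricts to a smooth diffeomorphism of the open ball and is such that, for each $A\in G$, the map $\varphi^{-1}\circ\mathsf{proj}_A\circ\varphi$, defined on the open ball, has a smooth extension to $\overline{\mathbb B}^n$. Two compactifications are smoothly (analytically) \emph{conjugate} if a smooth (analytic) diffeomorphism of $\overline{\mathbb B}^n$ intertwines the two resulting actions of $G$ on $\overline{\mathbb B}^n$. A \emph{half-space chart} is a smooth diffeomorphism from $\overline{\mathbb B}^n$ minus one boundary point onto $\{(x,y)\in\mathbb R^{n-1}\times\mathbb R : y\ge 0\}$. Let $\mathcal{KC}$ be the half-space chart $(x,y)\mapsto\bigl(\tfrac{x}{1-y},\tfrac{1-|x|^2-y^2}{(1-y)^2}\bigr)$, which misses the point $(0,\dots,0,1)$. For a homeomorphism $f$ of $\mathbb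 R^+=[0,\infty)$ that is smooth and restricts to a diffeomorphism of $(0,\infty)$, put $\varphi_f(x,y)=(x,f(y))$. A homeomorphism $\varphi$ of $\overline{\mathbb B}^n$ is said to be \emph{given by} $\varphi_f$ if, for some half-space chart $\chi$ missing a point $p$, one has $\varphi(p)=(0,\dots,0,1)$ and $\mathcal{KC}\circ\varphi=\varphi_f\circ\chi$ on $\overline{\mathbb B}^n\setminus\{p\}$. 1. For each such $f$, some homeomorphism of $\overline{\mathbb B}^n$ given by $\varphi_f$ is a smooth compactification if and only if $f/f'$ is smooth, i.e. extends from $(0,\infty)$ to a smooth function on $[0,\infty)$. 2. This condition holds whenever $f$ is non-flat, i.e. has some non-zero derivative at $0$. 3. If $n\ge 3$, every smooth compactification is analytically conjugate to a smooth compactification given by $\varphi_f$ for some such $f$ with $f/f'$ smooth. 4. Two smooth compactifications given by $\varphi_{f_1}$ and $\varphi_{f_2}$ are smoothly conjugate if and only if $f_1$ and $f_2$ are smoothly conjugate, i.e. $k\circ f_1=f_2\circ h$ for some smooth diffeomorphisms $h,k$ of $[0,\infty)$; equivalently, if and only if $f_1=f_2\circ h$ for some smooth diffeomorphism $h$ of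 $[0,\infty)$. -/

import Mathlib

open scoped ContDiff Matrix

noncomputable section

namespace HypCompact

/-- `φ` restricts to a homeomorphism from `S` onto `T`
(values outside `S` and `T` are irrelevant). -/
structure IsHomeo {E F : Type*} [TopologicalSpace E] [TopologicalSpace F]
    (φ : PartialEquiv E F) (S : Set E) (T : Set F) : Prop where
  source_eq : φ.source = S
  target_eq : φ.target = T
  continuousOn : ContinuousOn φ S
  continuousOn_symm : ContinuousOn φ.symm T

/-- `φ` restricts to a `C^k` diffeomorphism from `S` onto `T`. It is used for open sets and for
closed balls, half-spaces and half-lines, where `ContDiffOn` is smoothness up to the boundary. -/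
structure IsDiffeo {E F : Type*} [NormedAddCommGroup E] [NormedSpace ℝ E]
    [NormedAddCommGroup F] [NormedSpace ℝ F] (k : WithTop ℕ∞)
    (φ : PartialEquiv E F) (S : Set E) (T : Set F) : Prop where
  source_eq : φ.source = S
  target_eq : φ.target = T
  contDiffOn : ContDiffOn ℝ k φ S
  contDiffOn_symm : ContDiffOn ℝ k φ.symm T

/-! ### The projective action of `SO₀(n,1)` on the closed Klein ball -/

/-- `ℝⁿ` with its Euclidean norm. -/
abbrev Eucl (n : ℕ) : Type := EuclideanSpace ℝ (Fin n)

/-- The closed unit ball of `ℝⁿ`. -/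
abbrev cball (n : ℕ) : Set (Eucl n) := Metric.closedBall 0 1

/-- The open unit ball of `ℝⁿ`. -/
abbrev oball (n : ℕ) : Set (Eucl n) := Metric.ball 0 1

/-- `SO₀(n,1)`: the real matrices of determinant `1` that preserve the Lorentzian quadratic form
`x₁² + ⋯ + xₙ² - t²` and the time orientation. -/
def SO₀ (n : ℕ) : Set (Matrix (Fin n ⊕ Fin 1) (Fin n ⊕ Fin 1) ℝ) :=
  {A | Aᵀ * LieAlgebra.Orthogonal.indefiniteDiagonal (Fin n) (Fin 1) ℝ * A
        = LieAlgebra.Orthogonal.indefiniteDiagonal (Fin n) (Fin 1) ℝ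
      ∧ A.det = 1 ∧ 0 < A (Sum.inr 0) (Sum.inr 0)}

/-- The vector `(v, 1)` of `ℝⁿ⁺¹`. -/
def lift {n : ℕ} (v : Eucl n) : Fin n ⊕ Fin 1 → ℝ := Sum.elim v.ofLp (fun _ => 1)

/-- The projective action on the closed ball: the point `v` is identified with the line through
`(v, 1)`, so that `v` is sent to `w / t` where `(w, t) = A (v, 1)`. -/
def proj {n : ℕ} (A : Matrix (Fin n ⊕ Fin 1) (Fin n ⊕ Fin 1) ℝ) (v : Eucl n) : Eucl n :=
  WithLp.toLp 2 fun i => (A *ᵥ lift v) (Sum.inl i) / (A *ᵥ lift v) (Sum.inr 0)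

/-! ### Compactifications of the isometric action -/

/-- The action of `A` conjugated by `φ`: the map `φ⁻¹ ∘ proj_A ∘ φ`. -/
def conjAct {n : ℕ} (φ : PartialEquiv (Eucl n) (Eucl n))
    (A : Matrix (Fin n ⊕ Fin 1) (Fin n ⊕ Fin 1) ℝ) (v : Eucl n) : Eucl n :=
  φ.symm (proj A (φ v))

/-- A smooth compactification of the isometric action of `SO₀(n,1)`: a homeomorphism `φ` of the
closed ball that restricts to a smooth diffeomorphism of the open ball, and such that for each
`A` in `SO₀(n,1)` the map `φ⁻¹ ∘ proj_A ∘ φ`, defined on the open ball, has a smooth extension to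
the closed ball. -/
structure IsSmoothCompactification {n : ℕ} (φ : PartialEquiv (Eucl n) (Eucl n)) : Prop where
  isHomeo : IsHomeo φ (cball n) (cball n)
  image_oball : φ '' oball n = oball n
  contDiffOn : ContDiffOn ℝ ∞ φ (oball n)
  contDiffOn_symm : ContDiffOn ℝ ∞ φ.symm (oball n)
  extends_smoothly : ∀ A ∈ SO₀ n, ∃ F : Eucl n → Eucl n,
    ContDiffOn ℝ ∞ F (cball n) ∧ Set.EqOn F (conjAct φ A) (oball n)

/-- Two compactifications are `C^k` conjugate if some `C^k` diffeomorphism of the closed ball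
intertwines the two actions of `SO₀(n,1)` on the closed ball. -/
def AreConjugate {n : ℕ} (k : WithTop ℕ∞) (φ₁ φ₂ : PartialEquiv (Eucl n) (Eucl n)) : Prop :=
  ∃ ψ : PartialEquiv (Eucl n) (Eucl n), IsDiffeo k ψ (cball n) (cball n) ∧
    ∀ A ∈ SO₀ n, ∀ v ∈ cball n, ψ (conjAct φ₁ A v) = conjAct φ₂ A (ψ v)

/-! ### Half-space charts

The last coordinate of `ℝⁿ` is the one of index `⊤ : Fin n`. -/

/-- The closed half-space `{(x₁, …, xₙ₋₁, y) | 0 ≤ y}`. -/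
def halfSpace (n : ℕ) [NeZero n] : Set (Eucl n) := {v | 0 ≤ v ⊤}

/-- `χ` is a smooth half-space chart of the closed ball that misses only the boundary
point `p`. -/
def IsHalfSpaceChart {n : ℕ} [NeZero n] (p : Eucl n) (χ : PartialEquiv (Eucl n) (Eucl n)) :
    Prop :=
  ‖p‖ = 1 ∧ IsDiffeo ∞ χ (cball n \ {p}) (halfSpace n)

/-- The pole `(0, …, 0, 1)`. -/
def pole (n : ℕ) [NeZero n] : Eucl n := EuclideanSpace.single ⊤ 1

/-- The half-space chart `𝒦𝒞` of the closed Klein ball, which misses only the pole: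
`(x, y) ↦ (x / (1 - y), (1 - |x|² - y²) / (1 - y)²)`. -/
def kleinChart {n : ℕ} [NeZero n] (v : Eucl n) : Eucl n :=
  WithLp.toLp 2 fun i =>
    if i = ⊤ then (1 - ‖v‖ ^ 2) / (1 - v ⊤) ^ 2 else v i / (1 - v ⊤)

/-- The map `φ_f : (x₁, …, xₙ₋₁, y) ↦ (x₁, …, xₙ₋₁, f y)`. -/
def vertMap {n : ℕ} [NeZero n] (f : ℝ → ℝ) (v : Eucl n) : Eucl n :=
  WithLp.toLp 2 fun i => if i = ⊤ then f (v ⊤) else v i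

/-- The homeomorphism `φ` of the closed ball is `φ_f` read in half-space charts: some smooth
half-space chart at the source, and `𝒦𝒞` at the target. -/
def IsGivenBy {n : ℕ} [NeZero n] (f : ℝ → ℝ) (φ : PartialEquiv (Eucl n) (Eucl n)) : Prop :=
  IsHomeo φ (cball n) (cball n) ∧
    ∃ (p : Eucl n) (χ : PartialEquiv (Eucl n) (Eucl n)), IsHalfSpaceChart p χ ∧
      φ p = pole n ∧ ∀ v ∈ cball n \ {p}, kleinChart (φ v) = vertMap f (χ v)

/-! ### The maps `f` of the half-line -/

/-- `f` is a homeomorphism of `[0, ∞)` that is smooth (up to `0`) and restricts to a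
diffeomorphism of `(0, ∞)`. -/
structure IsProfile (f : PartialEquiv ℝ ℝ) : Prop where
  isHomeo : IsHomeo f (Set.Ici 0) (Set.Ici 0)
  contDiffOn : ContDiffOn ℝ ∞ f (Set.Ici 0)
  image_Ioi : f '' Set.Ioi 0 = Set.Ioi 0
  contDiffOn_symm : ContDiffOn ℝ ∞ f.symm (Set.Ioi 0)

/-- `f / f'`, defined on `(0, ∞)`, is smooth up to `0`. -/
def QuotientSmooth (f : ℝ → ℝ) : Prop :=
  ∃ q : ℝ → ℝ, ContDiffOn ℝ ∞ q (Set.Ici 0) ∧ ∀ y > 0, q y = f y / deriv f y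

/-- `f` has some non-zero derivative at `0`. -/
def NonFlat (f : ℝ → ℝ) : Prop :=
  ∃ k : ℕ, 1 ≤ k ∧ iteratedDerivWithin k f (Set.Ici 0) 0 ≠ 0

/-- `h` is a smooth diffeomorphism of `[0, ∞)`. -/
def IsHalfLineDiffeo (h : PartialEquiv ℝ ℝ) : Prop :=
  IsDiffeo ∞ h (Set.Ici 0) (Set.Ici 0)

/-- `f₁` and `f₂` are smoothly conjugate: they are the same map up to smooth diffeomorphisms of
the half-line at the source and at the target. -/
def SmoothlyConjugate (f₁ f₂ : ℝ → ℝ) : Prop :=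
  ∃ h k : PartialEquiv ℝ ℝ, IsHalfLineDiffeo h ∧ IsHalfLineDiffeo k ∧
    Set.EqOn (k ∘ f₁) (f₂ ∘ h) (Set.Ici 0)

/-- `f₁` and `f₂` differ by a smooth diffeomorphism of the half-line at the source only. -/
def SourceConjugate (f₁ f₂ : ℝ → ℝ) : Prop :=
  ∃ h : PartialEquiv ℝ ℝ, IsHalfLineDiffeo h ∧ Set.EqOn f₁ (f₂ ∘ h) (Set.Ici 0)

end HypCompact

end

/-!
# Smooth compactifications of the isometric action of `SO₀(n,1)`

In the Klein chart, the stabilizer of the pole acts by the horizontal translations `X ↦ X + a`, by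
the dilations `(X, Y) ↦ (eˢ X, e²ˢ Y)` and by rotations of `X`. Everything is read off from these
elements, together with the half-turns that change the signs of two coordinates.

*The condition on `f / f'`.* In a chart where the compactification is `φ_f`, the dilations act on the
vertical axis by the scaling flow `w ↦ f⁻¹ (eˢ f w)`, whose generator is `f / f'`. If the generator
is smooth up to `0`, so is its flow (`IsProfile.contDiffOn_scaleFlow`), and then a radial map
`v ↦ a (|v|²) v` with `1 - |φ v|² = f (c (1 - |v|²))` is a smooth compactification, since every
element of the group multiplies `1 - |u|²` by a smooth positive factor
(`IsRadial.isSmoothCompactification`). Conversely only the individual maps of the action are known to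
be smooth up to the boundary, not their dependence on the group element. Baire's theorem bounds
their derivatives locally uniformly (`SmoothAction.exists_bound`), so that averages over
compact sets of group elements are smooth (`SmoothAction.contDiffOn_average`). The average of
`1 - |v|²` along the dilations is then differentiable along the flow, with a smooth derivative, and
dividing gives the generator (`quotientSmooth_of_isGivenBy`). For non-flat `f`, Hadamard's lemma
writes `f = yᵐ h` with `h 0 ≠ 0`, and `f / f'` is computed.

*Classification.* Let `n ≥ 3`, and let `(X, Y)` be the Klein chart read through a smooth
compactification `φ`. The first moments of a bump function along the orbits of the translations are
smooth and equivariant, hence equal to the coordinates `X` up to functions of the height; a rotation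
that reverses a coordinate eliminates these (`contDiffOn_coord_apply`). The half-turn that exchanges
the poles acts as an inversion, which expresses `Y` by smooth functions (`contDiffOn_coord_top`). So
`(X, Y)` is smooth up to the boundary, but `Y` may be flat there. The average of `1 - |v|²` along the
translations, cut off by a bump function, is a function of `Y` that vanishes exactly to first order;
adding a multiple of `Y` gives an increasing function `e` with `e Y` transverse to the boundary
(`exists_height`). Sard's theorem and homogeneity show that `X` is a local diffeomorphism along the
sphere (`det_fderiv_polar_ne_zero`), so that `(X, e Y)` is a half-space chart. In this chart `φ` is
`φ_f` with `f = e⁻¹`, and the conjugacy is the identity.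

*Conjugacy.* A homeomorphism that intertwines two actions can only be `φ₂⁻¹ ∘ φ₁`, as the identity is
the only continuous map of the closed ball that commutes with the projective action
(`areConjugate_iff`). In the half-space charts it is `φ_h` with `h = f₂⁻¹ ∘ f₁`. Changes of variable
at the target can be moved to the source, because `f⁻¹ ∘ κ ∘ f` follows the scaling flow for a smooth
time (`IsProfile.contDiffOn_symm_comp_diffeo`).
-/

noncomputable section

namespace HypCompact

open MeasureTheory Set Filter Topology

/-! ### Integrals depending on a parameter, up to the boundary -/

section ParametricIntegral

set_option linter.unusedSectionVars false

variable {α E G : Type*} [TopologicalSpace α] [T2Space α] [MeasurableSpace α]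
  [OpensMeasurableSpace α]
  [NormedAddCommGroup E] [NormedSpace ℝ E] [NormedAddCommGroup G] [NormedSpace ℝ G]
  {μ : Measure α} [IsFiniteMeasureOnCompacts μ] {A : Set α} {S : Set E}

lemma eventually_forall_norm_sub_lt {H : Type*} [SeminormedAddCommGroup H] (hA : IsCompact A)
    {K : α → E → H} (hK : ContinuousOn (Function.uncurry K) (A ×ˢ S)) {y : E} (hy : y ∈ S)
    {ε : ℝ} (hε : 0 < ε) : ∀ᶠ z in 𝓝 y, ∀ a ∈ A, z ∈ S → ‖K a z - K a y‖ < ε := by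
  have key : ∀ a ∈ A, ∀ᶠ q in 𝓝 (y, a), q.2 ∈ A → q.1 ∈ S → ‖K q.2 q.1 - K q.2 y‖ < ε := by
    intro a ha
    have h1 := Metric.continuousWithinAt_iff'.1 (hK (a, y) ⟨ha, hy⟩) (ε / 2) (half_pos hε)
    rw [eventually_nhdsWithin_iff, nhds_prod_eq] at h1
    have h2 : ∀ᶠ a' in 𝓝 a, (a', y) ∈ A ×ˢ S →
        dist (Function.uncurry K (a', y)) (Function.uncurry K (a, y)) < ε / 2 := by
      rw [← nhds_prod_eq] at h1
      exact (Continuous.prodMk_left y).continuousAt.eventually h1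
    have h3 := h1
    rw [prod_comm, eventually_map] at h3
    rw [nhds_prod_eq]
    filter_upwards [h3, h2.prod_inr (𝓝 y)] with q hq1 hq2 hA' hS'
    have e1 := hq1 ⟨hA', hS'⟩
    have e2 := hq2 ⟨hA', hy⟩
    rw [← dist_eq_norm]
    calc _ ≤ dist (K q.2 q.1) (K a y) + dist (K q.2 y) (K a y) := dist_triangle_right _ _ _
      _ < ε / 2 + ε / 2 := add_lt_add e1 e2
      _ = ε := add_halves ε
  have := hA.eventually_forall_of_forall_eventually
    (P := fun z a => a ∈ A → z ∈ S → ‖K a z - K a y‖ < ε) key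
  filter_upwards [this] with z hz a ha hzS using hz a ha ha hzS

lemma integrableOn_of_uncurry (hA : IsCompact A) {K : α → E → G}
    (hK : ContinuousOn (Function.uncurry K) (A ×ˢ S)) {y : E} (hy : y ∈ S) :
    IntegrableOn (fun a => K a y) A μ :=
  ContinuousOn.integrableOn_compact hA
    (hK.comp (Continuous.prodMk_left y).continuousOn fun _ ha => ⟨ha, hy⟩)

lemma continuousOn_setIntegral (hA : IsCompact A) {K : α → E → G}
    (hK : ContinuousOn (Function.uncurry K) (A ×ˢ S)) :
    ContinuousOn (fun y => ∫ a in A, K a y ∂μ) S := by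
  intro y hy
  rw [Metric.continuousWithinAt_iff']
  intro ε hε
  have hM : 0 < μ.real A + 1 := by positivity
  rw [eventually_nhdsWithin_iff]
  filter_upwards [eventually_forall_norm_sub_lt hA hK hy (div_pos hε hM)] with z hz hzS
  rw [dist_eq_norm, ← integral_sub (integrableOn_of_uncurry hA hK hzS)
    (integrableOn_of_uncurry hA hK hy)]
  calc _ ≤ ε / (μ.real A + 1) * μ.real A :=
        norm_setIntegral_le_of_norm_le_const hA.measure_lt_top (fun a ha => (hz a ha hzS).le)
    _ < ε / (μ.real A + 1) * (μ.real A + 1) := by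
        apply mul_lt_mul_of_pos_left (lt_add_one _) (div_pos hε hM)
    _ = ε := div_mul_cancel₀ _ hM.ne'

/-- Differentiation under the integral sign within a convex set, without any openness. -/
lemma hasFDerivWithinAt_setIntegral (hA : IsCompact A) (hS : Convex ℝ S) {K : α → E → G}
    {K' : α → E → E →L[ℝ] G} (hK : ContinuousOn (Function.uncurry K) (A ×ˢ S))
    (hK' : ContinuousOn (Function.uncurry K') (A ×ˢ S))
    (hd : ∀ a ∈ A, ∀ y ∈ S, HasFDerivWithinAt (K a) (K' a y) S y) {y : E} (hy : y ∈ S) :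
    ∃ L : E →L[ℝ] G, HasFDerivWithinAt (fun y => ∫ a in A, K a y ∂μ) L S y ∧
      ∀ x, L x = ∫ a in A, K' a y x ∂μ := by
  have hKint := integrableOn_of_uncurry (μ := μ) hA hK' hy
  have e1 : ∀ x, (∫ a in A, K' a y ∂μ) x = ∫ a in A, K' a y x ∂μ := fun x =>
    ContinuousLinearMap.integral_apply hKint _
  refine ⟨∫ a in A, K' a y ∂μ, ?_, e1⟩
  rw [hasFDerivWithinAt_iff_isLittleO, Asymptotics.isLittleO_iff]
  intro ε hε
  have hM : 0 < μ.real A + 1 := by positivity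
  obtain ⟨δ, hδ, hball⟩ := Metric.eventually_nhds_iff_ball.1
    (eventually_forall_norm_sub_lt hA hK' hy (div_pos hε hM))
  rw [eventually_nhdsWithin_iff]
  filter_upwards [Metric.ball_mem_nhds y hδ] with z hz hzS
  have i1 := integrableOn_of_uncurry (μ := μ) hA hK hzS
  have i2 := integrableOn_of_uncurry (μ := μ) hA hK hy
  have i3 : IntegrableOn (fun a => K' a y (z - y)) A μ :=
    hKint.apply_continuousLinearMap (z - y)
  have i12 : IntegrableOn (fun a => K a z - K a y) A μ := Integrable.sub i1 i2
  rw [e1, ← integral_sub i1 i2, ← integral_sub i12 i3]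
  have hb : ∀ a ∈ A, ‖K a z - K a y - K' a y (z - y)‖ ≤ ε / (μ.real A + 1) * ‖z - y‖ := by
    intro a ha
    have hconv : Convex ℝ (S ∩ Metric.ball y δ) := hS.inter (convex_ball y δ)
    refine hconv.norm_image_sub_le_of_norm_hasFDerivWithin_le' (f' := K' a)
      (fun x hx => (hd a ha x hx.1).mono inter_subset_left)
      (fun x hx => (hball x hx.2 a ha hx.1).le) ⟨hy, Metric.mem_ball_self hδ⟩ ⟨hzS, hz⟩
  calc _ ≤ ε / (μ.real A + 1) * ‖z - y‖ * μ.real A :=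
        norm_setIntegral_le_of_norm_le_const hA.measure_lt_top hb
    _ ≤ ε / (μ.real A + 1) * ‖z - y‖ * (μ.real A + 1) := by
        gcongr; linarith
    _ = ε * ‖z - y‖ := by field_simp

/-- If the terms of Taylor series of the functions `K a` within a convex set `S` are continuous
in `(a, y)`, then the integral of `K a y` over a compact set of `a` has the integrated Taylor
series. -/
lemma contDiffOn_setIntegral [CompleteSpace G] (hA : IsCompact A) (hS : Convex ℝ S)
    {n : ℕ∞}
    {K : α → E → G} {p : α → E → FormalMultilinearSeries ℝ E G}
    (hp : ∀ a ∈ A, HasFTaylorSeriesUpToOn n (K a) (p a) S)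
    (hc : ∀ m : ℕ, (m : ℕ∞) ≤ n →
      ContinuousOn (Function.uncurry fun a y => p a y m) (A ×ˢ S)) :
    ContDiffOn ℝ n (fun y => ∫ a in A, K a y ∂μ) S := by
  have hT : HasFTaylorSeriesUpToOn n (fun y => ∫ a in A, K a y ∂μ)
      (fun y m => ∫ a in A, p a y m ∂μ) S := by
    refine ⟨fun y hy => ?_, fun m hm y hy => ?_, fun m hm => ?_⟩
    · have hi := integrableOn_of_uncurry (μ := μ) (K := fun a y => p a y 0) hA
        (hc 0 (by simp)) hy
      rw [ContinuousMultilinearMap.curry0,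
        ContinuousMultilinearMap.integral_apply hi]
      refine setIntegral_congr_fun hA.measurableSet fun a ha => ?_
      exact (hp a ha).zero_eq y hy
    · have hm' : (m : ℕ∞) < n := by exact_mod_cast hm
      have hm1 : ((m + 1 : ℕ) : ℕ∞) ≤ n := by
        exact_mod_cast Order.add_one_le_of_lt hm'
      have h1 := hc m hm'.le
      have h2 := hc (m + 1) hm1
      have h2' : ContinuousOn (Function.uncurry fun a y => (p a y (m + 1)).curryLeft)
          (A ×ˢ S) :=
        (continuousMultilinearCurryLeftEquiv ℝ (fun _ : Fin (m + 1) => E) G).continuous.comp_continuousOn h2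
      obtain ⟨L, hL, hLx⟩ := hasFDerivWithinAt_setIntegral (μ := μ) hA hS h1 h2'
        (fun a ha y hy => (hp a ha).fderivWithin m hm y hy) hy
      have hLe : (∫ a in A, p a y (m + 1) ∂μ).curryLeft = L := by
        refine ContinuousLinearMap.ext fun x => ContinuousMultilinearMap.ext fun w => ?_
        have hi := integrableOn_of_uncurry (μ := μ) hA h2 hy
        have hi' : IntegrableOn (fun a => (p a y (m + 1)).curryLeft x) A μ := by
          refine ContinuousOn.integrableOn_compact hA ?_
          have := h2'.comp (Continuous.prodMk_left y).continuousOn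
            (fun a (ha : a ∈ A) => (⟨ha, hy⟩ : (a, y) ∈ A ×ˢ S))
          exact this.clm_apply continuousOn_const
        rw [hLx, ContinuousMultilinearMap.curryLeft_apply,
          ContinuousMultilinearMap.integral_apply hi, ContinuousMultilinearMap.integral_apply hi']
        rfl
      exact hLe.symm ▸ hL
    · exact continuousOn_setIntegral hA (hc m (by exact_mod_cast hm))
  exact hT.contDiffOn

/-- Integration over a compact set preserves joint smoothness on a product set. -/
lemma ContDiffOn.setIntegral {α : Type*} [NormedAddCommGroup α] [NormedSpace ℝ α]
    [MeasurableSpace α] [OpensMeasurableSpace α] {μ : Measure α} [IsFiniteMeasureOnCompacts μ]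
    {A : Set α} [CompleteSpace G] (hA : IsCompact A)
    (hS : Convex ℝ S) (hAS : UniqueDiffOn ℝ (A ×ˢ S)) {n : ℕ∞} {K : α × E → G}
    (hK : ContDiffOn ℝ n K (A ×ˢ S)) :
    ContDiffOn ℝ n (fun y => ∫ a in A, K (a, y) ∂μ) S := by
  have hq := hK.ftaylorSeriesWithin hAS
  obtain ⟨ι, hι, hιl⟩ : ∃ ι : α → E →ᴬ[ℝ] α × E, (∀ a y, ι a y = (a, y)) ∧
      ∀ a, (ι a).contLinear = ContinuousLinearMap.inr ℝ α E :=
    ⟨fun a => (ContinuousLinearMap.inr ℝ α E).toContinuousAffineMap +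
      ContinuousAffineMap.const ℝ E (a, 0), fun a y => by simp, fun a => by simp⟩
  refine contDiffOn_setIntegral (K := fun a y => K (a, y))
    (p := fun a y k => (ftaylorSeriesWithin ℝ K (A ×ˢ S) (a, y) k).compContinuousLinearMap
      fun _ => ContinuousLinearMap.inr ℝ α E) hA hS ?_ ?_
  · intro a ha
    have h := (hq.comp_continuousAffineMap (ι a)).mono (t := S) (fun y hy => by
      simpa [hι] using ⟨ha, hy⟩)
    have e1 : K ∘ ι a = fun y => K (a, y) := funext fun y => by simp [hι]
    simpa only [e1, hι, hιl] using h
  · intro m hm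
    exact (isBoundedLinearMap_continuousMultilinearMap_comp_linear
      (ContinuousLinearMap.inr ℝ α E)).continuous.comp_continuousOn
      (hq.cont m (by exact_mod_cast hm))

end ParametricIntegral

/-! ### Division by the variable, and inverse maps up to the boundary -/

/-- Hadamard's lemma on an interval, up to the end points: a smooth function that vanishes at `0`
is `y` times a smooth function. -/
lemma exists_eq_mul_of_contDiffOn {S : Set ℝ} (hS : Convex ℝ S) (hSu : UniqueDiffOn ℝ S)
    (h0 : (0 : ℝ) ∈ S) {f : ℝ → ℝ} (hf : ContDiffOn ℝ ∞ f S) (hf0 : f 0 = 0) :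
    ∃ h : ℝ → ℝ, ContDiffOn ℝ ∞ h S ∧ (∀ y ∈ S, f y = y * h y) ∧ h 0 = derivWithin f S 0 := by
  have hmem : ∀ t ∈ Icc (0 : ℝ) 1, ∀ y ∈ S, t * y ∈ S := fun t ht y hy => by
    have := hS.smul_mem_of_zero_mem h0 hy ht
    simpa using this
  have hd : ContDiffOn ℝ ∞ (derivWithin f S) S := hf.derivWithin hSu (by simp)
  refine ⟨fun y => ∫ t in Icc (0 : ℝ) 1, derivWithin f S (t * y), ?_, fun y hy => ?_, ?_⟩
  · refine ContDiffOn.setIntegral (K := fun q : ℝ × ℝ => derivWithin f S (q.1 * q.2))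
      isCompact_Icc hS ((uniqueDiffOn_Icc one_pos).prod hSu) ?_
    exact hd.comp (contDiff_fst.mul contDiff_snd).contDiffOn fun q hq => hmem _ hq.1 _ hq.2
  · have hcont : ContinuousOn (fun t : ℝ => derivWithin f S (t * y) * y) (Icc 0 1) :=
      (hd.continuousOn.comp (by fun_prop) fun t ht => hmem t ht y hy).mul continuousOn_const
    have h1 := intervalIntegral.integral_eq_sub_of_hasDerivAt_of_le (a := 0) (b := 1)
      (f := fun t => f (t * y)) (f' := fun t => derivWithin f S (t * y) * y) zero_le_one
      (hf.continuousOn.comp (by fun_prop) fun t ht => hmem t ht y hy) (fun t ht => ?_)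
      (hcont.intervalIntegrable_of_Icc zero_le_one)
    · rw [intervalIntegral.integral_of_le zero_le_one, ← integral_Icc_eq_integral_Ioc,
        integral_mul_const] at h1
      simp only [one_mul, zero_mul, hf0, sub_zero] at h1
      rw [← h1, mul_comm]
    · have e1 : HasDerivWithinAt f (derivWithin f S (t * y)) S (t * y) :=
        (hf.differentiableOn (by simp) _ (hmem t ⟨ht.1.le, ht.2.le⟩ y hy)).hasDerivWithinAt
      have e2 : HasDerivWithinAt (fun t : ℝ => t * y) y (Icc 0 1) t := by
        simpa using (hasDerivAt_id t).hasDerivWithinAt.mul_const y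
      exact (e1.comp t e2 fun s hs => hmem s hs y hy).hasDerivAt (Icc_mem_nhds ht.1 ht.2)
  · simp

/-- The inverse of a smooth bijection with invertible derivatives is smooth as soon as it is
continuous; the source and the target need not be open. -/
lemma contDiffOn_symm_of_fderivWithin {E F : Type*} [NormedAddCommGroup E] [NormedSpace ℝ E]
    [NormedAddCommGroup F] [NormedSpace ℝ F] [CompleteSpace E] (χ : PartialEquiv E F)
    (hs : UniqueDiffOn ℝ χ.source) (ht : UniqueDiffOn ℝ χ.target)
    (hχ : ContDiffOn ℝ ∞ χ χ.source) (hc : ContinuousOn χ.symm χ.target)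
    (hinv : ∀ x ∈ χ.source, ∃ e : E ≃L[ℝ] F, fderivWithin ℝ χ χ.source x = e) :
    ContDiffOn ℝ ∞ χ.symm χ.target := by
  have hd : ∀ y ∈ χ.target, HasFDerivWithinAt χ.symm
      ((fderivWithin ℝ χ χ.source (χ.symm y)).inverse) χ.target y := by
    intro y hy
    obtain ⟨e, he⟩ := hinv _ (χ.map_target hy)
    rw [he, ContinuousLinearMap.inverse_equiv]
    refine HasFDerivWithinAt.of_local_left_inverse (f := χ) (f' := e) (t := χ.source) ?_ ?_ hy ?_
    · exact (hc y hy).tendsto_nhdsWithin fun z hz => χ.map_target hz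
    · rw [← he]
      exact (hχ.differentiableOn (by simp) _ (χ.map_target hy)).hasFDerivWithinAt
    · filter_upwards [self_mem_nhdsWithin] with z hz using χ.right_inv hz
  rw [contDiffOn_infty]
  intro k
  induction k with
  | zero => simpa using hc
  | succ k ih =>
    push_cast
    rw [contDiffOn_succ_iff_hasFDerivWithinAt_of_uniqueDiffOn ht]
    refine ⟨by simp, _, ?_, hd⟩
    intro y hy
    obtain ⟨e, he⟩ := hinv _ (χ.map_target hy)
    have h1 : ContDiffWithinAt ℝ k (fun y => fderivWithin ℝ χ χ.source (χ.symm y)) χ.target y :=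
      ((hχ.fderivWithin hs (m := k) (by exact_mod_cast le_top)).comp ih
        fun z hz => χ.map_target hz) y hy
    have h2 : ContDiffAt ℝ k ContinuousLinearMap.inverse
        (fderivWithin ℝ χ χ.source (χ.symm y)) := by
      rw [he]; exact contDiffAt_map_inverse e
    exact h2.comp_contDiffWithinAt y h1

/-! ### Uniform bounds for the derivatives of a group of smooth maps -/

section SmoothAction

variable {P E : Type*} [NormedAddCommGroup P] [NormedSpace ℝ P]
  [NormedAddCommGroup E] [NormedSpace ℝ E]

lemma contDiffOn_iteratedFDeriv {G : Type*} [NormedAddCommGroup G] [NormedSpace ℝ G]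
    {K : P → E → G} {U : Set E} (hU : IsOpen U)
    (hK : ContDiffOn ℝ ∞ (Function.uncurry K) (univ ×ˢ U)) (m : ℕ) :
    ContDiffOn ℝ ∞ (Function.uncurry fun a y => iteratedFDeriv ℝ m (K a) y) (univ ×ˢ U) := by
  have hO : IsOpen ((univ : Set P) ×ˢ U) := isOpen_univ.prod hU
  induction m with
  | zero =>
    exact (continuousMultilinearCurryFin0 ℝ E G).symm.toContinuousLinearEquiv.contDiff.comp_contDiffOn hK
  | succ m ih =>
    have h1 : ContDiffOn ℝ ∞
        (fun q : P × E => fderiv ℝ (iteratedFDeriv ℝ m (K q.1)) q.2) (univ ×ˢ U) := by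
      intro q hq
      refine (ContDiffAt.fderiv (n := ∞) (f := fun q : P × E => iteratedFDeriv ℝ m (K q.1))
        (g := Prod.snd) ?_ contDiffAt_snd (by simp)).contDiffWithinAt
      exact ContDiffAt.comp (g := Function.uncurry fun a y => iteratedFDeriv ℝ m (K a) y)
        (f := fun z : (P × E) × E => (z.1.1, z.2)) (q, q.2)
        (ih.contDiffAt (hO.mem_nhds hq)) (by fun_prop)
    exact (continuousMultilinearCurryLeftEquiv ℝ (fun _ : Fin (m + 1) => E)
      G).symm.toContinuousLinearEquiv.contDiff.comp_contDiffOn h1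

/-- An action of the additive group `P` by smooth maps of `S` that is jointly smooth on the
interior of `S`. -/
structure SmoothAction (T : P → E → E) (S : Set E) : Prop where
  contDiffOn : ∀ a, ContDiffOn ℝ ∞ (T a) S
  mapsTo : ∀ a, MapsTo (T a) S S
  mapsTo_interior : ∀ a, MapsTo (T a) (interior S) (interior S)
  add : ∀ a b, ∀ v ∈ S, T (a + b) v = T a (T b v)
  joint : ContDiffOn ℝ ∞ (Function.uncurry T) (univ ×ˢ interior S)

lemma exists_bound_iteratedFDeriv {G : Type*} [NormedAddCommGroup G] [NormedSpace ℝ G]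
    {S : Set E} (hS : IsCompact S) (hSu : UniqueDiffOn ℝ S) {f : E → G}
    (hf : ContDiffOn ℝ ∞ f S) (m : ℕ) :
    ∃ C : ℝ, ∀ j ≤ m, ∀ v ∈ interior S, ‖iteratedFDeriv ℝ j f v‖ ≤ C := by
  have h1 : ∀ j : ℕ, ∃ C : ℝ, ∀ v ∈ interior S, ‖iteratedFDeriv ℝ j f v‖ ≤ C := by
    intro j
    obtain ⟨C, hC⟩ := hS.exists_bound_of_continuousOn
      (hf.continuousOn_iteratedFDerivWithin (m := j) (by exact_mod_cast le_top) hSu)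
    refine ⟨C, fun v hv => ?_⟩
    have hv' := mem_interior_iff_mem_nhds.1 hv
    rw [← iteratedFDerivWithin_eq_iteratedFDeriv hSu
      ((hf.contDiffAt hv').of_le (by exact_mod_cast le_top)) (interior_subset hv)]
    exact hC v (interior_subset hv)
  choose C hC using h1
  refine ⟨∑ j ∈ Finset.range (m + 1), |C j|, fun j hj v hv => (hC j v hv).trans ?_⟩
  exact (le_abs_self _).trans (Finset.single_le_sum (f := fun j => |C j|)
    (fun _ _ => abs_nonneg _) (Finset.mem_range.2 (by omega)))

lemma norm_iteratedFDeriv_comp_le_of_isOpen {G : Type*} [NormedAddCommGroup G] [NormedSpace ℝ G]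
    {U : Set E} (hU : IsOpen U) {f : E → E} {g : E → G} (hf : ContDiffOn ℝ ∞ f U)
    (hg : ContDiffOn ℝ ∞ g U) (hm : MapsTo f U U) {m : ℕ} {C D : ℝ} (hD : 1 ≤ D)
    (hgC : ∀ j ≤ m, ∀ v ∈ U, ‖iteratedFDeriv ℝ j g v‖ ≤ C)
    (hfD : ∀ j ≤ m, ∀ v ∈ U, ‖iteratedFDeriv ℝ j f v‖ ≤ D) :
    ∀ j ≤ m, ∀ v ∈ U, ‖iteratedFDeriv ℝ j (g ∘ f) v‖ ≤ m.factorial * C * D ^ m := by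
  intro j hj v hv
  have hC : 0 ≤ C := (norm_nonneg _).trans (hgC 0 (Nat.zero_le _) v hv)
  have h := norm_iteratedFDerivWithin_comp_le (n := j) (C := C) (D := D) hg hf
    (by exact_mod_cast le_top) hU.uniqueDiffOn hU.uniqueDiffOn hm hv
    (fun i hi => by
      rw [iteratedFDerivWithin_of_isOpen i hU (hm hv)]
      exact hgC i (hi.trans hj) _ (hm hv))
    (fun i hi1 hi => by
      rw [iteratedFDerivWithin_of_isOpen i hU hv]
      exact (hfD i (hi.trans hj) _ hv).trans (le_self_pow₀ hD (by omega)))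
  rw [iteratedFDerivWithin_of_isOpen j hU hv] at h
  refine h.trans ?_
  gcongr

/-- The derivatives of the maps of a smooth action are bounded, locally uniformly in the group.
Baire's theorem gives a bound on some open subset of the group, and the group law carries it
everywhere. -/
lemma SmoothAction.exists_bound [CompleteSpace P] {T : P → E → E} {S : Set E}
    (hT : SmoothAction T S) (hS : IsCompact S) (hSu : UniqueDiffOn ℝ S) {A : Set P}
    (hA : IsCompact A) (m : ℕ) :
    ∃ C : ℝ, 1 ≤ C ∧ ∀ a ∈ A, ∀ j ≤ m, ∀ v ∈ interior S, ‖iteratedFDeriv ℝ j (T a) v‖ ≤ C := by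
  set U := interior S with hUdef
  have hU : IsOpen U := isOpen_interior
  let e : ℕ → Set P := fun N => {a | ∀ j ≤ m, ∀ v ∈ U, ‖iteratedFDeriv ℝ j (T a) v‖ ≤ N}
  have hclosed : ∀ N, IsClosed (e N) := by
    intro N
    simp only [e, ofPred_forall]
    refine isClosed_iInter fun j => isClosed_iInter fun _ => isClosed_iInter fun v =>
      isClosed_iInter fun hv => isClosed_le ?_ continuous_const
    have h1 := (contDiffOn_iteratedFDeriv hU hT.joint j).continuousOn
    have h2 : Continuous fun a => iteratedFDeriv ℝ j (T a) v := by
      rw [← continuousOn_univ]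
      exact h1.comp (f := fun a => (a, v)) (by fun_prop) fun a _ => ⟨mem_univ _, hv⟩
    exact h2.norm
  have hcover : ⋃ N, e N = univ := by
    refine eq_univ_of_forall fun a => ?_
    obtain ⟨C, hC⟩ := exists_bound_iteratedFDeriv hS hSu (hT.contDiffOn a) m
    obtain ⟨N, hN⟩ := exists_nat_ge C
    exact mem_iUnion.2 ⟨N, fun j hj v hv => (hC j hj v hv).trans hN⟩
  obtain ⟨N, a₀, ha₀⟩ := nonempty_interior_of_iUnion_of_closed hclosed hcover
  have hfU : ∀ a, ContDiffOn ℝ ∞ (T a) U := fun a => (hT.contDiffOn a).mono interior_subset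
  refine hA.induction_on
    (p := fun A => ∃ C : ℝ, 1 ≤ C ∧ ∀ a ∈ A, ∀ j ≤ m, ∀ v ∈ U, ‖iteratedFDeriv ℝ j (T a) v‖ ≤ C)
    ⟨1, le_rfl, by simp⟩ ?_ ?_ ?_
  · rintro s t hst ⟨C, h1, hC⟩
    exact ⟨C, h1, fun a ha => hC a (hst ha)⟩
  · rintro s t ⟨C, h1, hC⟩ ⟨D, h1', hD⟩
    refine ⟨max C D, h1.trans (le_max_left _ _), fun a ha j hj v hv => ?_⟩
    rcases ha with ha | ha
    · exact (hC a ha j hj v hv).trans (le_max_left _ _)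
    · exact (hD a ha j hj v hv).trans (le_max_right _ _)
  · intro b _
    obtain ⟨C, hC⟩ := exists_bound_iteratedFDeriv hS hSu (hT.contDiffOn (b - a₀)) m
    refine ⟨{a | a - b + a₀ ∈ interior (e N)}, mem_nhdsWithin_of_mem_nhds ?_,
      max 1 (m.factorial * C * (max 1 (N : ℝ)) ^ m), le_max_left _ _, ?_⟩
    · refine (isOpen_interior.preimage (by fun_prop : Continuous fun a => a - b + a₀)).mem_nhds ?_
      simpa using ha₀
    · intro a ha j hj v hv
      have ha' := interior_subset ha
      have hb := norm_iteratedFDeriv_comp_le_of_isOpen hU (hfU (a - b + a₀)) (hfU (b - a₀))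
        (hT.mapsTo_interior _) (le_max_left 1 (N : ℝ)) (fun j hj v hv => hC j hj v hv)
        (fun j hj v hv => (ha' j hj v hv).trans (le_max_right _ _)) j hj v hv
      have heq : EqOn (T a) (T (b - a₀) ∘ T (a - b + a₀)) U := fun w hw => by
        have := hT.add (b - a₀) (a - b + a₀) w (interior_subset hw)
        rw [show b - a₀ + (a - b + a₀) = a by abel] at this
        exact this
      rw [← iteratedFDerivWithin_of_isOpen j hU hv, iteratedFDerivWithin_congr heq hv,
        iteratedFDerivWithin_of_isOpen j hU hv]
      exact hb.trans (le_max_right _ _)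

lemma subset_closure_interior {S : Set E} (hS : Convex ℝ S) (hne : (interior S).Nonempty) :
    S ⊆ closure (interior S) := by
  rw [hS.closure_interior_eq_closure_of_nonempty_interior hne]
  exact subset_closure

/-- Integration over a compact set of parameters: a family of functions that is smooth up to the
boundary for each parameter, with bounds on each derivative that are uniform in the parameter,
has a smooth integral. Continuity in the parameter is only required in the interior. -/
lemma contDiffOn_setIntegral_of_bounds {α G : Type*} [TopologicalSpace α] [T2Space α]
    [MeasurableSpace α] [OpensMeasurableSpace α] {μ : Measure α} [IsFiniteMeasureOnCompacts μ]
    [NormedAddCommGroup G] [NormedSpace ℝ G] [CompleteSpace G] {A : Set α} (hA : IsCompact A)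
    {S : Set E} (hS : Convex ℝ S) (hne : (interior S).Nonempty) {K : α → E → G}
    (hK : ∀ a ∈ A, ContDiffOn ℝ ∞ (K a) S)
    (hb : ∀ m : ℕ, ∃ C : ℝ, ∀ a ∈ A, ∀ v ∈ interior S, ‖iteratedFDeriv ℝ m (K a) v‖ ≤ C)
    (hc : ∀ m : ℕ, ∀ v ∈ interior S, ContinuousOn (fun a => iteratedFDeriv ℝ m (K a) v) A) :
    ContDiffOn ℝ ∞ (fun v => ∫ a in A, K a v ∂μ) S := by
  have hSu : UniqueDiffOn ℝ S := uniqueDiffOn_convex hS hne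
  have hcl := subset_closure_interior hS hne
  have heq : ∀ m : ℕ, ∀ a ∈ A, ∀ v ∈ interior S,
      iteratedFDerivWithin ℝ m (K a) S v = iteratedFDeriv ℝ m (K a) v := fun m a ha v hv =>
    iteratedFDerivWithin_eq_iteratedFDeriv hSu
      (((hK a ha).contDiffAt (mem_interior_iff_mem_nhds.1 hv)).of_le (by exact_mod_cast le_top))
      (interior_subset hv)
  have hcont : ∀ m : ℕ, ∀ a ∈ A, ContinuousOn (iteratedFDerivWithin ℝ m (K a) S) S :=
    fun m a ha => (hK a ha).continuousOn_iteratedFDerivWithin (by exact_mod_cast le_top) hSu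
  have hbS : ∀ m : ℕ, ∃ C : ℝ, 0 ≤ C ∧
      ∀ a ∈ A, ∀ v ∈ S, ‖iteratedFDerivWithin ℝ m (K a) S v‖ ≤ C := by
    intro m
    obtain ⟨C, hC⟩ := hb m
    refine ⟨max C 0, le_max_right _ _, fun a ha v hv => ?_⟩
    have hcw : ContinuousWithinAt (fun v => ‖iteratedFDerivWithin ℝ m (K a) S v‖) (interior S) v :=
      ((hcont m a ha).norm v hv).mono interior_subset
    have hmem := hcw.mem_closure_image (hcl hv)
    refine closure_minimal ?_ isClosed_Iic hmem
    rintro _ ⟨w, hw, rfl⟩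
    simp only [heq m a ha w hw]
    exact (hC a ha w hw).trans (le_max_left _ _)
  refine contDiffOn_setIntegral (n := ⊤) hA hS
    (p := fun a => ftaylorSeriesWithin ℝ (K a) S)
    (fun a ha => (hK a ha).ftaylorSeriesWithin hSu) fun m _ => ?_
  obtain ⟨C, hC0, hC⟩ := hbS (m + 1)
  have hlip : ∀ a ∈ A, ∀ v ∈ S, ∀ w ∈ S, ‖iteratedFDerivWithin ℝ m (K a) S v -
      iteratedFDerivWithin ℝ m (K a) S w‖ ≤ C * ‖v - w‖ := by
    intro a ha v hv w hw
    refine hS.norm_image_sub_le_of_norm_fderivWithin_le (𝕜 := ℝ) ?_ (fun x hx => ?_) hw hv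
    · exact (hK a ha).differentiableOn_iteratedFDerivWithin
        (by exact_mod_cast ENat.natCast_lt_top m) hSu
    · rw [norm_fderivWithin_iteratedFDerivWithin]
      exact hC a ha x hx
  rintro ⟨a₀, v₀⟩ ⟨ha₀, hv₀⟩
  rw [Metric.continuousWithinAt_iff']
  intro ε hε
  have hδ : 0 < ε / (4 * (C + 1)) := by positivity
  obtain ⟨v₁, hv₁, hd₁⟩ := Metric.mem_closure_iff.1 (hcl hv₀) _ hδ
  have h1 := Metric.continuousWithinAt_iff'.1 (hc m v₁ hv₁ a₀ ha₀) (ε / 4) (by positivity)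
  rw [eventually_nhdsWithin_iff] at h1
  rw [eventually_nhdsWithin_iff, nhds_prod_eq]
  filter_upwards [h1.prod_inl (𝓝 v₀), (Metric.ball_mem_nhds v₀ hδ : _ ∈ 𝓝 v₀) |>
    fun h => (Filter.Eventually.prod_inr h (𝓝 a₀))] with q hq1 hq2 hq
  have e1 := hlip q.1 hq.1 q.2 hq.2 v₁ (interior_subset hv₁)
  have e2 := hlip a₀ ha₀ v₁ (interior_subset hv₁) v₀ hv₀
  have e3 := hq1 hq.1
  rw [← heq m _ hq.1 _ hv₁, ← heq m _ ha₀ _ hv₁, dist_eq_norm] at e3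
  have hq2' : ‖q.2 - v₀‖ < ε / (4 * (C + 1)) := by rw [← dist_eq_norm]; exact hq2
  have hd1' : ‖v₁ - v₀‖ < ε / (4 * (C + 1)) := by rw [← dist_eq_norm, dist_comm]; exact hd₁
  have e4 : ‖q.2 - v₁‖ ≤ ‖q.2 - v₀‖ + ‖v₁ - v₀‖ := by
    rw [show q.2 - v₁ = (q.2 - v₀) - (v₁ - v₀) by abel]; exact norm_sub_le _ _
  have e5 : C * (ε / (4 * (C + 1))) ≤ ε / 4 := by
    rw [mul_div_assoc', div_le_div_iff₀ (by positivity) (by positivity)]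
    nlinarith
  have e6 : C * ‖q.2 - v₁‖ ≤ ε / 4 + ε / 4 := by
    calc C * ‖q.2 - v₁‖ ≤ C * (ε / (4 * (C + 1)) + ε / (4 * (C + 1))) := by
          gcongr; linarith
      _ ≤ _ := by linarith
  have e7 : C * ‖v₁ - v₀‖ ≤ ε / 4 := (mul_le_mul_of_nonneg_left hd1'.le hC0).trans e5
  show dist (iteratedFDerivWithin ℝ m (K q.1) S q.2) (iteratedFDerivWithin ℝ m (K a₀) S v₀) < ε
  calc _ ≤ dist (iteratedFDerivWithin ℝ m (K q.1) S q.2) (iteratedFDerivWithin ℝ m (K q.1) S v₁)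
        + dist (iteratedFDerivWithin ℝ m (K q.1) S v₁) (iteratedFDerivWithin ℝ m (K a₀) S v₁)
        + dist (iteratedFDerivWithin ℝ m (K a₀) S v₁) (iteratedFDerivWithin ℝ m (K a₀) S v₀) :=
        dist_triangle4 _ _ _ _
    _ < ε := by simp only [dist_eq_norm]; linarith

/-- Averages of a smooth function over a smooth action are smooth up to the boundary. -/
lemma SmoothAction.contDiffOn_average [CompleteSpace P] [MeasurableSpace P]
    [OpensMeasurableSpace P] {μ : Measure P} [IsFiniteMeasureOnCompacts μ] {T : P → E → E}
    {S : Set E} (hT : SmoothAction T S) (hS : IsCompact S) (hSc : Convex ℝ S)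
    (hne : (interior S).Nonempty) {A : Set P} (hA : IsCompact A) {w : P → ℝ}
    (hw : Continuous w) {ψ : E → ℝ} (hψ : ContDiffOn ℝ ∞ ψ S) :
    ContDiffOn ℝ ∞ (fun v => ∫ a in A, w a • ψ (T a v) ∂μ) S := by
  have hSu : UniqueDiffOn ℝ S := uniqueDiffOn_convex hSc hne
  have hK : ∀ a, ContDiffOn ℝ ∞ (fun v => ψ (T a v)) S := fun a =>
    hψ.comp (hT.contDiffOn a) (hT.mapsTo a)
  have hsm : ∀ a, ∀ m : ℕ, ∀ v ∈ interior S, iteratedFDeriv ℝ m (fun v => w a • ψ (T a v)) v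
      = w a • iteratedFDeriv ℝ m (fun v => ψ (T a v)) v := fun a m v hv =>
    iteratedFDeriv_const_smul_apply' (((hK a).contDiffAt
      (mem_interior_iff_mem_nhds.1 hv)).of_le (by exact_mod_cast le_top))
  refine contDiffOn_setIntegral_of_bounds hA hSc hne (fun a _ => (hK a).const_smul (w a)) ?_ ?_
  · intro m
    obtain ⟨D, hD1, hD⟩ := hT.exists_bound hS hSu hA m
    obtain ⟨C, hC⟩ := exists_bound_iteratedFDeriv hS hSu hψ m
    obtain ⟨M, hM⟩ := hA.exists_bound_of_continuousOn hw.continuousOn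
    refine ⟨M * (m.factorial * C * D ^ m), fun a ha v hv => ?_⟩
    rw [hsm a m v hv, norm_smul]
    have := norm_iteratedFDeriv_comp_le_of_isOpen isOpen_interior
      ((hT.contDiffOn a).mono interior_subset) (hψ.mono interior_subset) (hT.mapsTo_interior a) hD1
      hC (hD a ha) m le_rfl v hv
    exact mul_le_mul (hM a ha) this (norm_nonneg _) ((norm_nonneg _).trans (hM a ha))
  · intro m v hv
    have h1 : ContDiffOn ℝ ∞ (Function.uncurry fun a v => ψ (T a v)) (univ ×ˢ interior S) :=
      (hψ.mono interior_subset).comp hT.joint fun q hq => hT.mapsTo_interior q.1 hq.2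
    have h2 := (contDiffOn_iteratedFDeriv isOpen_interior h1 m).continuousOn
    have h3 : Continuous fun a => iteratedFDeriv ℝ m (fun v => ψ (T a v)) v := by
      rw [← continuousOn_univ]
      exact h2.comp (f := fun a => (a, v)) (by fun_prop) fun a _ => ⟨mem_univ _, hv⟩
    refine ((hw.smul h3).congr fun a => ?_).continuousOn
    exact (hsm a m v hv).symm

/-- The maps of a smooth action are Lipschitz, locally uniformly in the group. -/
lemma SmoothAction.exists_lipschitz [CompleteSpace P] {T : P → E → E} {S : Set E}
    (hT : SmoothAction T S) (hS : IsCompact S) (hSc : Convex ℝ S)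
    (hne : (interior S).Nonempty) {A : Set P} (hA : IsCompact A) :
    ∃ C : ℝ, 1 ≤ C ∧ ∀ a ∈ A, ∀ v ∈ S, ∀ w ∈ S, ‖T a v - T a w‖ ≤ C * ‖v - w‖ := by
  have hSu : UniqueDiffOn ℝ S := uniqueDiffOn_convex hSc hne
  obtain ⟨C, hC1, hC⟩ := hT.exists_bound hS hSu hA 1
  refine ⟨C, hC1, fun a ha v hv w hw => ?_⟩
  have hd := (hT.contDiffOn a).differentiableOn (by simp)
  refine hSc.norm_image_sub_le_of_norm_fderivWithin_le (𝕜 := ℝ) hd (fun x hx => ?_) hw hv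
  have hcw : ContinuousWithinAt (fun v => ‖fderivWithin ℝ (T a) S v‖) (interior S) x :=
    (((hT.contDiffOn a).continuousOn_fderivWithin hSu (by simp)).norm x hx).mono interior_subset
  refine closure_minimal ?_ isClosed_Iic
    (hcw.mem_closure_image (subset_closure_interior hSc hne hx))
  rintro _ ⟨y, hy, rfl⟩
  simp only [fderivWithin_of_mem_nhds (mem_interior_iff_mem_nhds.1 hy)]
  have := hC a ha 1 le_rfl y hy
  rwa [← norm_iteratedFDeriv_fderiv, norm_iteratedFDeriv_zero] at this

end SmoothAction

/-! ### Profiles and their scaling flow -/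

namespace IsProfile

variable {f : PartialEquiv ℝ ℝ}

lemma mapsTo (hf : IsProfile f) {y : ℝ} (hy : 0 ≤ y) : 0 ≤ f y := by
  have h := f.map_source (x := y) (by rw [hf.isHomeo.source_eq]; exact hy)
  rwa [hf.isHomeo.target_eq] at h

lemma mapsTo_symm (hf : IsProfile f) {y : ℝ} (hy : 0 ≤ y) : 0 ≤ f.symm y := by
  have h := f.map_target (x := y) (by rw [hf.isHomeo.target_eq]; exact hy)
  rwa [hf.isHomeo.source_eq] at h

lemma left_inv (hf : IsProfile f) {y : ℝ} (hy : 0 ≤ y) : f.symm (f y) = y :=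
  f.left_inv (by rw [hf.isHomeo.source_eq]; exact hy)

lemma right_inv (hf : IsProfile f) {y : ℝ} (hy : 0 ≤ y) : f (f.symm y) = y :=
  f.right_inv (by rw [hf.isHomeo.target_eq]; exact hy)

lemma pos (hf : IsProfile f) {y : ℝ} (hy : 0 < y) : 0 < f y := by
  have : f y ∈ f '' Ioi 0 := mem_image_of_mem _ hy
  rwa [hf.image_Ioi] at this

lemma apply_zero (hf : IsProfile f) : f 0 = 0 := by
  by_contra h
  have h1 : f 0 ∈ Ioi (0 : ℝ) := lt_of_le_of_ne (hf.mapsTo le_rfl) (Ne.symm h)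
  rw [← hf.image_Ioi] at h1
  obtain ⟨y, hy, hy0⟩ := h1
  have := congrArg f.symm hy0
  rw [hf.left_inv (le_of_lt hy), hf.left_inv le_rfl] at this
  exact (ne_of_gt hy) this

lemma symm_pos (hf : IsProfile f) {y : ℝ} (hy : 0 < y) : 0 < f.symm y := by
  refine lt_of_le_of_ne (hf.mapsTo_symm hy.le) fun h => ?_
  have := hf.right_inv hy.le
  rw [← h, hf.apply_zero] at this
  exact hy.ne this

lemma contDiffAt (hf : IsProfile f) {y : ℝ} (hy : 0 < y) : ContDiffAt ℝ ∞ f y :=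
  hf.contDiffOn.contDiffAt (Ici_mem_nhds hy)

lemma contDiffAt_symm (hf : IsProfile f) {y : ℝ} (hy : 0 < y) : ContDiffAt ℝ ∞ f.symm y :=
  hf.contDiffOn_symm.contDiffAt (Ioi_mem_nhds hy)

lemma hasDerivAt (hf : IsProfile f) {y : ℝ} (hy : 0 < y) : HasDerivAt f (deriv f y) y :=
  ((hf.contDiffAt hy).differentiableAt (by simp)).hasDerivAt

lemma deriv_ne_zero (hf : IsProfile f) {y : ℝ} (hy : 0 < y) : deriv f y ≠ 0 := by
  intro h
  have h1 := hf.hasDerivAt hy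
  have h2 := ((hf.contDiffAt_symm (hf.pos hy)).differentiableAt (by simp)).hasDerivAt
  have h3 := h2.comp y h1
  have h4 : HasDerivAt (f.symm ∘ f) 1 y := by
    refine (hasDerivAt_id y).congr_of_eventuallyEq ?_
    filter_upwards [Ioi_mem_nhds hy] with z hz using hf.left_inv (le_of_lt hz)
  have := h3.unique h4
  rw [h, mul_zero] at this
  exact zero_ne_one this

lemma continuousOn_deriv (hf : IsProfile f) : ContinuousOn (deriv f) (Ioi 0) := by
  have h := (hf.contDiffOn.mono Ioi_subset_Ici_self).continuousOn_deriv_of_isOpen isOpen_Ioi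
    (by simp)
  exact h

lemma deriv_pos (hf : IsProfile f) {y : ℝ} (hy : 0 < y) : 0 < deriv f y := by
  obtain ⟨z, hz, hz'⟩ := exists_deriv_eq_slope f (zero_lt_one (α := ℝ))
    (hf.contDiffOn.continuousOn.mono Icc_subset_Ici_self)
    (fun z hz => ((hf.contDiffAt hz.1).differentiableAt (by simp)).differentiableWithinAt)
  have hz1 : 0 < deriv f z := by
    rw [hz', hf.apply_zero]; simpa using hf.pos one_pos
  by_contra hneg
  obtain ⟨x, hx, hx0⟩ := isPreconnected_Ioi.intermediate_value (mem_Ioi.2 hy) (mem_Ioi.2 hz.1)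
    hf.continuousOn_deriv (⟨not_lt.1 hneg, hz1.le⟩ : (0 : ℝ) ∈ Icc (deriv f y) (deriv f z))
  exact hf.deriv_ne_zero hx hx0

lemma strictMonoOn (hf : IsProfile f) : StrictMonoOn f (Ici 0) :=
  strictMonoOn_of_deriv_pos (convex_Ici 0) hf.contDiffOn.continuousOn
    fun x hx => hf.deriv_pos (by simpa using hx)

lemma hasDerivAt_symm (hf : IsProfile f) {y : ℝ} (hy : 0 < y) :
    HasDerivAt f.symm (deriv f (f.symm y))⁻¹ y := by
  refine HasDerivAt.of_local_left_inverse (f := f) (f' := deriv f (f.symm y))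
    (hf.contDiffAt_symm hy).continuousAt (hf.hasDerivAt (hf.symm_pos hy))
    (hf.deriv_ne_zero (hf.symm_pos hy)) ?_
  filter_upwards [Ioi_mem_nhds hy] with z hz using hf.right_inv (le_of_lt hz)

end IsProfile

/-- The scaling flow `(s, w) ↦ f⁻¹ (eˢ f w)` of a profile, generated by the vector field
`f / f'` of the half-line. -/
def scaleFlow (f : PartialEquiv ℝ ℝ) (q : ℝ × ℝ) : ℝ := f.symm (Real.exp q.1 * f q.2)

namespace IsProfile

variable {f : PartialEquiv ℝ ℝ}

lemma apply_scaleFlow (hf : IsProfile f) (s : ℝ) {w : ℝ} (hw : 0 ≤ w) :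
    f (scaleFlow f (s, w)) = Real.exp s * f w :=
  hf.right_inv (mul_nonneg (Real.exp_pos _).le (hf.mapsTo hw))

lemma scaleFlow_nonneg (hf : IsProfile f) (s : ℝ) {w : ℝ} (hw : 0 ≤ w) :
    0 ≤ scaleFlow f (s, w) :=
  hf.mapsTo_symm (mul_nonneg (Real.exp_pos _).le (hf.mapsTo hw))

lemma scaleFlow_pos (hf : IsProfile f) (s : ℝ) {w : ℝ} (hw : 0 < w) :
    0 < scaleFlow f (s, w) :=
  hf.symm_pos (mul_pos (Real.exp_pos _) (hf.pos hw))

lemma hasDerivAt_scaleFlow (hf : IsProfile f) (s : ℝ) {w : ℝ} (hw : 0 < w) :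
    HasDerivAt (fun s => scaleFlow f (s, w))
      (f (scaleFlow f (s, w)) / deriv f (scaleFlow f (s, w))) s := by
  have h1 := hf.hasDerivAt_symm (mul_pos (Real.exp_pos s) (hf.pos hw))
  have h2 := h1.comp s ((Real.hasDerivAt_exp s).mul_const (f w))
  rw [hf.apply_scaleFlow s hw.le, div_eq_inv_mul]
  exact h2

lemma scaleFlow_zero (hf : IsProfile f) {w : ℝ} (hw : 0 ≤ w) : scaleFlow f (0, w) = w := by
  simp [scaleFlow, hf.left_inv hw]

lemma continuousOn_scaleFlow (hf : IsProfile f) :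
    ContinuousOn (scaleFlow f) (univ ×ˢ Ici 0) := by
  refine hf.isHomeo.continuousOn_symm.comp (t := Ici 0) ?_ fun q hq =>
    mul_nonneg (Real.exp_pos _).le (hf.mapsTo hq.2)
  exact (Real.continuous_exp.comp continuous_fst).continuousOn.mul
    (hf.isHomeo.continuousOn.comp continuousOn_snd fun q hq => hq.2)

/-- The scaling flow is smooth up to the boundary when its generator `f / f'` is: its derivatives
are `q (g)` in time and `exp ∫₀ˢ q' (g)` in space, so that each order of differentiability yields
the next one. -/
lemma contDiffOn_scaleFlow (hf : IsProfile f) (hq : QuotientSmooth f) :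
    ContDiffOn ℝ ∞ (scaleFlow f) (univ ×ˢ Ici 0) := by
  obtain ⟨q, hq, hqf⟩ := hq
  have hpos : ∀ y > 0, 0 < q y := fun y hy => by
    rw [hqf y hy]; exact div_pos (hf.pos hy) (hf.deriv_pos hy)
  set g := scaleFlow f with hg
  set q' := derivWithin q (Ici 0) with hq'
  have hq's : ContDiffOn ℝ ∞ q' (Ici 0) := hq.derivWithin (uniqueDiffOn_Ici 0) (by simp)
  let I : ℝ × ℝ → ℝ := fun x => ∫ u in Icc (0 : ℝ) 1, x.1 * q' (g (u * x.1, x.2))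
  let L : ℝ × ℝ → ℝ × ℝ →L[ℝ] ℝ := fun x =>
    q (g x) • ContinuousLinearMap.fst ℝ ℝ ℝ + Real.exp (I x) • ContinuousLinearMap.snd ℝ ℝ ℝ
  have hΩc : Convex ℝ ((univ : Set ℝ) ×ˢ Ici (0 : ℝ)) := convex_univ.prod (convex_Ici 0)
  have hΩu : UniqueDiffOn ℝ ((univ : Set ℝ) ×ˢ Ici (0 : ℝ)) :=
    uniqueDiffOn_univ.prod (uniqueDiffOn_Ici 0)
  have hgm : MapsTo g (univ ×ˢ Ici 0) (Ici 0) := fun x hx => hf.scaleFlow_nonneg x.1 hx.2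
  have hLsmooth : ∀ k : ℕ, ContDiffOn ℝ k g (univ ×ˢ Ici 0) →
      ContDiffOn ℝ k L (univ ×ˢ Ici 0) := by
    intro k hk
    have hkt : (k : WithTop ℕ∞) ≤ ∞ := by exact_mod_cast le_top
    have hI : ContDiffOn ℝ k I (univ ×ˢ Ici 0) := by
      refine ContDiffOn.setIntegral (n := k)
        (K := fun x : ℝ × ℝ × ℝ => x.2.1 * q' (g (x.1 * x.2.1, x.2.2)))
        isCompact_Icc hΩc ((uniqueDiffOn_Icc one_pos).prod hΩu) ?_
      refine ContDiffOn.mul (by fun_prop) ((hq's.of_le hkt).comp (t := Ici 0)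
        (hk.comp (t := univ ×ˢ Ici 0) (f := fun x : ℝ × ℝ × ℝ => (x.1 * x.2.1, x.2.2))
          (by fun_prop) fun x hx => ⟨mem_univ _, hx.2.2⟩) fun x hx => ?_)
      exact hf.scaleFlow_nonneg _ hx.2.2
    exact (((hq.of_le hkt).comp hk hgm).smul contDiffOn_const).add
      ((Real.contDiff_exp.comp_contDiffOn hI).smul contDiffOn_const)
  have hint : ∀ x ∈ (univ : Set ℝ) ×ˢ Ioi (0 : ℝ), HasFDerivAt g (L x) x := by
    rintro ⟨s, w⟩ ⟨-, hw⟩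
    have hw' : 0 < w := hw
    have hgp : ∀ s, 0 < g (s, w) := fun s => hf.scaleFlow_pos s hw'
    have hfg : ∀ s, f (g (s, w)) = Real.exp s * f w := fun s => hf.apply_scaleFlow s hw'.le
    have hqg : ∀ s, q (g (s, w)) = Real.exp s * f w / deriv f (g (s, w)) := fun s => by
      rw [hqf _ (hgp s), hfg]
    have hgs : ∀ s, HasDerivAt (fun s => g (s, w)) (q (g (s, w))) s := by
      intro s
      rw [hqf _ (hgp s)]
      exact hf.hasDerivAt_scaleFlow s hw'
    have hIeq : Real.exp (I (s, w)) = q (g (s, w)) / q w := by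
      have hlog : ∀ u : ℝ, HasDerivAt (fun u => Real.log (q (g (u * s, w))))
          (s * q' (g (u * s, w))) u := by
        intro u
        have h1 : HasDerivAt q (q' (g (u * s, w))) (g (u * s, w)) :=
          (hq.differentiableOn (by simp) _ (hgp _).le).hasDerivWithinAt.hasDerivAt
            (Ici_mem_nhds (hgp _))
        have h2 : HasDerivAt (fun u : ℝ => g (u * s, w)) (q (g (u * s, w)) * s) u :=
          HasDerivAt.comp (h₂ := fun s => g (s, w)) (h := fun u : ℝ => u * s) u (hgs (u * s))
            (by simpa using (hasDerivAt_id u).mul_const s)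
        have h3 := ((h1.comp u h2).log (hpos _ (hgp _)).ne')
        refine h3.congr_deriv ?_
        have := (hpos _ (hgp (u * s))).ne'
        change q' (g (u * s, w)) * (q (g (u * s, w)) * s) / q (g (u * s, w)) = _
        rw [div_eq_iff this]
        ring
      have hcont : Continuous fun u : ℝ => s * q' (g (u * s, w)) := by
        rw [← continuousOn_univ]
        exact continuousOn_const.mul (hq's.continuousOn.comp (t := Ici 0)
          (hf.continuousOn_scaleFlow.comp (f := fun u : ℝ => (u * s, w)) (by fun_prop)
            fun u _ => ⟨mem_univ _, hw'.le⟩) fun u _ => (hgp _).le)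
      have h4 : I (s, w) = Real.log (q (g (s, w))) - Real.log (q w) := by
        have h5 := intervalIntegral.integral_eq_sub_of_hasDerivAt (a := 0) (b := 1)
          (fun u _ => hlog u) (hcont.intervalIntegrable 0 1)
        have h6 : g (0, w) = w := hf.scaleFlow_zero hw'.le
        simp only [one_mul, zero_mul, h6] at h5
        rw [← h5, intervalIntegral.integral_of_le zero_le_one, ← integral_Icc_eq_integral_Ioc]
      rw [h4, Real.exp_sub, Real.exp_log (hpos _ (hgp _)), Real.exp_log (hpos _ hw')]
    have hm : HasFDerivAt (fun x : ℝ × ℝ => Real.exp x.1 * f x.2)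
        (Real.exp s • (deriv f w • ContinuousLinearMap.snd ℝ ℝ ℝ) +
          f w • (Real.exp s • ContinuousLinearMap.fst ℝ ℝ ℝ)) (s, w) := by
      have hA : HasFDerivAt (fun x : ℝ × ℝ => Real.exp x.1)
          (Real.exp s • ContinuousLinearMap.fst ℝ ℝ ℝ) (s, w) :=
        HasDerivAt.comp_hasFDerivAt (h₂ := Real.exp) (s, w) (Real.hasDerivAt_exp s) hasFDerivAt_fst
      have hB : HasFDerivAt (fun x : ℝ × ℝ => f x.2)
          (deriv f w • ContinuousLinearMap.snd ℝ ℝ ℝ) (s, w) :=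
        HasDerivAt.comp_hasFDerivAt (h₂ := f) (s, w) (hf.hasDerivAt hw') hasFDerivAt_snd
      exact hA.mul hB
    have h7 := (hf.hasDerivAt_symm (mul_pos (Real.exp_pos s) (hf.pos hw'))).comp_hasFDerivAt
      (s, w) hm
    have hL : L (s, w) = (deriv f (g (s, w)))⁻¹ •
        (Real.exp s • (deriv f w • ContinuousLinearMap.snd ℝ ℝ ℝ) +
          f w • (Real.exp s • ContinuousLinearMap.fst ℝ ℝ ℝ)) := by
      have hne := hf.deriv_ne_zero (hgp s)
      have hne' := hf.deriv_ne_zero hw'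
      have hne'' := (hf.pos hw').ne'
      ext
      · simp [L, hqg]; field_simp
      · simp only [L, hIeq, hqg, hqf w hw']; simp; field_simp
    rw [hL]
    exact h7
  have hall : ∀ x ∈ (univ : Set ℝ) ×ˢ Ici (0 : ℝ), HasFDerivWithinAt g (L x) (univ ×ˢ Ici 0) x := by
    intro x hx
    have hcl : closure ((univ : Set ℝ) ×ˢ Ioi (0 : ℝ)) = univ ×ˢ Ici 0 := by
      rw [closure_prod_eq, closure_univ, closure_Ioi]
    have hsub : (univ : Set ℝ) ×ˢ Ioi (0 : ℝ) ⊆ univ ×ˢ Ici 0 :=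
      prod_mono Subset.rfl Ioi_subset_Ici_self
    rw [← hcl]
    refine hasFDerivWithinAt_closure_of_tendsto_fderiv
      (fun y hy => (hint y hy).differentiableAt.differentiableWithinAt)
      (convex_univ.prod (convex_Ioi 0)) (isOpen_univ.prod isOpen_Ioi) ?_ ?_
    · rw [hcl]
      exact fun y hy => (hf.continuousOn_scaleFlow y hy).mono hsub
    · have h1 := (hLsmooth 0 (by simpa using hf.continuousOn_scaleFlow)).continuousOn x hx
      refine (h1.mono hsub).tendsto.congr' ?_
      filter_upwards [self_mem_nhdsWithin] with y hy using (hint y hy).fderiv.symm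
  rw [contDiffOn_infty]
  intro k
  induction k with
  | zero => simpa using hf.continuousOn_scaleFlow
  | succ k ih =>
    push_cast
    rw [contDiffOn_succ_iff_hasFDerivWithinAt_of_uniqueDiffOn hΩu]
    exact ⟨by simp, L, hLsmooth k ih, hall⟩

end IsProfile

/-! ### The projective action and the Klein chart -/

section Klein

variable {n : ℕ}

/-- The time coordinate of `A (v, 1)`, the denominator of `proj A v`. -/
def height (A : Matrix (Fin n ⊕ Fin 1) (Fin n ⊕ Fin 1) ℝ) (v : Eucl n) : ℝ :=
  (A *ᵥ lift v) (Sum.inr 0)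

/-- The Lorentzian quadratic form `x₁² + ⋯ + xₙ² - t²`. -/
def lorentz (x : Fin n ⊕ Fin 1 → ℝ) : ℝ := ∑ i, x (Sum.inl i) ^ 2 - x (Sum.inr 0) ^ 2

lemma dotProduct_indefiniteDiagonal (x y : Fin n ⊕ Fin 1 → ℝ) :
    x ⬝ᵥ (LieAlgebra.Orthogonal.indefiniteDiagonal (Fin n) (Fin 1) ℝ *ᵥ y)
      = ∑ i, x (Sum.inl i) * y (Sum.inl i) - x (Sum.inr 0) * y (Sum.inr 0) := by
  simp [LieAlgebra.Orthogonal.indefiniteDiagonal, Matrix.mulVec_diagonal, dotProduct, sub_eq_add_neg]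

lemma lorentz_mulVec {A : Matrix (Fin n ⊕ Fin 1) (Fin n ⊕ Fin 1) ℝ} (hA : A ∈ SO₀ n)
    (x : Fin n ⊕ Fin 1 → ℝ) : lorentz (A *ᵥ x) = lorentz x := by
  have h : ∀ x : Fin n ⊕ Fin 1 → ℝ, lorentz x =
      x ⬝ᵥ (LieAlgebra.Orthogonal.indefiniteDiagonal (Fin n) (Fin 1) ℝ *ᵥ x) := fun x => by
    rw [dotProduct_indefiniteDiagonal, lorentz]
    simp only [pow_two]
  set J := LieAlgebra.Orthogonal.indefiniteDiagonal (Fin n) (Fin 1) ℝ with hJ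
  calc lorentz (A *ᵥ x) = (x ᵥ* Aᵀ) ⬝ᵥ (J *ᵥ (A *ᵥ x)) := by rw [h, Matrix.vecMul_transpose]
    _ = x ⬝ᵥ (Aᵀ *ᵥ (J *ᵥ (A *ᵥ x))) := (Matrix.dotProduct_mulVec _ _ _).symm
    _ = lorentz x := by rw [Matrix.mulVec_mulVec, Matrix.mulVec_mulVec, hA.1, h]

lemma lorentz_lift (v : Eucl n) : lorentz (lift v) = ‖v‖ ^ 2 - 1 := by
  simp [lorentz, lift, EuclideanSpace.real_norm_sq_eq]

lemma height_pos {A : Matrix (Fin n ⊕ Fin 1) (Fin n ⊕ Fin 1) ℝ} (hA : A ∈ SO₀ n) {v : Eucl n}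
    (hv : ‖v‖ ≤ 1) : 0 < height A v := by
  obtain ⟨hA1, -, hA3⟩ := hA
  set J := LieAlgebra.Orthogonal.indefiniteDiagonal (Fin n) (Fin 1) ℝ with hJ
  have hJJ : J * J = 1 := by
    rw [hJ, LieAlgebra.Orthogonal.indefiniteDiagonal, Matrix.diagonal_mul_diagonal,
      ← Matrix.diagonal_one]
    congr 1
    ext i; rcases i with i | i <;> simp
  have h1 : (J * Aᵀ * J) * A = 1 := by
    rw [Matrix.mul_assoc, Matrix.mul_assoc, ← Matrix.mul_assoc Aᵀ, hA1, hJJ]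
  have h2 : A * (J * Aᵀ * J) = 1 := mul_eq_one_comm.1 h1
  have h3 : A * J * Aᵀ = J := by
    have := congrArg (· * J) h2
    simpa [Matrix.mul_assoc, hJJ] using this
  have h4 : ∑ i, A (Sum.inr 0) (Sum.inl i) ^ 2 - A (Sum.inr 0) (Sum.inr 0) ^ 2 = -1 := by
    have := congrFun (congrFun h3 (Sum.inr 0)) (Sum.inr 0)
    rw [Matrix.mul_assoc, Matrix.mul_apply, hJ, LieAlgebra.Orthogonal.indefiniteDiagonal] at this
    simp only [Matrix.diagonal_mul] at this
    simpa [pow_two, sub_eq_add_neg] using this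
  have h5 : height A v = ∑ i, A (Sum.inr 0) (Sum.inl i) * v i + A (Sum.inr 0) (Sum.inr 0) := by
    simp [height, Matrix.mulVec, dotProduct, lift]
  have h6 := Finset.sum_mul_sq_le_sq_mul_sq Finset.univ (fun i => A (Sum.inr 0) (Sum.inl i)) v
  have h7 : ∑ i, v i ^ 2 ≤ 1 := by
    rw [← EuclideanSpace.real_norm_sq_eq]; nlinarith [norm_nonneg v]
  have h8 : 0 ≤ ∑ i, A (Sum.inr 0) (Sum.inl i) ^ 2 := Finset.sum_nonneg fun _ _ => sq_nonneg _
  rw [h5]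
  by_contra hneg
  rw [not_lt] at hneg
  nlinarith

lemma proj_apply (A : Matrix (Fin n ⊕ Fin 1) (Fin n ⊕ Fin 1) ℝ) (v : Eucl n) (i : Fin n) :
    proj A v i = (A *ᵥ lift v) (Sum.inl i) / height A v := rfl

lemma one_sub_norm_sq_proj {A : Matrix (Fin n ⊕ Fin 1) (Fin n ⊕ Fin 1) ℝ} (hA : A ∈ SO₀ n)
    {v : Eucl n} (hv : ‖v‖ ≤ 1) : 1 - ‖proj A v‖ ^ 2 = (1 - ‖v‖ ^ 2) / height A v ^ 2 := by
  have h1 := lorentz_mulVec hA (lift v)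
  have ht := (height_pos hA hv).ne'
  rw [lorentz_lift, lorentz] at h1
  rw [EuclideanSpace.real_norm_sq_eq, eq_div_iff (pow_ne_zero 2 ht), sub_mul, Finset.sum_mul]
  have h2 : ∀ i, proj A v i ^ 2 * height A v ^ 2 = (A *ᵥ lift v) (Sum.inl i) ^ 2 := fun i => by
    rw [proj_apply, div_pow, div_mul_cancel₀ _ (pow_ne_zero 2 ht)]
  simp only [h2]
  have h3 : height A v = (A *ᵥ lift v) (Sum.inr 0) := rfl
  rw [h3]
  linarith

lemma proj_mem_cball {A : Matrix (Fin n ⊕ Fin 1) (Fin n ⊕ Fin 1) ℝ} (hA : A ∈ SO₀ n)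
    {v : Eucl n} (hv : ‖v‖ ≤ 1) : ‖proj A v‖ ≤ 1 := by
  have h1 := one_sub_norm_sq_proj hA hv
  have h2 : 0 ≤ (1 - ‖v‖ ^ 2) / height A v ^ 2 :=
    div_nonneg (by nlinarith [norm_nonneg v]) (sq_nonneg _)
  nlinarith [norm_nonneg (proj A v)]

lemma proj_mem_oball {A : Matrix (Fin n ⊕ Fin 1) (Fin n ⊕ Fin 1) ℝ} (hA : A ∈ SO₀ n)
    {v : Eucl n} (hv : ‖v‖ < 1) : ‖proj A v‖ < 1 := by
  have h1 := one_sub_norm_sq_proj hA hv.le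
  have h2 : 0 < (1 - ‖v‖ ^ 2) / height A v ^ 2 :=
    div_pos (by nlinarith [norm_nonneg v]) (pow_pos (height_pos hA hv.le) 2)
  nlinarith [norm_nonneg (proj A v)]

lemma norm_proj_eq_one {A : Matrix (Fin n ⊕ Fin 1) (Fin n ⊕ Fin 1) ℝ} (hA : A ∈ SO₀ n)
    {v : Eucl n} (hv : ‖v‖ = 1) : ‖proj A v‖ = 1 := by
  have h1 := one_sub_norm_sq_proj hA hv.le
  rw [hv] at h1
  norm_num at h1
  have h2 : ‖proj A v‖ ^ 2 = 1 := by linarith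
  exact (pow_eq_one_iff_of_nonneg (norm_nonneg _) two_ne_zero).1 h2

lemma contDiff_mulVec_lift (A : Matrix (Fin n ⊕ Fin 1) (Fin n ⊕ Fin 1) ℝ) (j : Fin n ⊕ Fin 1) :
    ContDiff ℝ ω fun v : Eucl n => (A *ᵥ lift v) j := by
  have : ∀ v : Eucl n, (A *ᵥ lift v) j = ∑ i, A j (Sum.inl i) * v i + A j (Sum.inr 0) :=
    fun v => by simp [Matrix.mulVec, dotProduct, lift]
  simp only [this]
  fun_prop

lemma contDiffAt_proj {A : Matrix (Fin n ⊕ Fin 1) (Fin n ⊕ Fin 1) ℝ} {v : Eucl n}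
    (hv : height A v ≠ 0) : ContDiffAt ℝ ω (proj A) v := by
  rw [contDiffAt_euclidean]
  intro i
  exact (contDiff_mulVec_lift A _).contDiffAt.div (contDiff_mulVec_lift A _).contDiffAt hv

variable [NeZero n]

/-- The quantity `1 - y` of a point `(x, y)` of the ball, in terms of its Klein chart `(X, Y)`:
`1 - y = 2 / (1 + |X|² + Y)`. -/
def depth (z : Eucl n) : ℝ := 2 / (1 + (‖z‖ ^ 2 - z ⊤ ^ 2) + z ⊤)

/-- The inverse of the Klein chart. -/
def kleinInv (z : Eucl n) : Eucl n :=
  WithLp.toLp 2 fun i => if i = ⊤ then 1 - depth z else depth z * z i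

lemma norm_sq_eq_top_add (z : Eucl n) :
    ‖z‖ ^ 2 = z ⊤ ^ 2 + ∑ i ∈ Finset.univ.erase ⊤, z i ^ 2 := by
  rw [EuclideanSpace.real_norm_sq_eq, Finset.add_sum_erase _ (fun i => z i ^ 2) (Finset.mem_univ ⊤)]

lemma top_sq_le (z : Eucl n) : z ⊤ ^ 2 ≤ ‖z‖ ^ 2 := by
  rw [norm_sq_eq_top_add]
  have : 0 ≤ ∑ i ∈ Finset.univ.erase ⊤, z i ^ 2 := Finset.sum_nonneg fun _ _ => sq_nonneg _
  linarith

lemma depth_denom_pos {z : Eucl n} (hz : 0 ≤ z ⊤) : 0 < 1 + (‖z‖ ^ 2 - z ⊤ ^ 2) + z ⊤ := by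
  have := top_sq_le z
  linarith

lemma depth_pos {z : Eucl n} (hz : 0 ≤ z ⊤) : 0 < depth z :=
  div_pos two_pos (depth_denom_pos hz)

lemma norm_kleinInv {z : Eucl n} (hz : 0 ≤ z ⊤) :
    1 - ‖kleinInv z‖ ^ 2 = z ⊤ * depth z ^ 2 := by
  have h1 := depth_denom_pos hz
  have h2 : ‖kleinInv z‖ ^ 2 = (1 - depth z) ^ 2 + depth z ^ 2 * (‖z‖ ^ 2 - z ⊤ ^ 2) := by
    rw [norm_sq_eq_top_add, norm_sq_eq_top_add z, add_sub_cancel_left, Finset.mul_sum]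
    congr 1
    · simp [kleinInv]
    · refine Finset.sum_congr rfl fun i hi => ?_
      have : i ≠ ⊤ := Finset.ne_of_mem_erase hi
      simp [kleinInv, this, mul_pow]
  have h3 : depth z * (1 + (‖z‖ ^ 2 - z ⊤ ^ 2) + z ⊤) = 2 := div_mul_cancel₀ _ h1.ne'
  rw [h2]
  linear_combination (-depth z) * h3

lemma kleinInv_top (z : Eucl n) : kleinInv z ⊤ = 1 - depth z := by simp [kleinInv]

lemma kleinInv_apply (z : Eucl n) {i : Fin n} (hi : i ≠ ⊤) : kleinInv z i = depth z * z i := by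
  simp [kleinInv, hi]

lemma kleinChart_top (v : Eucl n) : kleinChart v ⊤ = (1 - ‖v‖ ^ 2) / (1 - v ⊤) ^ 2 := by
  simp [kleinChart]

lemma kleinChart_apply (v : Eucl n) {i : Fin n} (hi : i ≠ ⊤) :
    kleinChart v i = v i / (1 - v ⊤) := by
  simp [kleinChart, hi]

lemma kleinInv_mem {z : Eucl n} (hz : 0 ≤ z ⊤) : ‖kleinInv z‖ ≤ 1 := by
  have h1 := norm_kleinInv hz
  have h2 : 0 ≤ z ⊤ * depth z ^ 2 := mul_nonneg hz (sq_nonneg _)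
  nlinarith [norm_nonneg (kleinInv z)]

lemma kleinInv_mem_oball {z : Eucl n} (hz : 0 < z ⊤) : ‖kleinInv z‖ < 1 := by
  have h1 := norm_kleinInv hz.le
  have h2 : 0 < z ⊤ * depth z ^ 2 := mul_pos hz (pow_pos (depth_pos hz.le) 2)
  nlinarith [norm_nonneg (kleinInv z)]

lemma pole_top : pole n ⊤ = 1 := by simp [pole]

lemma pole_apply {i : Fin n} (hi : i ≠ ⊤) : pole n i = 0 := by simp [pole, hi]

lemma norm_pole : ‖pole n‖ = 1 := by simp [pole]

lemma kleinInv_ne_pole {z : Eucl n} (hz : 0 ≤ z ⊤) : kleinInv z ≠ pole n := by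
  intro h
  have := congrArg (fun v : Eucl n => v ⊤) h
  simp only [kleinInv_top, pole_top] at this
  linarith [depth_pos hz]

lemma kleinChart_kleinInv {z : Eucl n} (hz : 0 ≤ z ⊤) : kleinChart (kleinInv z) = z := by
  have hd := (depth_pos hz).ne'
  ext i
  by_cases hi : i = ⊤
  · subst hi
    rw [kleinChart_top, norm_kleinInv hz, kleinInv_top, sub_sub_cancel,
      mul_div_cancel_right₀ _ (pow_ne_zero 2 hd)]
  · rw [kleinChart_apply _ hi, kleinInv_apply _ hi, kleinInv_top, sub_sub_cancel,
      mul_div_cancel_left₀ _ hd]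

lemma top_lt_one {v : Eucl n} (hv : ‖v‖ ≤ 1) (hp : v ≠ pole n) : v ⊤ < 1 := by
  have h1 := norm_sq_eq_top_add v
  have h2 : 0 ≤ ∑ i ∈ Finset.univ.erase ⊤, v i ^ 2 := Finset.sum_nonneg fun _ _ => sq_nonneg _
  have h3 : ‖v‖ ^ 2 ≤ 1 := by nlinarith [norm_nonneg v]
  refine lt_of_le_of_ne (by nlinarith) fun h => hp ?_
  rw [h] at h1
  have h4 : ∑ i ∈ Finset.univ.erase ⊤, v i ^ 2 = 0 := by linarith
  rw [Finset.sum_eq_zero_iff_of_nonneg fun _ _ => sq_nonneg _] at h4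
  ext i
  by_cases hi : i = ⊤
  · subst hi; rw [h, pole_top]
  · rw [pole_apply hi]
    exact pow_eq_zero_iff two_ne_zero |>.1 (h4 i (Finset.mem_erase.2 ⟨hi, Finset.mem_univ _⟩))

lemma ne_pole_of_norm_lt {v : Eucl n} (hv : ‖v‖ < 1) : v ≠ pole n := by
  rintro rfl
  rw [norm_pole] at hv
  exact lt_irrefl _ hv

lemma kleinChart_top_nonneg {v : Eucl n} (hv : ‖v‖ ≤ 1) : 0 ≤ kleinChart v ⊤ := by
  rw [kleinChart_top]
  exact div_nonneg (by nlinarith [norm_nonneg v]) (sq_nonneg _)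

lemma kleinChart_top_pos {v : Eucl n} (hv : ‖v‖ < 1) : 0 < kleinChart v ⊤ := by
  rw [kleinChart_top]
  have := top_lt_one hv.le (ne_pole_of_norm_lt hv)
  exact div_pos (by nlinarith [norm_nonneg v]) (pow_pos (by linarith) 2)

lemma kleinChart_top_eq_zero {v : Eucl n} (hv : ‖v‖ = 1) : kleinChart v ⊤ = 0 := by
  rw [kleinChart_top, hv]; simp

lemma depth_kleinChart {v : Eucl n} (hv : ‖v‖ ≤ 1) (hp : v ≠ pole n) :
    depth (kleinChart v) = 1 - v ⊤ := by
  have h1 : 0 < 1 - v ⊤ := by linarith [top_lt_one hv hp]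
  have h2 : ‖kleinChart v‖ ^ 2 - kleinChart v ⊤ ^ 2 = (‖v‖ ^ 2 - v ⊤ ^ 2) / (1 - v ⊤) ^ 2 := by
    rw [norm_sq_eq_top_add, norm_sq_eq_top_add v, add_sub_cancel_left, add_sub_cancel_left,
      Finset.sum_div]
    refine Finset.sum_congr rfl fun i hi => ?_
    rw [kleinChart_apply _ (Finset.ne_of_mem_erase hi), div_pow]
  rw [depth, h2, kleinChart_top, div_eq_iff (by
    rw [← h2, ← kleinChart_top]; exact (depth_denom_pos (kleinChart_top_nonneg hv)).ne')]
  field_simp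
  ring

lemma kleinInv_kleinChart {v : Eucl n} (hv : ‖v‖ ≤ 1) (hp : v ≠ pole n) :
    kleinInv (kleinChart v) = v := by
  have h1 : 0 < 1 - v ⊤ := by linarith [top_lt_one hv hp]
  ext i
  by_cases hi : i = ⊤
  · subst hi
    rw [kleinInv_top, depth_kleinChart hv hp, sub_sub_cancel]
  · rw [kleinInv_apply _ hi, depth_kleinChart hv hp, kleinChart_apply _ hi,
      mul_div_cancel₀ _ h1.ne']

lemma kleinChart_inj {v w : Eucl n} (hv : ‖v‖ ≤ 1) (hvp : v ≠ pole n) (hw : ‖w‖ ≤ 1)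
    (hwp : w ≠ pole n) (h : kleinChart v = kleinChart w) : v = w := by
  rw [← kleinInv_kleinChart hv hvp, h, kleinInv_kleinChart hw hwp]

lemma contDiffAt_kleinChart {v : Eucl n} (hv : v ⊤ < 1) : ContDiffAt ℝ ω kleinChart v := by
  have h1 : (1 : ℝ) - v ⊤ ≠ 0 := by linarith
  rw [contDiffAt_euclidean]
  intro i
  have h2 : ContDiffAt ℝ ω (fun v : Eucl n => 1 - v ⊤) v := by fun_prop
  by_cases hi : i = ⊤
  · subst hi
    simp only [kleinChart_top]
    exact (contDiffAt_const.sub (contDiff_norm_sq ℝ).contDiffAt).div (h2.pow 2) (pow_ne_zero 2 h1)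
  · simp only [kleinChart_apply _ hi]
    exact ContDiffAt.div (by fun_prop) h2 h1

lemma contDiffAt_depth {z : Eucl n} (hz : 0 ≤ z ⊤) : ContDiffAt ℝ ω depth z :=
  contDiffAt_const.div (((contDiff_const.add ((contDiff_norm_sq ℝ).sub (by fun_prop))).add
    (by fun_prop)).contDiffAt) (depth_denom_pos hz).ne'

lemma contDiffAt_kleinInv {z : Eucl n} (hz : 0 ≤ z ⊤) : ContDiffAt ℝ ω kleinInv z := by
  have h := contDiffAt_depth hz
  rw [contDiffAt_euclidean]
  intro i
  by_cases hi : i = ⊤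
  · subst hi
    simp only [kleinInv_top]
    exact contDiffAt_const.sub h
  · simp only [kleinInv_apply _ hi]
    exact h.mul (by fun_prop)

/-- The Klein chart of `proj A v`, in terms of `A (v, 1)`. -/
lemma kleinChart_proj {A : Matrix (Fin n ⊕ Fin 1) (Fin n ⊕ Fin 1) ℝ} (hA : A ∈ SO₀ n)
    {v : Eucl n} (hv : ‖v‖ ≤ 1) (i : Fin n) : kleinChart (proj A v) i =
      if i = ⊤ then (1 - ‖v‖ ^ 2) / (height A v - (A *ᵥ lift v) (Sum.inl ⊤)) ^ 2
      else (A *ᵥ lift v) (Sum.inl i) / (height A v - (A *ᵥ lift v) (Sum.inl ⊤)) := by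
  have ht := (height_pos hA hv).ne'
  have h1 : 1 - proj A v ⊤ = (height A v - (A *ᵥ lift v) (Sum.inl ⊤)) / height A v := by
    rw [proj_apply, sub_div, div_self ht]
  split_ifs with hi
  · subst hi
    rw [kleinChart_top, one_sub_norm_sq_proj hA hv, h1, div_pow, div_div_div_cancel_right₀
      (pow_ne_zero 2 ht)]
  · rw [kleinChart_apply _ hi, h1, proj_apply, div_div_div_cancel_right₀ ht]

end Klein

/-! ### Parabolic translations, dilations and half-turns -/

section Elements

variable {n : ℕ}

lemma transpose_mul_of_lorentz {L : (Fin n ⊕ Fin 1 → ℝ) →ₗ[ℝ] (Fin n ⊕ Fin 1 → ℝ)}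
    (hL : ∀ x, lorentz (L x) = lorentz x) :
    (LinearMap.toMatrix' L)ᵀ * LieAlgebra.Orthogonal.indefiniteDiagonal (Fin n) (Fin 1) ℝ *
      LinearMap.toMatrix' L = LieAlgebra.Orthogonal.indefiniteDiagonal (Fin n) (Fin 1) ℝ := by
  set J := LieAlgebra.Orthogonal.indefiniteDiagonal (Fin n) (Fin 1) ℝ with hJ
  have hpolar : ∀ x y : Fin n ⊕ Fin 1 → ℝ,
      2 * (x ⬝ᵥ (J *ᵥ y)) = lorentz (x + y) - lorentz x - lorentz y := by
    intro x y
    rw [hJ, dotProduct_indefiniteDiagonal]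
    simp only [lorentz, Pi.add_apply, add_sq, Finset.sum_add_distrib, mul_sub, Finset.mul_sum,
      mul_assoc]
    ring
  have hb : ∀ x y, (L x) ⬝ᵥ (J *ᵥ (L y)) = x ⬝ᵥ (J *ᵥ y) := by
    intro x y
    have h1 := hpolar (L x) (L y)
    rw [← map_add, hL, hL, hL, ← hpolar x y] at h1
    linarith
  set B := LinearMap.toMatrix' L with hB
  have hBL : ∀ x, B *ᵥ x = L x := fun x => by rw [hB, LinearMap.toMatrix'_mulVec]
  have h2 : ∀ x y : Fin n ⊕ Fin 1 → ℝ, x ⬝ᵥ ((Bᵀ * J * B) *ᵥ y) = x ⬝ᵥ (J *ᵥ y) := by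
    intro x y
    rw [← hb x y, ← hBL x, ← hBL y, ← Matrix.mulVec_mulVec, ← Matrix.mulVec_mulVec,
      Matrix.dotProduct_mulVec x, Matrix.vecMul_transpose]
  ext i j
  have := h2 (Pi.single i 1) (Pi.single j 1)
  simpa using this

/-- A linear map that is the square of a map preserving the Lorentzian form has determinant `1`. -/
lemma toMatrix_mem_SO₀ {L L' : (Fin n ⊕ Fin 1 → ℝ) →ₗ[ℝ] (Fin n ⊕ Fin 1 → ℝ)}
    (hL' : ∀ x, lorentz (L' x) = lorentz x) (hLL : ∀ x, L x = L' (L' x))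
    (hpos : 0 < L (Pi.single (Sum.inr 0) 1) (Sum.inr 0)) :
    LinearMap.toMatrix' L ∈ SO₀ n := by
  have hL : ∀ x, lorentz (L x) = lorentz x := fun x => by rw [hLL, hL', hL']
  have hcomp : L = L' ∘ₗ L' := LinearMap.ext hLL
  refine ⟨transpose_mul_of_lorentz hL, ?_, ?_⟩
  · have h1 := congrArg Matrix.det (transpose_mul_of_lorentz hL')
    rw [Matrix.det_mul, Matrix.det_mul, Matrix.det_transpose] at h1
    have h2 : (LieAlgebra.Orthogonal.indefiniteDiagonal (Fin n) (Fin 1) ℝ).det ≠ 0 := by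
      simp [LieAlgebra.Orthogonal.indefiniteDiagonal]
    rw [hcomp, LinearMap.toMatrix'_comp, Matrix.det_mul]
    apply mul_right_cancel₀ h2
    linarith
  · simpa [LinearMap.toMatrix'_apply, Pi.single_apply] using hpos

/-- The half-turn that changes the signs of two coordinates. -/
def flip (i j : Fin n) : Matrix (Fin n ⊕ Fin 1) (Fin n ⊕ Fin 1) ℝ :=
  Matrix.diagonal (Sum.elim (fun k => if k = i ∨ k = j then -1 else 1) fun _ => 1)

lemma flip_mem {i j : Fin n} (hij : i ≠ j) : flip i j ∈ SO₀ n := by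
  refine ⟨?_, ?_, by simp [flip]⟩
  · rw [flip, LieAlgebra.Orthogonal.indefiniteDiagonal, Matrix.diagonal_transpose,
      Matrix.diagonal_mul_diagonal, Matrix.diagonal_mul_diagonal]
    congr 1
    ext k
    rcases k with k | k
    · by_cases hk : k = i ∨ k = j <;> simp [hk]
    · simp
  · rw [flip, Matrix.det_diagonal, Fintype.prod_sum_type]
    simp only [Sum.elim_inl, Sum.elim_inr, Finset.prod_const_one, mul_one]
    rw [Finset.prod_ite, Finset.prod_const_one, mul_one, Finset.prod_const]
    have : (Finset.univ.filter fun k => k = i ∨ k = j) = {i, j} := by ext k; simp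
    rw [this, Finset.card_pair hij]
    norm_num

lemma proj_flip (i j : Fin n) (v : Eucl n) (k : Fin n) :
    proj (flip i j) v k = if k = i ∨ k = j then -v k else v k := by
  rw [proj_apply, height, flip, Matrix.mulVec_diagonal, Matrix.mulVec_diagonal]
  by_cases hk : k = i ∨ k = j <;> simp [hk, lift]

lemma proj_flip_proj_flip (i j : Fin n) (v : Eucl n) : proj (flip i j) (proj (flip i j) v) = v := by
  ext k
  rw [proj_flip, proj_flip]
  split_ifs <;> simp

lemma norm_proj_flip (i j : Fin n) (v : Eucl n) : ‖proj (flip i j) v‖ = ‖v‖ := by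
  rw [EuclideanSpace.norm_eq, EuclideanSpace.norm_eq]
  congr 1
  refine Finset.sum_congr rfl fun k _ => ?_
  rw [proj_flip]
  split_ifs <;> simp

variable [NeZero n]

variable (n) in
/-- The horizontal space `ℝⁿ⁻¹` of the first `n - 1` coordinates. -/
abbrev Horiz : Type := {i : Fin n // i ≠ ⊤} → ℝ

/-- The inclusion of the horizontal space in `ℝⁿ`. -/
def horEmb (a : Horiz n) : Eucl n := WithLp.toLp 2 fun i => if h : i = ⊤ then 0 else a ⟨i, h⟩

lemma horEmb_top (a : Horiz n) : horEmb a ⊤ = 0 := by simp [horEmb]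

lemma horEmb_apply (a : Horiz n) {i : Fin n} (hi : i ≠ ⊤) : horEmb a i = a ⟨i, hi⟩ := by
  simp [horEmb, hi]

lemma horEmb_add (a b : Horiz n) : horEmb (a + b) = horEmb a + horEmb b := by
  ext i
  by_cases hi : i = ⊤
  · subst hi; simp [horEmb_top]
  · simp [horEmb_apply _ hi]

lemma contDiff_horEmb : ContDiff ℝ ω (horEmb : Horiz n → Eucl n) := by
  rw [contDiff_euclidean]
  intro i
  by_cases hi : i = ⊤
  · subst hi; simp only [horEmb_top]; fun_prop
  · simp only [horEmb_apply _ hi]; fun_prop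

/-- The Lorentz map that adds `(t - y) a` to the horizontal part of a vector; the height `y` and the
time `t` get a common increment, so that the linear form `t - y` is preserved. -/
def transMap (a : Horiz n) : (Fin n ⊕ Fin 1 → ℝ) →ₗ[ℝ] (Fin n ⊕ Fin 1 → ℝ) where
  toFun x := Sum.elim
    (fun i => x (Sum.inl i) + horEmb a i * (x (Sum.inr 0) - x (Sum.inl ⊤)) +
      if i = ⊤ then ∑ j, horEmb a j * x (Sum.inl j) +
        (∑ j, horEmb a j ^ 2) * (x (Sum.inr 0) - x (Sum.inl ⊤)) / 2 else 0)
    (fun _ => x (Sum.inr 0) + (∑ j, horEmb a j * x (Sum.inl j) +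
        (∑ j, horEmb a j ^ 2) * (x (Sum.inr 0) - x (Sum.inl ⊤)) / 2))
  map_add' x y := by
    ext i
    rcases i with i | i
    · by_cases hi : i = ⊤ <;> simp [hi, mul_add, Finset.sum_add_distrib] <;> ring
    · simp [mul_add, Finset.sum_add_distrib]; ring
  map_smul' c x := by
    have h : ∑ j, horEmb a j * (c * x (Sum.inl j)) = c * ∑ j, horEmb a j * x (Sum.inl j) := by
      rw [Finset.mul_sum]; exact Finset.sum_congr rfl fun j _ => by ring
    ext i
    rcases i with i | i
    · by_cases hi : i = ⊤ <;> simp [hi, h] <;> ring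
    · simp [h]; ring

/-- The boost of Minkowski space that multiplies `t + y` by `eˢ` and `t - y` by `e⁻ˢ`. -/
def dilMap (n : ℕ) [NeZero n] (s : ℝ) : (Fin n ⊕ Fin 1 → ℝ) →ₗ[ℝ] (Fin n ⊕ Fin 1 → ℝ) where
  toFun x := Sum.elim
    (fun i => if i = ⊤ then Real.cosh s * x (Sum.inl ⊤) + Real.sinh s * x (Sum.inr 0)
      else x (Sum.inl i))
    (fun _ => Real.sinh s * x (Sum.inl ⊤) + Real.cosh s * x (Sum.inr 0))
  map_add' x y := by
    ext i
    rcases i with i | i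
    · by_cases hi : i = ⊤
      · simp [hi]; ring
      · simp [hi]
    · simp; ring
  map_smul' c x := by
    ext i
    rcases i with i | i
    · by_cases hi : i = ⊤
      · simp [hi]; ring
      · simp [hi]
    · simp; ring

lemma sum_top_add (g : Fin n → ℝ) : ∑ i, g i = g ⊤ + ∑ i ∈ Finset.univ.erase ⊤, g i :=
  (Finset.add_sum_erase _ g (Finset.mem_univ ⊤)).symm

lemma lorentz_transMap (a : Horiz n) (x : Fin n ⊕ Fin 1 → ℝ) :
    lorentz (transMap a x) = lorentz x := by
  set u := x (Sum.inr 0) - x (Sum.inl ⊤) with hu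
  set σ := ∑ j, horEmb a j * x (Sum.inl j) with hσ
  set N := ∑ j, horEmb a j ^ 2 with hN
  have h1 : ∑ i, (transMap a x) (Sum.inl i) ^ 2 =
      ∑ i, (x (Sum.inl i) + horEmb a i * u) ^ 2 + 2 * (σ + N * u / 2) * x (Sum.inl ⊤)
        + (σ + N * u / 2) ^ 2 := by
    rw [sum_top_add, sum_top_add fun i => (x (Sum.inl i) + horEmb a i * u) ^ 2]
    have h2 : ∀ i ∈ Finset.univ.erase (⊤ : Fin n), (transMap a x) (Sum.inl i) ^ 2 =
        (x (Sum.inl i) + horEmb a i * u) ^ 2 := fun i hi => by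
      simp [transMap, Finset.ne_of_mem_erase hi, hu]
    rw [Finset.sum_congr rfl h2]
    simp only [transMap, LinearMap.coe_mk, AddHom.coe_mk, Sum.elim_inl, if_true, horEmb_top]
    rw [← hu, ← hσ, ← hN]
    ring
  have h3 : ∑ i, (x (Sum.inl i) + horEmb a i * u) ^ 2 =
      ∑ i, x (Sum.inl i) ^ 2 + 2 * u * σ + u ^ 2 * N := by
    rw [hσ, hN, Finset.mul_sum, Finset.mul_sum, ← Finset.sum_add_distrib, ← Finset.sum_add_distrib]
    exact Finset.sum_congr rfl fun i _ => by ring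
  have h4 : (transMap a x) (Sum.inr 0) = x (Sum.inr 0) + (σ + N * u / 2) := rfl
  rw [lorentz, h1, h3, h4, lorentz, hu]
  ring

lemma transMap_add (a b : Horiz n) (x : Fin n ⊕ Fin 1 → ℝ) :
    transMap (a + b) x = transMap a (transMap b x) := by
  set u := x (Sum.inr 0) - x (Sum.inl ⊤) with hu
  have hu' : (transMap b x) (Sum.inr 0) - (transMap b x) (Sum.inl ⊤) = u := by
    simp [transMap, horEmb_top, hu]
  have hσ : ∑ j, horEmb a j * (transMap b x) (Sum.inl j) =
      ∑ j, horEmb a j * x (Sum.inl j) + u * ∑ j, horEmb a j * horEmb b j := by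
    rw [Finset.mul_sum, ← Finset.sum_add_distrib]
    refine Finset.sum_congr rfl fun j _ => ?_
    by_cases hj : j = ⊤
    · subst hj; simp [horEmb_top]
    · simp [transMap, hj, hu]; ring
  have hσ2 : ∑ j, horEmb (a + b) j * x (Sum.inl j) =
      ∑ j, horEmb a j * x (Sum.inl j) + ∑ j, horEmb b j * x (Sum.inl j) := by
    rw [← Finset.sum_add_distrib]
    exact Finset.sum_congr rfl fun j _ => by rw [horEmb_add]; simp; ring
  have hN : ∑ j, horEmb (a + b) j ^ 2 = ∑ j, horEmb a j ^ 2 + ∑ j, horEmb b j ^ 2 +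
      2 * ∑ j, horEmb a j * horEmb b j := by
    rw [Finset.mul_sum, ← Finset.sum_add_distrib, ← Finset.sum_add_distrib]
    exact Finset.sum_congr rfl fun j _ => by rw [horEmb_add]; simp; ring
  have key : ∀ (a : Horiz n) (x : Fin n ⊕ Fin 1 → ℝ), transMap a x = Sum.elim
    (fun i => x (Sum.inl i) + horEmb a i * (x (Sum.inr 0) - x (Sum.inl ⊤)) +
      if i = ⊤ then ∑ j, horEmb a j * x (Sum.inl j) +
        (∑ j, horEmb a j ^ 2) * (x (Sum.inr 0) - x (Sum.inl ⊤)) / 2 else 0)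
    (fun _ => x (Sum.inr 0) + (∑ j, horEmb a j * x (Sum.inl j) +
        (∑ j, horEmb a j ^ 2) * (x (Sum.inr 0) - x (Sum.inl ⊤)) / 2)) := fun _ _ => rfl
  rw [key a (transMap b x), hσ, hu', key (a + b) x, hσ2, hN, ← hu]
  ext i
  rcases i with i | i
  · by_cases hi : i = ⊤
    · subst hi; simp [transMap, horEmb_top, ← hu]; ring
    · simp [transMap, hi, ← hu, horEmb_add]; ring
  · simp [transMap, ← hu]; ring

lemma lorentz_dilMap (s : ℝ) (x : Fin n ⊕ Fin 1 → ℝ) : lorentz (dilMap n s x) = lorentz x := by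
  rw [lorentz, lorentz, sum_top_add, sum_top_add fun i => x (Sum.inl i) ^ 2]
  have h2 : ∀ i ∈ Finset.univ.erase (⊤ : Fin n), (dilMap n s x) (Sum.inl i) ^ 2 =
      x (Sum.inl i) ^ 2 := fun i hi => by
    simp [dilMap, Finset.ne_of_mem_erase hi]
  rw [Finset.sum_congr rfl h2]
  simp only [dilMap, LinearMap.coe_mk, AddHom.coe_mk, Sum.elim_inl, Sum.elim_inr, if_true]
  linear_combination (x (Sum.inl ⊤) ^ 2 - x (Sum.inr 0) ^ 2) * Real.cosh_sq_sub_sinh_sq s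

lemma dilMap_add (s t : ℝ) (x : Fin n ⊕ Fin 1 → ℝ) :
    dilMap n (s + t) x = dilMap n s (dilMap n t x) := by
  ext i
  rcases i with i | i
  · by_cases hi : i = ⊤
    · simp [dilMap, hi, Real.cosh_add, Real.sinh_add]; ring
    · simp [dilMap, hi]
  · simp [dilMap, Real.cosh_add, Real.sinh_add]; ring

/-- The parabolic element acting by the horizontal translation `X ↦ X + a` in the Klein chart. -/
def trans (a : Horiz n) : Matrix (Fin n ⊕ Fin 1) (Fin n ⊕ Fin 1) ℝ :=
  LinearMap.toMatrix' (transMap a)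

variable (n) in
/-- The hyperbolic element acting by `(X, Y) ↦ (eˢ X, e²ˢ Y)` in the Klein chart. -/
def dil (s : ℝ) : Matrix (Fin n ⊕ Fin 1) (Fin n ⊕ Fin 1) ℝ :=
  LinearMap.toMatrix' (dilMap n s)

lemma trans_mem (a : Horiz n) : trans a ∈ SO₀ n := by
  refine toMatrix_mem_SO₀ (lorentz_transMap ((2 : ℝ)⁻¹ • a)) (fun x => ?_) ?_
  · rw [← transMap_add, ← two_smul ℝ, smul_smul]; norm_num
  · have : 0 ≤ ∑ j, horEmb a j ^ 2 := Finset.sum_nonneg fun _ _ => sq_nonneg _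
    simp [transMap]
    linarith

lemma dil_mem (s : ℝ) : dil n s ∈ SO₀ n := by
  refine toMatrix_mem_SO₀ (lorentz_dilMap (s / 2)) (fun x => ?_) ?_
  · rw [← dilMap_add, add_halves]
  · simpa [dilMap] using Real.cosh_pos s

lemma height_sub_trans (a : Horiz n) (v : Eucl n) :
    height (trans a) v - (trans a *ᵥ lift v) (Sum.inl ⊤) = 1 - v ⊤ := by
  rw [height, trans, LinearMap.toMatrix'_mulVec]; simp [transMap, lift, horEmb_top]

lemma height_sub_dil (s : ℝ) (v : Eucl n) :
    height (dil n s) v - (dil n s *ᵥ lift v) (Sum.inl ⊤) = Real.exp (-s) * (1 - v ⊤) := by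
  rw [height, dil, LinearMap.toMatrix'_mulVec]
  simp [dilMap, lift, ← Real.cosh_sub_sinh]; ring

lemma proj_ne_pole {A : Matrix (Fin n ⊕ Fin 1) (Fin n ⊕ Fin 1) ℝ} (hA : A ∈ SO₀ n) {v : Eucl n}
    (hv : ‖v‖ ≤ 1) (h : 0 < height A v - (A *ᵥ lift v) (Sum.inl ⊤)) : proj A v ≠ pole n := by
  intro hp
  have h2 := congrArg (fun v : Eucl n => v ⊤) hp
  simp only [pole_top, proj_apply] at h2
  rw [div_eq_one_iff_eq (height_pos hA hv).ne'] at h2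
  linarith

lemma proj_trans_ne_pole (a : Horiz n) {v : Eucl n} (hv : ‖v‖ ≤ 1) (hp : v ≠ pole n) :
    proj (trans a) v ≠ pole n := by
  refine proj_ne_pole (trans_mem a) hv ?_
  rw [height_sub_trans]
  linarith [top_lt_one hv hp]

lemma proj_dil_ne_pole (s : ℝ) {v : Eucl n} (hv : ‖v‖ ≤ 1) (hp : v ≠ pole n) :
    proj (dil n s) v ≠ pole n := by
  refine proj_ne_pole (dil_mem s) hv ?_
  rw [height_sub_dil]
  exact mul_pos (Real.exp_pos _) (by linarith [top_lt_one hv hp])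

lemma kleinChart_trans (a : Horiz n) {v : Eucl n} (hv : ‖v‖ ≤ 1) :
    kleinChart (proj (trans a) v) = kleinChart v + if v = pole n then 0 else horEmb a := by
  have hx : ∀ j, (trans a *ᵥ lift v) j = transMap a (lift v) j := fun j => by
    rw [trans, LinearMap.toMatrix'_mulVec]
  ext i
  rw [kleinChart_proj (trans_mem a) hv, height_sub_trans]
  split_ifs with hi hp hp
  · subst hi; simp [kleinChart_top]
  · subst hi; simp [kleinChart_top, horEmb_top]
  · subst hp; simp [kleinChart_apply _ hi, pole_top]
  · have h1 : 1 - v ⊤ ≠ 0 := by linarith [top_lt_one hv hp]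
    rw [hx]
    simp [transMap, hi, lift, kleinChart_apply _ hi]
    field_simp

lemma kleinChart_dil (s : ℝ) {v : Eucl n} (hv : ‖v‖ ≤ 1) (i : Fin n) :
    kleinChart (proj (dil n s) v) i =
      (if i = ⊤ then Real.exp (2 * s) else Real.exp s) * kleinChart v i := by
  have hx : ∀ j, (dil n s *ᵥ lift v) j = dilMap n s (lift v) j := fun j => by
    rw [dil, LinearMap.toMatrix'_mulVec]
  rw [kleinChart_proj (dil_mem s) hv, height_sub_dil]
  split_ifs with hi
  · subst hi
    rw [kleinChart_top, mul_pow, Real.exp_neg, two_mul, Real.exp_add, inv_pow,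
      ← div_div, div_inv_eq_mul]
    ring
  · rw [hx, kleinChart_apply _ hi, Real.exp_neg]
    simp [dilMap, hi, lift]
    rw [← div_div, div_inv_eq_mul]
    ring

lemma proj_pole_trans (a : Horiz n) : proj (trans a) (pole n) = pole n := by
  have hx : ∀ j, (trans a *ᵥ lift (pole n)) j = transMap a (lift (pole n)) j := fun j => by
    rw [trans, LinearMap.toMatrix'_mulVec]
  have hs : ∑ j, horEmb a j * (pole n) j = 0 := Finset.sum_eq_zero fun j _ => by
    by_cases hj : j = ⊤
    · subst hj; simp [horEmb_top]
    · simp [pole_apply hj]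
  ext i
  rw [proj_apply, height, hx, hx]
  by_cases hi : i = ⊤
  · subst hi; simp [transMap, lift, pole_top, hs]
  · simp [transMap, lift, pole_top, pole_apply hi, hi]

lemma proj_pole_dil (s : ℝ) : proj (dil n s) (pole n) = pole n := by
  have hx : ∀ j, (dil n s *ᵥ lift (pole n)) j = dilMap n s (lift (pole n)) j := fun j => by
    rw [dil, LinearMap.toMatrix'_mulVec]
  ext i
  rw [proj_apply, height, hx, hx]
  by_cases hi : i = ⊤
  · subst hi
    simp [dilMap, lift, pole_top, add_comm (Real.cosh s)]
  · simp [dilMap, lift, pole_apply hi, hi]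

lemma kleinChart_flip {i j : Fin n} (hi : i ≠ ⊤) (hj : j ≠ ⊤) (v : Eucl n) (k : Fin n) :
    kleinChart (proj (flip i j) v) k = if k = i ∨ k = j then -kleinChart v k else kleinChart v k := by
  have ht : proj (flip i j) v ⊤ = v ⊤ := by
    rw [proj_flip, if_neg]; rintro (h | h); exacts [hi h.symm, hj h.symm]
  by_cases hk : k = ⊤
  · subst hk
    rw [if_neg (by rintro (h | h); exacts [hi h.symm, hj h.symm]), kleinChart_top, kleinChart_top,
      norm_proj_flip, ht]
  · rw [kleinChart_apply _ hk, kleinChart_apply _ hk, ht, proj_flip]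
    split_ifs <;> ring

lemma proj_trans_add (a b : Horiz n) {v : Eucl n} (hv : ‖v‖ ≤ 1) :
    proj (trans (a + b)) v = proj (trans a) (proj (trans b) v) := by
  by_cases hp : v = pole n
  · rw [hp, proj_pole_trans, proj_pole_trans, proj_pole_trans]
  have hb := proj_mem_cball (trans_mem b) hv
  have hbp := proj_trans_ne_pole b hv hp
  refine kleinChart_inj (proj_mem_cball (trans_mem _) hv) (proj_trans_ne_pole _ hv hp)
    (proj_mem_cball (trans_mem a) hb) (proj_trans_ne_pole _ hb hbp) ?_
  rw [kleinChart_trans _ hv, kleinChart_trans _ hb, kleinChart_trans _ hv,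
    if_neg hp, if_neg hp, if_neg hbp, horEmb_add]
  abel

lemma proj_dil_add (s t : ℝ) {v : Eucl n} (hv : ‖v‖ ≤ 1) :
    proj (dil n (s + t)) v = proj (dil n s) (proj (dil n t) v) := by
  by_cases hp : v = pole n
  · rw [hp, proj_pole_dil, proj_pole_dil, proj_pole_dil]
  have hb := proj_mem_cball (dil_mem t) hv
  refine kleinChart_inj (proj_mem_cball (dil_mem _) hv) (proj_dil_ne_pole _ hv hp)
    (proj_mem_cball (dil_mem s) hb) (proj_dil_ne_pole _ hb (proj_dil_ne_pole t hv hp)) ?_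
  ext i
  rw [kleinChart_dil _ hv, kleinChart_dil _ hb, kleinChart_dil _ hv]
  split_ifs
  · rw [mul_add, Real.exp_add]; ring
  · rw [Real.exp_add]; ring

/-- The half-turn exchanging the poles acts as an inversion in the Klein chart. -/
lemma kleinChart_flip_top {j : Fin n} {v : Eucl n} (hv : ‖v‖ ≤ 1) (hp : v ≠ pole n)
    {k : Fin n} (hk : k ≠ ⊤) : kleinChart (proj (flip ⊤ j) v) k *
      (‖kleinChart v‖ ^ 2 - kleinChart v ⊤ ^ 2 + kleinChart v ⊤) =
      if k = j then -kleinChart v k else kleinChart v k := by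
  have h1 : 0 < 1 - v ⊤ := by linarith [top_lt_one hv hp]
  have h2 := depth_kleinChart hv hp
  have h3 := depth_denom_pos (kleinChart_top_nonneg hv)
  set m := ‖kleinChart v‖ ^ 2 - kleinChart v ⊤ ^ 2 + kleinChart v ⊤ with hm
  have h3' : 0 < 1 + m := by rw [hm]; linarith
  have hden : (1 - v ⊤) * (1 + m) = 2 := by
    rw [← h2, depth, ← add_assoc]
    exact div_mul_cancel₀ _ (by rw [← add_assoc] at h3'; exact h3.ne')
  have ht : 1 - proj (flip ⊤ j) v ⊤ = (1 - v ⊤) * m := by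
    rw [proj_flip, if_pos (Or.inl rfl)]
    linear_combination -hden
  rw [kleinChart_apply _ hk, kleinChart_apply _ hk, ht, proj_flip]
  simp only [hk, false_or]
  by_cases hm0 : m = 0
  · have hvk : v k = 0 := by
      have h4 : kleinChart v k = 0 := by
        have h5 : kleinChart v k ^ 2 ≤ ‖kleinChart v‖ ^ 2 - kleinChart v ⊤ ^ 2 := by
          rw [norm_sq_eq_top_add, add_sub_cancel_left]
          exact Finset.single_le_sum (f := fun i => kleinChart v i ^ 2)
            (fun _ _ => sq_nonneg _) (Finset.mem_erase.2 ⟨hk, Finset.mem_univ _⟩)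
        have h6 := kleinChart_top_nonneg hv
        have : kleinChart v k ^ 2 ≤ 0 := by rw [hm] at hm0; linarith
        exact pow_eq_zero_iff two_ne_zero |>.1 (le_antisymm this (sq_nonneg _))
      rw [kleinChart_apply _ hk, div_eq_zero_iff] at h4
      exact h4.resolve_right h1.ne'
    simp [hvk]
  · split_ifs <;> field_simp

end Elements

/-! ### Actions on the closed ball defined by a compactification -/

section Ball

variable {n : ℕ}

lemma mem_cball {v : Eucl n} : v ∈ cball n ↔ ‖v‖ ≤ 1 := mem_closedBall_zero_iff

lemma mem_oball {v : Eucl n} : v ∈ oball n ↔ ‖v‖ < 1 := mem_ball_zero_iff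

lemma interior_cball : interior (cball n) = oball n := interior_closedBall _ one_ne_zero

lemma uniqueDiffOn_cball : UniqueDiffOn ℝ (cball n) :=
  uniqueDiffOn_convex (convex_closedBall _ _) (by
    rw [interior_cball]; exact ⟨0, Metric.mem_ball_self one_pos⟩)

lemma cball_subset_closure : cball n ⊆ closure (oball n) := by
  rw [closure_ball _ one_ne_zero]

lemma nonempty_interior_cball : (interior (cball n)).Nonempty := by
  rw [interior_cball]; exact ⟨0, Metric.mem_ball_self one_pos⟩

/-- The boundary defining function `1 - |v|²` of the closed ball. -/
def defect (v : Eucl n) : ℝ := 1 - ‖v‖ ^ 2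

lemma contDiff_defect : ContDiff ℝ ∞ (defect (n := n)) := contDiff_const.sub (contDiff_norm_sq ℝ)

lemma defect_nonneg {v : Eucl n} (hv : ‖v‖ ≤ 1) : 0 ≤ defect v := by
  rw [defect]; nlinarith [norm_nonneg v]

/-- A smooth action of the ball that preserves the sphere changes `1 - |v|²` by a bounded
factor. -/
lemma SmoothAction.exists_mul_defect_le {P : Type*} [NormedAddCommGroup P] [NormedSpace ℝ P]
    [CompleteSpace P] {T : P → Eucl n → Eucl n} (hT : SmoothAction T (cball n))
    (hsph : ∀ a v, ‖v‖ = 1 → ‖T a v‖ = 1) (hzero : ∀ v ∈ cball n, T 0 v = v) {A : Set P}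
    (hA : IsCompact A) : ∃ c > 0, ∀ a ∈ A, ∀ v ∈ cball n, c * defect v ≤ defect (T a v) := by
  obtain ⟨C, hC1, hC⟩ := hT.exists_lipschitz (isCompact_closedBall _ _) (convex_closedBall _ _)
    nonempty_interior_cball hA.neg
  refine ⟨(2 * C)⁻¹, by positivity, fun a ha v hv => ?_⟩
  have hu := mem_cball.1 (hT.mapsTo a hv)
  have hv1 := mem_cball.1 hv
  set u := T a v with hudef
  have huv : T (-a) u = v := by
    rw [hudef, ← hT.add _ _ _ hv, neg_add_cancel, hzero v hv]
  have key : 1 - ‖v‖ ≤ C * (1 - ‖u‖) := by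
    by_cases h0 : u = 0
    · rw [h0, norm_zero]; nlinarith [norm_nonneg v]
    · have hn : 0 < ‖u‖ := norm_pos_iff.2 h0
      have h1 : ‖(‖u‖⁻¹ • u)‖ = 1 := by
        rw [norm_smul, norm_inv, norm_norm, inv_mul_cancel₀ hn.ne']
      have h2 := hC (-a) (neg_mem_neg.2 ha) (‖u‖⁻¹ • u) (mem_cball.2 h1.le) u (mem_cball.2 hu)
      have h3 : ‖‖u‖⁻¹ • u - u‖ = 1 - ‖u‖ := by
        have : ‖u‖⁻¹ • u - u = (‖u‖⁻¹ - 1) • u := by rw [sub_smul, one_smul]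
        rw [this, norm_smul, Real.norm_of_nonneg (by
          rw [sub_nonneg]; exact (one_le_inv₀ hn).2 hu), sub_mul, inv_mul_cancel₀ hn.ne', one_mul]
      rw [h3, huv] at h2
      have h4 := norm_sub_norm_le (T (-a) (‖u‖⁻¹ • u)) v
      rw [hsph _ _ h1] at h4
      linarith
  rw [inv_mul_le_iff₀ (by positivity), defect, defect]
  have e1 : 0 ≤ 1 - ‖u‖ := by linarith
  nlinarith [norm_nonneg v, norm_nonneg u, mul_nonneg (mul_nonneg (zero_le_one.trans hC1) e1)
    (norm_nonneg u)]

end Ball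

namespace IsHomeo

variable {n : ℕ} {φ : PartialEquiv (Eucl n) (Eucl n)}

lemma norm_le (h : IsHomeo φ (cball n) (cball n)) {v : Eucl n} (hv : ‖v‖ ≤ 1) : ‖φ v‖ ≤ 1 := by
  have := φ.map_source (x := v) (by rw [h.source_eq]; exact mem_cball.2 hv)
  rw [h.target_eq] at this
  exact mem_cball.1 this

lemma norm_symm_le (h : IsHomeo φ (cball n) (cball n)) {v : Eucl n} (hv : ‖v‖ ≤ 1) :
    ‖φ.symm v‖ ≤ 1 := by
  have := φ.map_target (x := v) (by rw [h.target_eq]; exact mem_cball.2 hv)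
  rw [h.source_eq] at this
  exact mem_cball.1 this

lemma left_inv (h : IsHomeo φ (cball n) (cball n)) {v : Eucl n} (hv : ‖v‖ ≤ 1) :
    φ.symm (φ v) = v := φ.left_inv (by rw [h.source_eq]; exact mem_cball.2 hv)

lemma right_inv (h : IsHomeo φ (cball n) (cball n)) {v : Eucl n} (hv : ‖v‖ ≤ 1) :
    φ (φ.symm v) = v := φ.right_inv (by rw [h.target_eq]; exact mem_cball.2 hv)

lemma inj (h : IsHomeo φ (cball n) (cball n)) {v w : Eucl n} (hv : ‖v‖ ≤ 1) (hw : ‖w‖ ≤ 1)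
    (hvw : φ v = φ w) : v = w := by
  rw [← h.left_inv hv, hvw, h.left_inv hw]

end IsHomeo

namespace IsSmoothCompactification

variable {n : ℕ} {φ : PartialEquiv (Eucl n) (Eucl n)}

lemma norm_lt (h : IsSmoothCompactification φ) {v : Eucl n} (hv : ‖v‖ < 1) : ‖φ v‖ < 1 := by
  have : φ v ∈ φ '' oball n := mem_image_of_mem _ (mem_oball.2 hv)
  rw [h.image_oball] at this
  exact mem_oball.1 this

lemma norm_symm_lt (h : IsSmoothCompactification φ) {v : Eucl n} (hv : ‖v‖ < 1) :
    ‖φ.symm v‖ < 1 := by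
  have : v ∈ φ '' oball n := by rw [h.image_oball]; exact mem_oball.2 hv
  obtain ⟨w, hw, rfl⟩ := this
  rw [h.isHomeo.left_inv (mem_oball.1 hw).le]
  exact mem_oball.1 hw

lemma norm_eq_one (h : IsSmoothCompactification φ) {v : Eucl n} (hv : ‖v‖ = 1) : ‖φ v‖ = 1 := by
  refine le_antisymm (h.isHomeo.norm_le hv.le) (not_lt.1 fun hlt => ?_)
  have := h.norm_symm_lt hlt
  rw [h.isHomeo.left_inv hv.le, hv] at this
  exact lt_irrefl _ this

lemma norm_symm_eq_one (h : IsSmoothCompactification φ) {v : Eucl n} (hv : ‖v‖ = 1) :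
    ‖φ.symm v‖ = 1 := by
  refine le_antisymm (h.isHomeo.norm_symm_le hv.le) (not_lt.1 fun hlt => ?_)
  have := h.norm_lt hlt
  rw [h.isHomeo.right_inv hv.le, hv] at this
  exact lt_irrefl _ this

variable {A : Matrix (Fin n ⊕ Fin 1) (Fin n ⊕ Fin 1) ℝ}

lemma continuousOn_conjAct (h : IsHomeo φ (cball n) (cball n)) (hA : A ∈ SO₀ n) :
    ContinuousOn (conjAct φ A) (cball n) := by
  have h1 : ContinuousOn (proj A) (cball n) := fun v hv =>
    (contDiffAt_proj (height_pos hA (mem_cball.1 hv)).ne').continuousAt.continuousWithinAt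
  exact h.continuousOn_symm.comp (h1.comp h.continuousOn fun v hv =>
    mem_cball.2 (h.norm_le (mem_cball.1 hv))) fun v hv =>
      mem_cball.2 (proj_mem_cball hA (h.norm_le (mem_cball.1 hv)))

lemma contDiffOn_conjAct (h : IsSmoothCompactification φ) (hA : A ∈ SO₀ n) :
    ContDiffOn ℝ ∞ (conjAct φ A) (cball n) := by
  obtain ⟨F, hF, hFe⟩ := h.extends_smoothly A hA
  exact hF.congr (hFe.symm.of_subset_closure (continuousOn_conjAct h.isHomeo hA) hF.continuousOn
    Metric.ball_subset_closedBall cball_subset_closure)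

lemma norm_conjAct_le (h : IsHomeo φ (cball n) (cball n)) (hA : A ∈ SO₀ n) {v : Eucl n}
    (hv : ‖v‖ ≤ 1) : ‖conjAct φ A v‖ ≤ 1 :=
  h.norm_symm_le (proj_mem_cball hA (h.norm_le hv))

lemma norm_conjAct_lt (h : IsSmoothCompactification φ) (hA : A ∈ SO₀ n) {v : Eucl n}
    (hv : ‖v‖ < 1) : ‖conjAct φ A v‖ < 1 :=
  h.norm_symm_lt (proj_mem_oball hA (h.norm_lt hv))

lemma norm_conjAct_eq_one (h : IsSmoothCompactification φ) (hA : A ∈ SO₀ n) {v : Eucl n}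
    (hv : ‖v‖ = 1) : ‖conjAct φ A v‖ = 1 :=
  h.norm_symm_eq_one (norm_proj_eq_one hA (h.norm_eq_one hv))

lemma apply_conjAct (h : IsHomeo φ (cball n) (cball n)) (hA : A ∈ SO₀ n) {v : Eucl n}
    (hv : ‖v‖ ≤ 1) : φ (conjAct φ A v) = proj A (φ v) :=
  h.right_inv (proj_mem_cball hA (h.norm_le hv))

lemma conjAct_eq_self (h : IsHomeo φ (cball n) (cball n)) (hA : ∀ v : Eucl n, ‖v‖ ≤ 1 → proj A v = v)
    {v : Eucl n} (hv : ‖v‖ ≤ 1) : conjAct φ A v = v := by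
  rw [conjAct, hA _ (h.norm_le hv), h.left_inv hv]

variable [NeZero n]

/-- The point that a compactification sends to the pole. -/
def poleInv (φ : PartialEquiv (Eucl n) (Eucl n)) : Eucl n := φ.symm (pole n)

lemma norm_poleInv (h : IsSmoothCompactification φ) : ‖poleInv φ‖ = 1 :=
  h.norm_symm_eq_one norm_pole

lemma apply_poleInv (h : IsHomeo φ (cball n) (cball n)) : φ (poleInv φ) = pole n :=
  h.right_inv norm_pole.le

lemma apply_ne_pole (h : IsHomeo φ (cball n) (cball n)) {v : Eucl n} (hv : ‖v‖ ≤ 1)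
    (hp : v ≠ poleInv φ) : φ v ≠ pole n := fun hvp => hp (by
  rw [poleInv, ← hvp, h.left_inv hv])

/-- The linear map `(X, Y) ↦ (eˢ X, e²ˢ Y)`. -/
def scale (s : ℝ) (z : Eucl n) : Eucl n :=
  WithLp.toLp 2 fun i => (if i = ⊤ then Real.exp (2 * s) else Real.exp s) * z i

lemma kleinChart_dil_eq_scale (s : ℝ) {v : Eucl n} (hv : ‖v‖ ≤ 1) :
    kleinChart (proj (dil n s) v) = scale s (kleinChart v) := by
  ext i
  rw [kleinChart_dil _ hv]
  rfl

lemma contDiff_scale : ContDiff ℝ ω fun q : ℝ × Eucl n => scale q.1 q.2 := by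
  rw [contDiff_euclidean]
  intro i
  simp only [scale]
  split_ifs
  · exact ((Real.contDiff_exp.comp (by fun_prop))).mul (by fun_prop)
  · exact ((Real.contDiff_exp.comp (by fun_prop))).mul (by fun_prop)

lemma proj_trans_zero {v : Eucl n} (hv : ‖v‖ ≤ 1) : proj (trans (0 : Horiz n)) v = v := by
  have h := proj_mem_cball (trans_mem (0 : Horiz n)) hv
  by_cases hp : v = pole n
  · rw [hp, proj_pole_trans]
  refine kleinChart_inj h (proj_trans_ne_pole _ hv hp) hv hp ?_
  have h0 : horEmb (0 : Horiz n) = 0 := by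
    ext i; by_cases hi : i = ⊤
    · subst hi; simp [horEmb_top]
    · simp [horEmb_apply _ hi]
  rw [kleinChart_trans _ hv, if_neg hp, h0, add_zero]

lemma proj_dil_zero {v : Eucl n} (hv : ‖v‖ ≤ 1) : proj (dil n 0) v = v := by
  have h := proj_mem_cball (dil_mem 0) hv
  by_cases hp : v = pole n
  · rw [hp, proj_pole_dil]
  refine kleinChart_inj h (proj_dil_ne_pole _ hv hp) hv hp ?_
  ext i
  rw [kleinChart_dil _ hv]
  simp

/-- A jointly smooth formula in the Klein chart makes the conjugated action of a family of
isometries jointly smooth on the open ball. -/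
lemma contDiffOn_uncurry_conjAct (h : IsSmoothCompactification φ) {P : Type*}
    [NormedAddCommGroup P] [NormedSpace ℝ P]
    {A : P → Matrix (Fin n ⊕ Fin 1) (Fin n ⊕ Fin 1) ℝ} (hA : ∀ a, A a ∈ SO₀ n)
    (hAp : ∀ a, ∀ v : Eucl n, ‖v‖ ≤ 1 → v ≠ pole n → proj (A a) v ≠ pole n)
    {m : P × Eucl n → Eucl n} (hm : ContDiff ℝ ∞ m)
    (hAm : ∀ a, ∀ v : Eucl n, ‖v‖ ≤ 1 → v ≠ pole n →
      kleinChart (proj (A a) v) = m (a, kleinChart v)) :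
    ContDiffOn ℝ ∞ (Function.uncurry fun a => conjAct φ (A a)) (univ ×ˢ oball n) := by
  have heq : EqOn (Function.uncurry fun a => conjAct φ (A a))
      (fun q : P × Eucl n => φ.symm (kleinInv (m (q.1, kleinChart (φ q.2))))) (univ ×ˢ oball n) := by
    rintro ⟨a, v⟩ ⟨-, hv⟩
    have hv' := h.norm_lt (mem_oball.1 hv)
    have hvp := ne_pole_of_norm_lt hv'
    simp only [Function.uncurry_apply_pair, conjAct]
    rw [← hAm a _ hv'.le hvp, kleinInv_kleinChart (proj_mem_cball (hA a) hv'.le)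
      (hAp a _ hv'.le hvp)]
  refine ContDiffOn.congr ?_ heq
  have htop : ∀ q ∈ (univ : Set P) ×ˢ oball n, 0 < m (q.1, kleinChart (φ q.2)) ⊤ := by
    rintro ⟨a, v⟩ ⟨-, hv⟩
    have hv' := h.norm_lt (mem_oball.1 hv)
    rw [← hAm a _ hv'.le (ne_pole_of_norm_lt hv')]
    exact kleinChart_top_pos (proj_mem_oball (hA a) hv')
  refine h.contDiffOn_symm.comp (t := oball n) ?_ fun q hq =>
    mem_oball.2 (kleinInv_mem_oball (htop q hq))
  intro q hq
  have hv' := h.norm_lt (mem_oball.1 hq.2)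
  have h1 : ContDiffWithinAt ℝ ∞ (fun q : P × Eucl n => φ q.2) (univ ×ˢ oball n) q :=
    (h.contDiffOn.comp (t := oball n) contDiffOn_snd fun q hq => hq.2) q hq
  have h2 : ContDiffWithinAt ℝ ∞ (fun q : P × Eucl n => kleinChart (φ q.2)) (univ ×ˢ oball n) q :=
    ((contDiffAt_kleinChart (top_lt_one hv'.le (ne_pole_of_norm_lt hv'))).of_le
      (by simp)).comp_contDiffWithinAt (f := fun q : P × Eucl n => φ q.2) q h1
  have h3 : ContDiffWithinAt ℝ ∞ (fun q : P × Eucl n => m (q.1, kleinChart (φ q.2)))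
      (univ ×ˢ oball n) q :=
    hm.contDiffAt.comp_contDiffWithinAt q (contDiffWithinAt_fst.prodMk h2)
  exact ((contDiffAt_kleinInv (htop q hq).le).of_le
    (by simp)).comp_contDiffWithinAt (f := fun q : P × Eucl n => m (q.1, kleinChart (φ q.2))) q h3

/-- Read through a smooth compactification, the horizontal translations act smoothly. -/
lemma smoothAction_trans (h : IsSmoothCompactification φ) :
    SmoothAction (fun a : Horiz n => conjAct φ (trans a)) (cball n) where
  contDiffOn a := h.contDiffOn_conjAct (trans_mem a)
  mapsTo a v hv := mem_cball.2 (norm_conjAct_le h.isHomeo (trans_mem a) (mem_cball.1 hv))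
  mapsTo_interior a v hv := by
    rw [interior_cball] at hv ⊢
    exact mem_oball.2 (h.norm_conjAct_lt (trans_mem a) (mem_oball.1 hv))
  add a b v hv := by
    have hb := proj_mem_cball (trans_mem b) (h.isHomeo.norm_le (mem_cball.1 hv))
    simp only [conjAct]
    rw [h.isHomeo.right_inv hb, proj_trans_add _ _ (h.isHomeo.norm_le (mem_cball.1 hv))]
  joint := by
    rw [interior_cball]
    refine h.contDiffOn_uncurry_conjAct trans_mem
      (fun a v hv hp => proj_trans_ne_pole a hv hp) (m := fun q => q.2 + horEmb q.1)
      (contDiff_snd.add ((contDiff_horEmb.of_le (by simp)).comp contDiff_fst)) fun a v hv hp => ?_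
    rw [kleinChart_trans a hv, if_neg hp]

/-- Read through a smooth compactification, the dilations act smoothly. -/
lemma smoothAction_dil (h : IsSmoothCompactification φ) :
    SmoothAction (fun s : ℝ => conjAct φ (dil n s)) (cball n) where
  contDiffOn a := h.contDiffOn_conjAct (dil_mem a)
  mapsTo a v hv := mem_cball.2 (norm_conjAct_le h.isHomeo (dil_mem a) (mem_cball.1 hv))
  mapsTo_interior a v hv := by
    rw [interior_cball] at hv ⊢
    exact mem_oball.2 (h.norm_conjAct_lt (dil_mem a) (mem_oball.1 hv))
  add a b v hv := by
    have hb := proj_mem_cball (dil_mem b) (h.isHomeo.norm_le (mem_cball.1 hv))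
    simp only [conjAct]
    rw [h.isHomeo.right_inv hb, proj_dil_add _ _ (h.isHomeo.norm_le (mem_cball.1 hv))]
  joint := by
    rw [interior_cball]
    exact h.contDiffOn_uncurry_conjAct dil_mem
      (fun a v hv hp => proj_dil_ne_pole a hv hp) (m := fun q => scale q.1 q.2)
      (contDiff_scale.of_le (by simp)) fun a v hv hp => kleinChart_dil_eq_scale a hv

end IsSmoothCompactification

/-! ### Smoothness of `f / f'` -/

section Necessity

variable {n : ℕ} [NeZero n]

open IsSmoothCompactification

/-- The point of height `w` on the vertical axis of the half-space. -/
def vertical (n : ℕ) [NeZero n] (w : ℝ) : Eucl n := EuclideanSpace.single ⊤ w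

lemma vertical_top (w : ℝ) : vertical n w ⊤ = w := by simp [vertical]

lemma vertical_apply (w : ℝ) {i : Fin n} (hi : i ≠ ⊤) : vertical n w i = 0 := by
  simp [vertical, hi]

lemma contDiff_vertical : ContDiff ℝ ω (vertical n) := by
  rw [contDiff_euclidean]
  intro i
  by_cases hi : i = ⊤
  · subst hi; simp only [vertical_top]; fun_prop
  · simp only [vertical_apply _ hi]; fun_prop

lemma vertical_mem {w : ℝ} (hw : 0 ≤ w) : vertical n w ∈ halfSpace n := by
  rw [halfSpace, mem_ofPred_eq, vertical_top]; exact hw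

lemma vertMap_vertical {f : ℝ → ℝ} (w : ℝ) : vertMap f (vertical n w) = vertical n (f w) := by
  ext i
  by_cases hi : i = ⊤
  · subst hi; simp [vertMap, vertical_top]
  · simp [vertMap, hi, vertical_apply _ hi]

lemma vertMap_top (f : ℝ → ℝ) (z : Eucl n) : vertMap f z ⊤ = f (z ⊤) := by simp [vertMap]

lemma vertMap_apply (f : ℝ → ℝ) (z : Eucl n) {i : Fin n} (hi : i ≠ ⊤) :
    vertMap f z i = z i := by simp [vertMap, hi]

lemma vertMap_vertMap {g k : ℝ → ℝ} {z : Eucl n} (hz : g (k (z ⊤)) = z ⊤) :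
    vertMap g (vertMap k z) = z := by
  ext i
  by_cases hi : i = ⊤
  · subst hi; rw [vertMap_top, vertMap_top, hz]
  · rw [vertMap_apply _ _ hi, vertMap_apply _ _ hi]

lemma scale_vertical (s w : ℝ) :
    scale s (vertical n w) = vertical n (Real.exp (2 * s) * w) := by
  ext i
  by_cases hi : i = ⊤
  · subst hi; simp [scale, vertical_top]
  · simp [scale, vertical_apply _ hi]

/-- `χ` is a half-space chart that misses the preimage of the pole and in which `φ` reads `φ_f`. -/
structure ChartFor (f : ℝ → ℝ) (φ χ : PartialEquiv (Eucl n) (Eucl n)) : Prop where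
  diffeo : IsDiffeo ∞ χ (cball n \ {poleInv φ}) (halfSpace n)
  eq : ∀ v ∈ cball n \ {poleInv φ}, kleinChart (φ v) = vertMap f (χ v)

lemma IsGivenBy.exists_chartFor {f : ℝ → ℝ} {φ : PartialEquiv (Eucl n) (Eucl n)}
    (h : IsGivenBy f φ) : ∃ χ, ChartFor f φ χ := by
  obtain ⟨hφ, p, χ, hχ, hp, heq⟩ := h
  have : p = poleInv φ := by rw [poleInv, ← hp, hφ.left_inv hχ.1.le]
  subst this
  exact ⟨χ, hχ.2, heq⟩

namespace ChartFor

variable {φ χ : PartialEquiv (Eucl n) (Eucl n)}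

lemma symm_mem {f : ℝ → ℝ} (h : ChartFor f φ χ) {z : Eucl n} (hz : 0 ≤ z ⊤) :
    χ.symm z ∈ cball n \ {poleInv φ} := by
  have := χ.map_target (x := z) (by rw [h.diffeo.target_eq]; exact hz)
  rwa [h.diffeo.source_eq] at this

lemma right_inv {f : ℝ → ℝ} (h : ChartFor f φ χ) {z : Eucl n} (hz : 0 ≤ z ⊤) :
    χ (χ.symm z) = z := χ.right_inv (by rw [h.diffeo.target_eq]; exact hz)

lemma top_nonneg {f : ℝ → ℝ} (h : ChartFor f φ χ) {v : Eucl n}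
    (hv : v ∈ cball n \ {poleInv φ}) : 0 ≤ χ v ⊤ := by
  have := χ.map_source (x := v) (by rw [h.diffeo.source_eq]; exact hv)
  rwa [h.diffeo.target_eq] at this

lemma kleinChart_symm {f : ℝ → ℝ} (h : ChartFor f φ χ) {z : Eucl n} (hz : 0 ≤ z ⊤) :
    kleinChart (φ (χ.symm z)) = vertMap f z := by
  rw [h.eq _ (h.symm_mem hz), h.right_inv hz]

lemma kleinChart_top {f : ℝ → ℝ} (h : ChartFor f φ χ) {v : Eucl n}
    (hv : v ∈ cball n \ {poleInv φ}) : kleinChart (φ v) ⊤ = f (χ v ⊤) := by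
  rw [h.eq v hv]; simp [vertMap]

/-- Along the vertical axis of the chart, dilations act by the scaling flow of the profile. -/
lemma conjAct_dil_vertical {f : PartialEquiv ℝ ℝ} (hf : IsProfile f) (h : ChartFor f φ χ)
    (hφ : IsHomeo φ (cball n) (cball n)) (s : ℝ) {w : ℝ} (hw : 0 ≤ w) :
    conjAct φ (dil n s) (χ.symm (vertical n w)) =
      χ.symm (vertical n (scaleFlow f (2 * s, w))) := by
  have hz : 0 ≤ vertical n w ⊤ := by rwa [vertical_top]
  have hc := h.symm_mem hz
  have hv := mem_cball.1 hc.1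
  have hφv := hφ.norm_le hv
  have hg := hf.scaleFlow_nonneg (2 * s) hw
  have hz' : 0 ≤ vertical n (scaleFlow f (2 * s, w)) ⊤ := by rwa [vertical_top]
  have hc' := h.symm_mem hz'
  have hv' := mem_cball.1 hc'.1
  have hne := apply_ne_pole hφ hv hc.2
  rw [conjAct, ← hφ.left_inv hv']
  congr 1
  refine kleinChart_inj (proj_mem_cball (dil_mem s) hφv) (proj_dil_ne_pole s hφv hne)
    (hφ.norm_le hv') (apply_ne_pole hφ hv' hc'.2) ?_
  rw [kleinChart_dil_eq_scale s hφv, h.kleinChart_symm hz, h.kleinChart_symm hz', vertMap_vertical,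
    vertMap_vertical, scale_vertical, hf.apply_scaleFlow _ hw]

lemma norm_symm_vertical_zero {f : PartialEquiv ℝ ℝ} (hf : IsProfile f) (h : ChartFor f φ χ)
    (hφ : IsSmoothCompactification φ) {z : Eucl n} (hz : z ⊤ = 0) : ‖χ.symm z‖ = 1 := by
  refine le_antisymm (mem_cball.1 (h.symm_mem hz.ge).1) (not_lt.1 fun hlt => ?_)
  have h1 := kleinChart_top_pos (hφ.norm_lt hlt)
  rw [h.kleinChart_symm hz.ge] at h1
  simp [vertMap, hz, hf.apply_zero] at h1

lemma top_eq_zero {f : PartialEquiv ℝ ℝ} (hf : IsProfile f) (h : ChartFor f φ χ)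
    (hφ : IsSmoothCompactification φ) {v : Eucl n} (hv : ‖v‖ = 1) (hp : v ≠ poleInv φ) :
    χ v ⊤ = 0 := by
  have hm : v ∈ cball n \ {poleInv φ} := ⟨mem_cball.2 hv.le, hp⟩
  have h1 := kleinChart_top_eq_zero (hφ.norm_eq_one hv)
  rw [h.kleinChart_top hm] at h1
  by_contra hne
  exact (hf.pos (lt_of_le_of_ne (h.top_nonneg hm) (Ne.symm hne))).ne' h1

lemma contDiffOn_axis {f : ℝ → ℝ} (h : ChartFor f φ χ) :
    ContDiffOn ℝ ∞ (fun w => χ.symm (vertical n w)) (Ici 0) :=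
  h.diffeo.contDiffOn_symm.comp (contDiff_vertical.of_le (by simp)).contDiffOn
    fun _ hw => vertical_mem hw

/-- The axis of the chart is transverse to the sphere. -/
lemma exists_le_defect {f : PartialEquiv ℝ ℝ} (hf : IsProfile f) (h : ChartFor f φ χ)
    (hφ : IsSmoothCompactification φ) :
    ∃ K > 0, ∀ᶠ w in 𝓝[≥] (0 : ℝ), w ≤ K * defect (χ.symm (vertical n w)) := by
  set c : ℝ → Eucl n := fun w => χ.symm (vertical n w) with hc
  have hcm : ∀ w, 0 ≤ w → c w ∈ cball n \ {poleInv φ} := fun w hw =>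
    h.symm_mem (by rwa [vertical_top])
  have hc0 := hcm 0 le_rfl
  have hn0 : ‖c 0‖ = 1 := h.norm_symm_vertical_zero hf hφ (vertical_top 0)
  have hnhds : cball n \ {poleInv φ} ∈ 𝓝[cball n] (c 0) :=
    inter_mem self_mem_nhdsWithin
      (mem_nhdsWithin_of_mem_nhds (isOpen_compl_singleton.mem_nhds hc0.2))
  have hχ : ContDiffWithinAt ℝ 1 χ (cball n) (c 0) :=
    ((h.diffeo.contDiffOn (c 0) hc0).mono_of_mem_nhdsWithin hnhds).of_le (by simp)
  obtain ⟨K, t, ht, hK⟩ := hχ.exists_lipschitzOnWith (convex_closedBall _ _)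
  have ht' := Filter.inter_mem ht hnhds
  have hct : Tendsto c (𝓝[≥] 0) (𝓝[cball n] (c 0)) :=
    (h.contDiffOn_axis.continuousOn 0 self_mem_Ici).tendsto_nhdsWithin fun w hw => (hcm w hw).1
  have hcont : ContinuousAt (fun v : Eucl n => ‖v‖⁻¹ • v) (c 0) := by
    refine ContinuousAt.smul (ContinuousAt.inv₀ continuous_norm.continuousAt ?_) continuousAt_id
    rw [hn0]; exact one_ne_zero
  have hct2 : Tendsto (fun w => ‖c w‖⁻¹ • c w) (𝓝[≥] 0) (𝓝 (c 0)) := by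
    have := hcont.tendsto.comp (hct.mono_right nhdsWithin_le_nhds)
    simpa [hn0, Function.comp_def] using this
  have hnz : ∀ᶠ w in 𝓝[≥] (0 : ℝ), c w ≠ 0 :=
    (hct.mono_right nhdsWithin_le_nhds).eventually_ne (by
      intro h0; rw [h0, norm_zero] at hn0; exact zero_ne_one hn0)
  have hct3 : Tendsto (fun w => ‖c w‖⁻¹ • c w) (𝓝[≥] 0) (𝓝[cball n] (c 0)) := by
    refine tendsto_nhdsWithin_iff.2 ⟨hct2, ?_⟩
    filter_upwards [hnz] with w hw
    rw [mem_cball, norm_smul, norm_inv, norm_norm, inv_mul_cancel₀ (norm_ne_zero_iff.2 hw)]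
  -- compare a point of the axis with its radial projection to the sphere, where the height is `0`
  refine ⟨K + 1, by positivity, ?_⟩
  filter_upwards [hct.eventually ht', hct3.eventually ht', hnz, self_mem_nhdsWithin]
    with w h1 h2 h3 hw
  have hn : 0 < ‖c w‖ := norm_pos_iff.2 h3
  have hn1 := mem_cball.1 (hcm w hw).1
  have h4 := hK.dist_le_mul _ h1.1 _ h2.1
  have h5 : ‖(‖c w‖⁻¹ • c w)‖ = 1 := by
    rw [norm_smul, norm_inv, norm_norm, inv_mul_cancel₀ hn.ne']
  have h6 : χ (‖c w‖⁻¹ • c w) ⊤ = 0 := h.top_eq_zero hf hφ h5 h2.2.2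
  have h7 : χ (c w) ⊤ = w := by
    rw [hc]; simp only; rw [h.right_inv (by rwa [vertical_top]), vertical_top]
  have h8 : dist (c w) (‖c w‖⁻¹ • c w) = 1 - ‖c w‖ := by
    have : c w - ‖c w‖⁻¹ • c w = (1 - ‖c w‖⁻¹) • c w := by rw [sub_smul, one_smul]
    rw [dist_eq_norm, this, norm_smul, Real.norm_of_nonpos (by
      rw [sub_nonpos]; exact (one_le_inv₀ hn).2 hn1), neg_sub, sub_mul,
      inv_mul_cancel₀ hn.ne', one_mul]
  have h9 : |χ (c w) ⊤ - χ (‖c w‖⁻¹ • c w) ⊤| ≤ dist (χ (c w)) (χ (‖c w‖⁻¹ • c w)) := by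
    rw [dist_eq_norm]
    exact PiLp.norm_apply_le (χ (c w) - χ (‖c w‖⁻¹ • c w)) ⊤
  rw [h6, h7, sub_zero, abs_of_nonneg hw] at h9
  rw [h8] at h4
  have h10 : 1 - ‖c w‖ ≤ defect (c w) := by rw [defect]; nlinarith
  have hK0 : (0 : ℝ) ≤ K := K.2
  nlinarith [defect_nonneg hn1]

end ChartFor

/-- If the dilations act smoothly up to the boundary, then the generator `f / f'` of their action
on the vertical axis is smooth: averaging `1 - |v|²` along the dilations gives a function `Θ` of
the height `w`, smooth up to the boundary with `Θ' (0) > 0`, whose derivative along the flow is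
`2 (f / f') Θ'` on the one hand, and a difference of smooth functions on the other hand. -/
theorem quotientSmooth_of_isGivenBy {f : PartialEquiv ℝ ℝ} (hf : IsProfile f)
    {φ : PartialEquiv (Eucl n) (Eucl n)} (hG : IsGivenBy f φ) (hφ : IsSmoothCompactification φ) :
    QuotientSmooth f := by
  obtain ⟨χ, h⟩ := hG.exists_chartFor
  set c : ℝ → Eucl n := fun w => χ.symm (vertical n w) with hc
  set T : ℝ → Eucl n → Eucl n := fun s => conjAct φ (dil n s) with hTdef
  have hT : SmoothAction T (cball n) := smoothAction_dil hφ
  have hcm : ∀ w, 0 ≤ w → c w ∈ cball n := fun w hw => (h.symm_mem (by rwa [vertical_top])).1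
  have hcs : ContDiffOn ℝ ∞ c (Ici 0) := h.contDiffOn_axis
  have hTc : ∀ s w, 0 ≤ w → T s (c w) = c (scaleFlow f (2 * s, w)) := fun s w hw =>
    h.conjAct_dil_vertical hf hφ.isHomeo s hw
  let V : Eucl n → ℝ := fun v => ∫ s in Icc (0 : ℝ) 1, (1 : ℝ) • defect (T s v)
  have hV : ContDiffOn ℝ ∞ V (cball n) :=
    hT.contDiffOn_average (isCompact_closedBall _ _) (convex_closedBall _ _)
      nonempty_interior_cball isCompact_Icc continuous_const contDiff_defect.contDiffOn
  have hΘ : ContDiffOn ℝ ∞ (V ∘ c) (Ici 0) := hV.comp hcs fun w hw => hcm w hw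
  have hsph0 : ‖c 0‖ = 1 := h.norm_symm_vertical_zero hf hφ (vertical_top 0)
  have hsph : ∀ a v, ‖v‖ = 1 → ‖T a v‖ = 1 := fun a v hv => hφ.norm_conjAct_eq_one (dil_mem a) hv
  have hd0 : ∀ s, defect (T s (c 0)) = 0 := fun s => by
    rw [defect, hsph s _ hsph0]; norm_num
  obtain ⟨k, hk, hkT⟩ := hT.exists_mul_defect_le hsph (fun v hv =>
    conjAct_eq_self hφ.isHomeo (fun v hv => proj_dil_zero hv) (mem_cball.1 hv))
    (isCompact_Icc (a := (0 : ℝ)) (b := 1))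
  have hcontT : ∀ v ∈ cball n, v ∈ oball n → Continuous fun s => defect (T s v) := by
    intro v _ hv
    have h1 := hT.joint.continuousOn
    rw [interior_cball] at h1
    refine contDiff_defect.continuous.comp ?_
    rw [← continuousOn_univ]
    exact h1.comp (f := fun s => (s, v)) (by fun_prop) fun s _ => ⟨mem_univ _, hv⟩
  have hcb : ∀ w, 0 < w → c w ∈ oball n := by
    intro w hw
    rw [mem_oball]
    refine lt_of_le_of_ne (mem_cball.1 (hcm w hw.le)) fun h1 => ?_
    have hz : (0 : ℝ) ≤ vertical n w ⊤ := by rw [vertical_top]; exact hw.le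
    have h2 := h.top_eq_zero hf hφ h1 (h.symm_mem hz).2
    rw [h.right_inv hz, vertical_top] at h2
    exact hw.ne' h2
  have hVlow : ∀ w, 0 < w → k * defect (c w) ≤ V (c w) := by
    intro w hw
    have h1 : ∫ _s in Icc (0 : ℝ) 1, k * defect (c w) ≤ V (c w) := by
      refine setIntegral_mono_on
        (continuousOn_const.integrableOn_compact isCompact_Icc) ?_ measurableSet_Icc fun s hs => ?_
      · simp only [one_smul]
        exact (hcontT _ (hcm w hw.le) (hcb w hw)).continuousOn.integrableOn_compact isCompact_Icc
      · rw [one_smul]; exact hkT s hs _ (hcm w hw.le)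
    simpa using h1
  have hV0 : V (c 0) = 0 := by simp [V, hd0]
  have hderiv0 : 0 < derivWithin (V ∘ c) (Ici 0) 0 := by
    obtain ⟨K, hK, hKw⟩ := h.exists_le_defect hf hφ
    have h1 : HasDerivWithinAt (V ∘ c) (derivWithin (V ∘ c) (Ici 0) 0) (Ici 0) 0 :=
      (hΘ.differentiableOn (by simp) 0 self_mem_Ici).hasDerivWithinAt
    have h2 := (hasDerivWithinAt_iff_tendsto_slope' (by simp)).1 h1.Ioi_of_Ici
    refine lt_of_lt_of_le (div_pos hk hK) (ge_of_tendsto h2 ?_)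
    filter_upwards [nhdsWithin_mono 0 Ioi_subset_Ici_self hKw, self_mem_nhdsWithin] with w h3 hw
    have hw' : 0 < w := hw
    rw [slope_def_field, sub_zero, Function.comp_apply, Function.comp_apply, hV0, sub_zero,
      div_le_div_iff₀ hK hw']
    have := hVlow w hw'
    calc k * w ≤ k * (K * defect (c w)) := mul_le_mul_of_nonneg_left h3 hk.le
      _ = k * defect (c w) * K := by ring
      _ ≤ V (c w) * K := mul_le_mul_of_nonneg_right this hK.le
  have hflow : ∀ w, 0 < w → 2 * (f w / deriv f w) * derivWithin (V ∘ c) (Ici 0) w =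
      defect (T 1 (c w)) - defect (c w) := by
    intro w hw
    have hκ := hcontT _ (hcm w hw.le) (hcb w hw)
    have hVc : HasDerivAt (V ∘ c) (derivWithin (V ∘ c) (Ici 0) w) w :=
      (hΘ.differentiableOn (by simp) w hw.le).hasDerivWithinAt.hasDerivAt (Ici_mem_nhds hw)
    have hg : HasDerivAt (fun σ : ℝ => scaleFlow f (2 * σ, w)) (2 * (f w / deriv f w)) 0 := by
      have h1 := hf.hasDerivAt_scaleFlow (2 * 0) hw
      rw [mul_zero, hf.scaleFlow_zero hw.le] at h1
      have h2 : HasDerivAt (fun σ : ℝ => 2 * σ) 2 0 := by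
        simpa using (hasDerivAt_id (0 : ℝ)).const_mul 2
      have h3 := HasDerivAt.comp (h₂ := fun s => scaleFlow f (s, w)) (0 : ℝ)
        (by simpa using h1) h2
      rw [mul_comm] at h3
      exact h3
    have h4 : HasDerivAt (fun σ : ℝ => (V ∘ c) (scaleFlow f (2 * σ, w)))
        (derivWithin (V ∘ c) (Ici 0) w * (2 * (f w / deriv f w))) 0 :=
      HasDerivAt.comp (h₂ := V ∘ c) (0 : ℝ)
        (by simpa [hf.scaleFlow_zero hw.le] using hVc) hg
    have h5 : ∀ σ : ℝ, (V ∘ c) (scaleFlow f (2 * σ, w)) =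
        (∫ s in (0 : ℝ)..(σ + 1), defect (T s (c w))) - ∫ s in (0 : ℝ)..σ, defect (T s (c w)) := by
      intro σ
      rw [intervalIntegral.integral_interval_sub_left (hκ.intervalIntegrable _ _)
        (hκ.intervalIntegrable _ _), Function.comp_apply, ← hTc σ w hw.le]
      have h6 : ∀ s, defect (T s (T σ (c w))) = defect (T (s + σ) (c w)) := fun s => by
        rw [hT.add s σ _ (hcm w hw.le)]
      simp only [V, one_smul, h6]
      rw [integral_Icc_eq_integral_Ioc, ← intervalIntegral.integral_of_le zero_le_one,
        intervalIntegral.integral_comp_add_right (fun s => defect (T s (c w))), zero_add, add_comm]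
    have h7 : HasDerivAt (fun σ : ℝ => (∫ s in (0 : ℝ)..(σ + 1), defect (T s (c w))) -
        ∫ s in (0 : ℝ)..σ, defect (T s (c w))) (defect (T 1 (c w)) - defect (T 0 (c w))) 0 := by
      have e1 : HasDerivAt (fun u : ℝ => ∫ s in (0 : ℝ)..u, defect (T s (c w)))
          (defect (T (0 + 1) (c w))) (0 + 1) := hκ.integral_hasStrictDerivAt 0 (0 + 1) |>.hasDerivAt
      have e2 := (hκ.integral_hasStrictDerivAt 0 0).hasDerivAt
      have e3 := e1.comp_add_const 0 1
      rw [zero_add] at e3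
      exact e3.sub e2
    have h8 := h4.unique (h7.congr_of_eventuallyEq (Eventually.of_forall h5))
    have h9 : T 0 (c w) = c w := conjAct_eq_self hφ.isHomeo (fun v hv => proj_dil_zero hv)
      (mem_cball.1 (hcm w hw.le))
    rw [h9] at h8
    rw [← h8]; ring
  have hΘ' : ContDiffOn ℝ ∞ (derivWithin (V ∘ c) (Ici 0)) (Ici 0) :=
    hΘ.derivWithin (uniqueDiffOn_Ici 0) (by simp)
  refine ⟨fun y => f y / deriv f y, fun y hy => ?_, fun y _ => rfl⟩
  rcases eq_or_lt_of_le (show (0 : ℝ) ≤ y from hy) with rfl | hy'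
  · have hnum : ContDiffOn ℝ ∞ (fun w => defect (T 1 (c w)) - defect (c w)) (Ici 0) :=
      (contDiff_defect.comp_contDiffOn ((hT.contDiffOn 1).comp hcs fun w hw => hcm w hw)).sub
        (contDiff_defect.comp_contDiffOn hcs)
    have hden : ContDiffOn ℝ ∞ (fun w => 2 * derivWithin (V ∘ c) (Ici 0) w) (Ici 0) :=
      contDiffOn_const.mul hΘ'
    have hq := (hnum 0 self_mem_Ici).div (hden 0 self_mem_Ici) (by positivity)
    have hev : ∀ᶠ w in 𝓝[≥] (0 : ℝ), 0 < derivWithin (V ∘ c) (Ici 0) w :=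
      (hΘ'.continuousOn 0 self_mem_Ici).eventually_const_lt hderiv0
    have hzero : f 0 / deriv f 0 = (defect (T 1 (c 0)) - defect (c 0)) /
        (2 * derivWithin (V ∘ c) (Ici 0) 0) := by
      rw [hf.apply_zero, hd0, defect, hsph0]; norm_num
    refine hq.congr_of_eventuallyEq ?_ hzero
    filter_upwards [hev, self_mem_nhdsWithin] with w hw hw0
    rcases eq_or_lt_of_le (show (0 : ℝ) ≤ w from hw0) with rfl | hw0'
    · exact hzero
    · change f w / deriv f w =
        (defect (T 1 (c w)) - defect (c w)) / (2 * derivWithin (V ∘ c) (Ici 0) w)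
      rw [← hflow w hw0', eq_div_iff (by positivity)]
      ring
  · have hd : ContDiffAt ℝ ∞ (deriv f) y :=
      ((hf.contDiffOn.mono Ioi_subset_Ici_self).deriv_of_isOpen isOpen_Ioi
        (by simp)).contDiffAt (Ioi_mem_nhds hy')
    exact ((hf.contDiffAt hy').div hd (hf.deriv_ne_zero hy')).contDiffWithinAt

end Necessity

/-! ### Non-flat profiles -/

section NonFlat

lemma iteratedDerivWithin_id_mul {h : ℝ → ℝ} (hh : ContDiffOn ℝ ∞ h (Ici 0)) (j : ℕ) :
    ∀ y ∈ Ici (0 : ℝ), iteratedDerivWithin (j + 1) (fun y => y * h y) (Ici 0) y =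
      y * iteratedDerivWithin (j + 1) h (Ici 0) y + (j + 1) * iteratedDerivWithin j h (Ici 0) y := by
  have hu := uniqueDiffOn_Ici (0 : ℝ)
  have hd : ∀ j : ℕ, ∀ y ∈ Ici (0 : ℝ), HasDerivWithinAt (iteratedDerivWithin j h (Ici 0))
      (iteratedDerivWithin (j + 1) h (Ici 0) y) (Ici 0) y := fun j y hy => by
    rw [iteratedDerivWithin_succ]
    exact (hh.differentiableOn_iteratedDerivWithin
      (by exact_mod_cast ENat.natCast_lt_top j) hu y hy).hasDerivWithinAt
  induction j with
  | zero =>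
    intro y hy
    have h1 := (hasDerivWithinAt_id y (Ici 0)).mul (hd 0 y hy)
    simp only [iteratedDerivWithin_zero] at h1
    rw [zero_add, iteratedDerivWithin_one, iteratedDerivWithin_zero]
    refine (h1.derivWithin (hu y hy)).trans ?_
    simp; ring
  | succ j ih =>
    intro y hy
    rw [iteratedDerivWithin_succ, derivWithin_congr ih (ih y hy)]
    have h1 := ((hasDerivWithinAt_id y (Ici 0)).mul (hd (j + 1) y hy)).add
      ((hd j y hy).const_mul ((j : ℝ) + 1))
    refine (h1.derivWithin (hu y hy)).trans ?_
    push_cast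
    simp; ring

/-- A smooth function on the half-line with a non-zero derivative at `0` is a power of the
variable times a smooth function that does not vanish at `0`. -/
lemma exists_eq_pow_mul (k : ℕ) : ∀ F : ℝ → ℝ, ContDiffOn ℝ ∞ F (Ici 0) →
    iteratedDerivWithin k F (Ici 0) 0 ≠ 0 →
    ∃ (m : ℕ) (h : ℝ → ℝ), ContDiffOn ℝ ∞ h (Ici 0) ∧ h 0 ≠ 0 ∧ ∀ y ∈ Ici 0, F y = y ^ m * h y := by
  induction k with
  | zero => exact fun F hF h0 => ⟨0, F, hF, by simpa using h0, fun y _ => by simp⟩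
  | succ k ih =>
    intro F hF hk
    by_cases h0 : F 0 = 0
    · obtain ⟨h₁, hh₁, heq, -⟩ := exists_eq_mul_of_contDiffOn (convex_Ici 0) (uniqueDiffOn_Ici 0)
        self_mem_Ici hF h0
      have h2 : iteratedDerivWithin k h₁ (Ici 0) 0 ≠ 0 := by
        intro hz
        apply hk
        rw [iteratedDerivWithin_congr (g := fun y => y * h₁ y) heq self_mem_Ici,
          iteratedDerivWithin_id_mul hh₁ k 0 self_mem_Ici, hz]
        simp
      obtain ⟨m, h, hh, hh0, hm⟩ := ih h₁ hh₁ h2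
      refine ⟨m + 1, h, hh, hh0, fun y hy => ?_⟩
      rw [heq y hy, hm y hy, pow_succ]; ring
    · exact ⟨0, F, hF, h0, fun y _ => by simp⟩

/-- If `f = yᵐ h` with `h 0 ≠ 0`, then `f / f' = y h / (m h + y h')`. -/
theorem quotientSmooth_of_nonFlat {f : PartialEquiv ℝ ℝ} (hf : IsProfile f) (hn : NonFlat f) :
    QuotientSmooth f := by
  obtain ⟨k, -, hk⟩ := hn
  obtain ⟨m, h, hh, hh0, hm⟩ := exists_eq_pow_mul k f hf.contDiffOn hk
  have hm0 : m ≠ 0 := by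
    rintro rfl
    have := hm 0 self_mem_Ici
    rw [hf.apply_zero] at this
    simp [hh0.symm] at this
  obtain ⟨m, rfl⟩ := Nat.exists_eq_succ_of_ne_zero hm0
  have hh' : ContDiffOn ℝ ∞ (derivWithin h (Ici 0)) (Ici 0) :=
    hh.derivWithin (uniqueDiffOn_Ici 0) (by simp)
  set D : ℝ → ℝ := fun y => (m + 1) * h y + y * derivWithin h (Ici 0) y with hDdef
  have hD : ContDiffOn ℝ ∞ D (Ici 0) :=
    (contDiffOn_const.mul hh).add (contDiffOn_id.mul hh')
  have hderiv : ∀ y > 0, deriv f y = y ^ m * D y := by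
    intro y hy
    have h1 : HasDerivAt h (derivWithin h (Ici 0) y) y :=
      (hh.differentiableOn (by simp) y (le_of_lt hy)).hasDerivWithinAt.hasDerivAt (Ici_mem_nhds hy)
    have h2 := (hasDerivAt_pow (m + 1) y).mul h1
    have h3 : HasDerivAt f _ y := h2.congr_of_eventuallyEq (by
      filter_upwards [Ioi_mem_nhds hy] with z hz using hm z (show (0 : ℝ) < z from hz).le)
    rw [h3.deriv, hDdef]
    push_cast
    ring
  have hDne : ∀ y ∈ Ici (0 : ℝ), D y ≠ 0 := by
    intro y hy
    rcases eq_or_lt_of_le (show (0 : ℝ) ≤ y from hy) with rfl | hy'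
    · simp only [hDdef, zero_mul, add_zero]
      exact mul_ne_zero (by positivity) hh0
    · intro h0
      have := hf.deriv_ne_zero hy'
      rw [hderiv y hy', h0, mul_zero] at this
      exact this rfl
  refine ⟨fun y => y * h y / D y, (contDiffOn_id.mul hh).div hD hDne, fun y hy => ?_⟩
  have h1 := hDne y (le_of_lt hy)
  have h2 : y ^ m ≠ 0 := pow_ne_zero m hy.ne'
  rw [hderiv y hy, hm y (le_of_lt hy), div_eq_div_iff h1 (mul_ne_zero h2 h1)]
  simp only [Nat.succ_eq_add_one, pow_succ]
  ring

end NonFlat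

/-! ### A compactification with a given profile -/

section Sufficiency

variable {n : ℕ}

lemma defect_pos_iff {v : Eucl n} : 0 < defect v ↔ ‖v‖ < 1 := by
  rw [defect, sub_pos, sq_lt_one_iff₀ (norm_nonneg v)]

lemma defect_nonneg_iff {v : Eucl n} : 0 ≤ defect v ↔ ‖v‖ ≤ 1 := by
  rw [defect, sub_nonneg, sq_le_one_iff₀ (norm_nonneg v)]

/-- A radial homeomorphism `v ↦ a (|v|²) v` of the closed ball such that
`1 - |φ v|² = f (c (1 - |v|²))`. -/
structure IsRadial (f : PartialEquiv ℝ ℝ) (c : ℝ) (a : ℝ → ℝ)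
    (φ : PartialEquiv (Eucl n) (Eucl n)) : Prop where
  c_pos : 0 < c
  contDiffOn : ContDiffOn ℝ ∞ a (Iic 1)
  pos : ∀ t ≤ 1, 0 < a t
  isHomeo : IsHomeo φ (cball n) (cball n)
  apply : ∀ v, φ v = a (‖v‖ ^ 2) • v
  symm_apply : ∀ u, φ.symm u = (a (1 - f.symm (defect u) / c))⁻¹ • u
  defect_apply : ∀ v, ‖v‖ ≤ 1 → defect (φ v) = f (c * defect v)

/-- The factor is `a t = √(σ t / t)` with `σ t = 1 - f (c (1 - t))`; the choice of `c` with `f c = 1`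
makes `σ` vanish at `0`, so that the quotient is smooth. -/
lemma exists_isRadial (n : ℕ) {f : PartialEquiv ℝ ℝ} (hf : IsProfile f) :
    ∃ (c : ℝ) (a : ℝ → ℝ) (φ : PartialEquiv (Eucl n) (Eucl n)), IsRadial f c a φ := by
  set c := f.symm 1 with hc
  have hc0 : 0 < c := hf.symm_pos one_pos
  have hfc : f c = 1 := hf.right_inv zero_le_one
  set σ : ℝ → ℝ := fun t => 1 - f (c * (1 - t)) with hσ
  have hm : ∀ t ∈ Iic (1 : ℝ), 0 ≤ c * (1 - t) := fun t ht =>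
    mul_nonneg hc0.le (sub_nonneg.2 ht)
  have hσs : ContDiffOn ℝ ∞ σ (Iic 1) :=
    contDiffOn_const.sub (hf.contDiffOn.comp (by fun_prop) hm)
  obtain ⟨b, hb, hσb, hb0⟩ := exists_eq_mul_of_contDiffOn (convex_Iic 1)
    (uniqueDiffOn_Iic 1) (by simp) hσs (by simp [hσ, hfc])
  have hbpos : ∀ t ≤ 1, 0 < b t := by
    intro t ht
    have h1 := hσb t ht
    rcases lt_trichotomy t 0 with h | rfl | h
    · have : f c < f (c * (1 - t)) := hf.strictMonoOn hc0.le (hm t ht) (by nlinarith)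
      have h2 : t * b t < 0 := by rw [← h1]; simp only [hσ]; linarith
      by_contra h3
      exact absurd (mul_nonneg_of_nonpos_of_nonpos h.le (not_lt.1 h3)) (not_le.2 h2)
    · rw [hb0]
      have h2 : HasDerivAt σ (c * deriv f c) 0 := by
        have h3 : HasDerivAt (fun t : ℝ => c * (1 - t)) (c * (0 - 1)) 0 :=
          ((hasDerivAt_const (0 : ℝ) (1 : ℝ)).sub (hasDerivAt_id 0)).const_mul c
        have h5 : HasDerivAt f (deriv f c) (c * (1 - 0)) := by
          simpa only [sub_zero, mul_one] using hf.hasDerivAt hc0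
        have h4 := (h5.comp (0 : ℝ) h3).const_sub 1
        refine h4.congr_deriv ?_
        ring
      rw [(h2.hasDerivWithinAt).derivWithin (uniqueDiffOn_Iic 1 0 (by simp))]
      exact mul_pos hc0 (hf.deriv_pos hc0)
    · have : f (c * (1 - t)) < f c := hf.strictMonoOn (hm t ht) hc0.le (by nlinarith)
      have h2 : 0 < t * b t := by rw [← h1]; simp only [hσ]; linarith
      exact (mul_pos_iff_of_pos_left h).1 h2
  set a : ℝ → ℝ := fun t => Real.sqrt (b t) with ha
  have has : ContDiffOn ℝ ∞ a (Iic 1) := hb.sqrt fun t ht => (hbpos t ht).ne'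
  have hapos : ∀ t ≤ 1, 0 < a t := fun t ht => Real.sqrt_pos.2 (hbpos t ht)
  have hasq : ∀ t ≤ 1, a t ^ 2 = b t := fun t ht => Real.sq_sqrt (hbpos t ht).le
  have hsq : ∀ v : Eucl n, ‖v‖ ≤ 1 → ‖v‖ ^ 2 ≤ 1 := fun v hv =>
    pow_le_one₀ (norm_nonneg v) hv
  have hτ : ∀ u : Eucl n, ‖u‖ ≤ 1 → 1 - f.symm (defect u) / c ≤ 1 := fun u hu => by
    have := div_nonneg (hf.mapsTo_symm (defect_nonneg hu)) hc0.le
    linarith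
  have hdef : ∀ v : Eucl n, ‖v‖ ≤ 1 → defect (a (‖v‖ ^ 2) • v) = f (c * defect v) := by
    intro v hv
    have h1 := hσb (‖v‖ ^ 2) (hsq v hv)
    rw [defect, norm_smul, mul_pow, Real.norm_eq_abs, sq_abs, hasq _ (hsq v hv), mul_comm, ← h1]
    simp [hσ, defect]
  have hnorm : ∀ u : Eucl n, ‖u‖ ≤ 1 → ‖(a (1 - f.symm (defect u) / c))⁻¹ • u‖ ^ 2 =
      1 - f.symm (defect u) / c := by
    intro u hu
    have h1 := hσb _ (hτ u hu)
    have h2 : σ (1 - f.symm (defect u) / c) = ‖u‖ ^ 2 := by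
      simp only [hσ]
      rw [sub_sub_cancel, mul_div_cancel₀ _ hc0.ne', hf.right_inv (defect_nonneg hu), defect]
      ring
    rw [norm_smul, mul_pow, norm_inv, Real.norm_eq_abs, inv_pow, sq_abs, hasq _ (hτ u hu), ← h2, h1]
    rw [mul_comm, mul_assoc, mul_inv_cancel₀ (hbpos _ (hτ u hu)).ne', mul_one]
  let φ : PartialEquiv (Eucl n) (Eucl n) :=
    { toFun := fun v => a (‖v‖ ^ 2) • v
      invFun := fun u => (a (1 - f.symm (defect u) / c))⁻¹ • u
      source := cball n
      target := cball n
      map_source' := fun v hv => by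
        have hv' := mem_cball.1 hv
        rw [mem_cball, ← defect_nonneg_iff, hdef v hv']
        exact hf.mapsTo (mul_nonneg hc0.le (defect_nonneg hv'))
      map_target' := fun u hu => by
        have hu' := mem_cball.1 hu
        rw [mem_cball, ← sq_le_one_iff₀ (norm_nonneg _), hnorm u hu']
        exact hτ u hu'
      left_inv' := fun v hv => by
        have hv' := mem_cball.1 hv
        have h1 : f.symm (defect (a (‖v‖ ^ 2) • v)) = c * defect v := by
          rw [hdef v hv', hf.left_inv (mul_nonneg hc0.le (defect_nonneg hv'))]
        change (a (1 - f.symm (defect (a (‖v‖ ^ 2) • v)) / c))⁻¹ • (a (‖v‖ ^ 2) • v) = v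
        rw [h1, mul_div_cancel_left₀ _ hc0.ne', defect, sub_sub_cancel, smul_smul,
          inv_mul_cancel₀ (hapos _ (hsq v hv')).ne', one_smul]
      right_inv' := fun u hu => by
        have hu' := mem_cball.1 hu
        simp only [hnorm u hu']
        rw [smul_smul, mul_inv_cancel₀ (hapos _ (hτ u hu')).ne', one_smul] }
  refine ⟨c, a, φ, hc0, has, hapos, ⟨rfl, rfl, ?_, ?_⟩, fun v => rfl, fun u => rfl, hdef⟩
  · exact (has.continuousOn.comp (by fun_prop) fun v hv => hsq v (mem_cball.1 hv)).smul
      continuousOn_id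
  · have h1 : ContinuousOn (fun u : Eucl n => 1 - f.symm (defect u) / c) (cball n) :=
      continuousOn_const.sub ((hf.isHomeo.continuousOn_symm.comp
        contDiff_defect.continuous.continuousOn
        fun u hu => defect_nonneg (mem_cball.1 hu)).div_const c)
    exact ((has.continuousOn.comp h1 fun u hu => hτ u (mem_cball.1 hu)).inv₀
      fun u hu => (hapos _ (hτ u (mem_cball.1 hu))).ne').smul continuousOn_id

namespace IsRadial

variable {f : PartialEquiv ℝ ℝ} {c : ℝ} {a : ℝ → ℝ} {φ : PartialEquiv (Eucl n) (Eucl n)}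

lemma contDiffOn_apply (h : IsRadial f c a φ) : ContDiffOn ℝ ∞ φ (cball n) := by
  have h1 : ContDiffOn ℝ ∞ (fun v : Eucl n => a (‖v‖ ^ 2) • v) (cball n) :=
    (h.contDiffOn.comp (contDiff_norm_sq ℝ).contDiffOn fun v hv =>
      pow_le_one₀ (norm_nonneg v) (mem_cball.1 hv)).smul contDiffOn_id
  exact h1.congr fun v _ => h.apply v

lemma norm_lt_iff (h : IsRadial f c a φ) (hf : IsProfile f) {v : Eucl n} (hv : ‖v‖ ≤ 1) :
    ‖φ v‖ < 1 ↔ ‖v‖ < 1 := by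
  rw [← defect_pos_iff, h.defect_apply v hv, ← defect_pos_iff]
  refine ⟨fun h1 => lt_of_le_of_ne (defect_nonneg hv) fun h0 => ?_,
    fun h1 => hf.pos (mul_pos h.c_pos h1)⟩
  rw [← h0, mul_zero, hf.apply_zero] at h1
  exact lt_irrefl _ h1

/-- The inverse of a radial map is smooth along smooth maps `w` into the closed ball for which
`1 - |w|²` is the value of `f` at a smooth function. -/
lemma contDiffOn_symm_comp (h : IsRadial f c a φ) {E : Type*} [NormedAddCommGroup E]
    [NormedSpace ℝ E] {S : Set E} {w : E → Eucl n} (hw : ContDiffOn ℝ ∞ w S) {r : E → ℝ}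
    (hr : ContDiffOn ℝ ∞ r S) (hr0 : ∀ x ∈ S, 0 ≤ r x)
    (hwr : ∀ x ∈ S, f.symm (defect (w x)) = r x) :
    ContDiffOn ℝ ∞ (fun x => φ.symm (w x)) S := by
  have hle : ∀ x ∈ S, 1 - r x / c ≤ 1 := fun x hx => by
    have := div_nonneg (hr0 x hx) h.c_pos.le
    linarith
  have h1 : ContDiffOn ℝ ∞ (fun x => (a (1 - r x / c))⁻¹ • w x) S :=
    ((h.contDiffOn.comp (contDiffOn_const.sub (hr.div_const c)) hle).inv
      fun x hx => (h.pos _ (hle x hx)).ne').smul hw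
  exact h1.congr fun x hx => by rw [h.symm_apply, hwr x hx]

lemma contDiffOn_scaleFlow_comp {E : Type*} [NormedAddCommGroup E]
    [NormedSpace ℝ E] {S : Set E} (hf : IsProfile f) (hq : QuotientSmooth f) {s r : E → ℝ}
    (hs : ContDiffOn ℝ ∞ s S) (hs0 : ∀ x ∈ S, s x ≠ 0)
    (hr : ContDiffOn ℝ ∞ r S) (hr0 : ∀ x ∈ S, 0 ≤ r x) :
    ContDiffOn ℝ ∞ (fun x => scaleFlow f (2 * Real.log (s x), r x)) S :=
  (hf.contDiffOn_scaleFlow hq).comp ((contDiffOn_const.mul (hs.log hs0)).prodMk hr)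
    fun x hx => ⟨mem_univ _, hr0 x hx⟩

lemma scaleFlow_two_log {s r : ℝ} (hs : 0 < s) :
    scaleFlow f (2 * Real.log s, r) = f.symm (s ^ 2 * f r) := by
  rw [scaleFlow, two_mul, Real.exp_add, Real.exp_log hs, pow_two]

/-- With a smooth generator `f / f'`, a radial compactification is smooth: for `w = proj_A (φ v)`
one has `1 - |w|² = f (c (1 - |v|²)) / t²` with a smooth positive `t`, so that
`f⁻¹ (1 - |w|²)` is given by the scaling flow. -/
lemma isSmoothCompactification (h : IsRadial f c a φ) (hf : IsProfile f)
    (hq : QuotientSmooth f) : IsSmoothCompactification φ where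
  isHomeo := h.isHomeo
  image_oball := by
    ext u
    constructor
    · rintro ⟨v, hv, rfl⟩
      have hv' := mem_oball.1 hv
      exact mem_oball.2 ((h.norm_lt_iff hf hv'.le).2 hv')
    · intro hu
      have hu' := mem_oball.1 hu
      refine ⟨φ.symm u, mem_oball.2 ?_, h.isHomeo.right_inv hu'.le⟩
      rw [← h.norm_lt_iff hf (h.isHomeo.norm_symm_le hu'.le), h.isHomeo.right_inv hu'.le]
      exact hu'
  contDiffOn := h.contDiffOn_apply.mono Metric.ball_subset_closedBall
  contDiffOn_symm := by
    refine h.contDiffOn_symm_comp (w := id) contDiffOn_id (r := fun u => f.symm (defect u)) ?_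
      (fun u hu => hf.mapsTo_symm (defect_nonneg (mem_oball.1 hu).le)) fun u _ => rfl
    exact hf.contDiffOn_symm.comp contDiff_defect.contDiffOn fun u hu =>
      defect_pos_iff.2 (mem_oball.1 hu)
  extends_smoothly := by
    intro A hA
    have hle : ∀ v ∈ cball n, ‖φ v‖ ≤ 1 := fun v hv => h.isHomeo.norm_le (mem_cball.1 hv)
    have hpos : ∀ v ∈ cball n, 0 < height A (φ v) := fun v hv => height_pos hA (hle v hv)
    refine ⟨conjAct φ A, ?_, fun v _ => rfl⟩
    have hh : ContDiffOn ℝ ∞ (fun v => height A (φ v)) (cball n) :=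
      ((contDiff_mulVec_lift A (Sum.inr 0)).of_le (by simp)).comp_contDiffOn h.contDiffOn_apply
    have hr0 : ∀ v ∈ cball n, 0 ≤ c * defect v := fun v hv =>
      mul_nonneg h.c_pos.le (defect_nonneg (mem_cball.1 hv))
    refine h.contDiffOn_symm_comp (w := fun v => proj A (φ v)) ?_
      (r := fun v => scaleFlow f (2 * Real.log (height A (φ v))⁻¹, c * defect v)) ?_ ?_ ?_
    · intro v hv
      exact ((contDiffAt_proj (hpos v hv).ne').of_le (by simp)).comp_contDiffWithinAt v
        (h.contDiffOn_apply v hv)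
    · exact contDiffOn_scaleFlow_comp hf hq (hh.inv fun v hv => (hpos v hv).ne')
        (fun v hv => inv_ne_zero (hpos v hv).ne') (contDiffOn_const.mul contDiff_defect.contDiffOn)
        hr0
    · exact fun v hv => hf.scaleFlow_nonneg _ (hr0 v hv)
    · intro v hv
      rw [scaleFlow_two_log (inv_pos.2 (hpos v hv)), ← h.defect_apply v (mem_cball.1 hv), defect,
        one_sub_norm_sq_proj hA (hle v hv), defect, inv_pow, div_eq_inv_mul]

variable [NeZero n]

/-- The half-space chart is `φ_f⁻¹` composed with the Klein chart of `φ`: as for the smoothness of the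
action, its last coordinate is given by the scaling flow. -/
lemma isGivenBy (h : IsRadial f c a φ) (hf : IsProfile f) (hq : QuotientSmooth f) :
    IsGivenBy f φ := by
  have hpole : φ (pole n) = pole n := by
    have h1 : ‖φ (pole n)‖ = a 1 := by
      rw [h.apply, norm_smul, norm_pole]
      simp [abs_of_pos (h.pos 1 le_rfl)]
    have h2 : defect (φ (pole n)) = 0 := by
      rw [h.defect_apply _ norm_pole.le, defect, norm_pole]
      simp [hf.apply_zero]
    have h3 : a 1 = 1 := by
      rw [defect, h1] at h2
      have := h.pos 1 le_rfl
      nlinarith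
    rw [h.apply, norm_pole, one_pow, h3, one_smul]
  have hne : ∀ v, ‖v‖ ≤ 1 → v ≠ pole n → φ v ≠ pole n := fun v hv hp he =>
    hp (h.isHomeo.inj hv norm_pole.le (he.trans hpole.symm))
  have hsymmpole : φ.symm (pole n) = pole n := by
    conv_lhs => rw [← hpole]
    exact h.isHomeo.left_inv norm_pole.le
  have hft : ∀ z ∈ halfSpace n, 0 ≤ vertMap f z ⊤ := fun z hz => by
    rw [vertMap_top]; exact hf.mapsTo hz
  let χ : PartialEquiv (Eucl n) (Eucl n) :=
    { toFun := fun v => vertMap f.symm (kleinChart (φ v))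
      invFun := fun z => φ.symm (kleinInv (vertMap f z))
      source := cball n \ {pole n}
      target := halfSpace n
      map_source' := fun v hv => by
        rw [halfSpace, mem_ofPred_eq, vertMap_top]
        exact hf.mapsTo_symm (kleinChart_top_nonneg (h.isHomeo.norm_le (mem_cball.1 hv.1)))
      map_target' := fun z hz => by
        have h1 := kleinInv_mem (hft z hz)
        refine ⟨mem_cball.2 (h.isHomeo.norm_symm_le h1), fun h2 => ?_⟩
        have h3 := congrArg φ (mem_singleton_iff.1 h2)
        rw [h.isHomeo.right_inv h1, hpole] at h3
        exact kleinInv_ne_pole (hft z hz) h3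
      left_inv' := fun v hv => by
        have h1 := h.isHomeo.norm_le (mem_cball.1 hv.1)
        rw [vertMap_vertMap (hf.right_inv (kleinChart_top_nonneg h1)),
          kleinInv_kleinChart h1 (hne v (mem_cball.1 hv.1) hv.2),
          h.isHomeo.left_inv (mem_cball.1 hv.1)]
      right_inv' := fun z hz => by
        rw [h.isHomeo.right_inv (kleinInv_mem (hft z hz)), kleinChart_kleinInv (hft z hz),
          vertMap_vertMap (hf.left_inv hz)] }
  refine ⟨h.isHomeo, pole n, χ, ⟨norm_pole, rfl, rfl, ?_, ?_⟩, hpole, fun v hv => ?_⟩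
  · have hlt : ∀ v ∈ cball n \ {pole n}, φ v ⊤ < 1 := fun v hv =>
      top_lt_one (h.isHomeo.norm_le (mem_cball.1 hv.1)) (hne v (mem_cball.1 hv.1) hv.2)
    have hφs : ContDiffOn ℝ ∞ φ (cball n \ {pole n}) := h.contDiffOn_apply.mono sdiff_subset
    have hK : ContDiffOn ℝ ∞ (fun v => kleinChart (φ v)) (cball n \ {pole n}) := fun v hv =>
      ((contDiffAt_kleinChart (hlt v hv)).of_le (by simp)).comp_contDiffWithinAt v (hφs v hv)
    rw [contDiffOn_euclidean]
    intro i
    by_cases hi : i = ⊤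
    · subst hi
      have h1 : ContDiffOn ℝ ∞ (fun v => (1 - φ v ⊤)⁻¹) (cball n \ {pole n}) :=
        (contDiffOn_const.sub ((contDiffOn_euclidean.1 hφs) ⊤)).inv
          fun v hv => by linarith [hlt v hv]
      have h2 : ContDiffOn ℝ ∞ (fun v => scaleFlow f (2 * Real.log (1 - φ v ⊤)⁻¹, c * defect v))
          (cball n \ {pole n}) :=
        contDiffOn_scaleFlow_comp hf hq h1
          (fun v hv => inv_ne_zero (by linarith [hlt v hv]))
          (contDiffOn_const.mul contDiff_defect.contDiffOn) fun v hv =>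
            mul_nonneg h.c_pos.le (defect_nonneg (mem_cball.1 hv.1))
      refine h2.congr fun v hv => ?_
      rw [scaleFlow_two_log (inv_pos.2 (by linarith [hlt v hv])),
        ← h.defect_apply v (mem_cball.1 hv.1), inv_pow, ← div_eq_inv_mul]
      change vertMap f.symm (kleinChart (φ v)) ⊤ = _
      rw [vertMap_top, kleinChart_top, defect]
    · refine ((contDiffOn_euclidean.1 hK) i).congr fun v _ => ?_
      exact vertMap_apply _ _ hi
  · have hvs : ContDiffOn ℝ ∞ (vertMap f) (halfSpace n) := by
      rw [contDiffOn_euclidean]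
      intro i
      by_cases hi : i = ⊤
      · subst hi
        simp only [vertMap_top]
        exact hf.contDiffOn.comp (s := halfSpace n) (f := fun z : Eucl n => z ⊤) (by fun_prop)
          fun z hz => hz
      · simp only [vertMap_apply _ _ hi]
        fun_prop
    refine h.contDiffOn_symm_comp (w := fun z => kleinInv (vertMap f z)) ?_
      (r := fun z => scaleFlow f (2 * Real.log (depth (vertMap f z)), z ⊤)) ?_ ?_ ?_
    · intro z hz
      exact ((contDiffAt_kleinInv (hft z hz)).of_le (by simp)).comp_contDiffWithinAt z (hvs z hz)
    · refine contDiffOn_scaleFlow_comp hf hq (fun z hz => ?_)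
        (fun z hz => (depth_pos (hft z hz)).ne') (by fun_prop) fun z hz => hz
      exact ((contDiffAt_depth (hft z hz)).of_le (by simp)).comp_contDiffWithinAt z (hvs z hz)
    · exact fun z hz => hf.scaleFlow_nonneg _ hz
    · intro z hz
      rw [scaleFlow_two_log (depth_pos (hft z hz)), defect, norm_kleinInv (hft z hz), vertMap_top, mul_comm]
  · exact (vertMap_vertMap (hf.right_inv
      (kleinChart_top_nonneg (h.isHomeo.norm_le (mem_cball.1 hv.1))))).symm

end IsRadial

end Sufficiency

/-! ### Conjugacy of profiles -/

namespace IsHalfLineDiffeo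

variable {κ : PartialEquiv ℝ ℝ}

lemma symm (h : IsHalfLineDiffeo κ) : IsHalfLineDiffeo κ.symm :=
  ⟨h.target_eq, h.source_eq, h.contDiffOn_symm, h.contDiffOn⟩

lemma nonneg (h : IsHalfLineDiffeo κ) {y : ℝ} (hy : 0 ≤ y) : 0 ≤ κ y := by
  have := κ.map_source (x := y) (by rw [h.source_eq]; exact hy)
  rwa [h.target_eq] at this

lemma left_inv (h : IsHalfLineDiffeo κ) {y : ℝ} (hy : 0 ≤ y) : κ.symm (κ y) = y :=
  κ.left_inv (by rw [h.source_eq]; exact hy)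

lemma right_inv (h : IsHalfLineDiffeo κ) {y : ℝ} (hy : 0 ≤ y) : κ (κ.symm y) = y :=
  κ.right_inv (by rw [h.target_eq]; exact hy)

lemma derivWithin_mul_derivWithin_symm (h : IsHalfLineDiffeo κ) {y : ℝ} (hy : 0 ≤ y) :
    derivWithin κ.symm (Ici 0) (κ y) * derivWithin κ (Ici 0) y = 1 := by
  have h1 := (h.contDiffOn.differentiableOn (by simp) y hy).hasDerivWithinAt
  have h2 := (h.contDiffOn_symm.differentiableOn (by simp) (κ y) (h.nonneg hy)).hasDerivWithinAt
  have h3 : HasDerivWithinAt (κ.symm ∘ κ)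
      (derivWithin κ.symm (Ici 0) (κ y) * derivWithin κ (Ici 0) y) (Ici 0) y :=
    h2.comp y h1 fun x hx => h.nonneg hx
  have h4 : HasDerivWithinAt (κ.symm ∘ κ) 1 (Ici 0) y :=
    (hasDerivWithinAt_id y _).congr (fun x hx => h.left_inv hx) (h.left_inv hy)
  exact (uniqueDiffOn_Ici 0 y hy).eq_deriv _ h3 h4

lemma apply_zero (h : IsHalfLineDiffeo κ) : κ 0 = 0 := by
  by_contra hne
  have hpos : 0 < κ 0 := lt_of_le_of_ne (h.nonneg le_rfl) (Ne.symm hne)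
  -- otherwise the inverse has an interior minimum at `κ 0`
  have hmin : IsLocalMin κ.symm (κ 0) := by
    filter_upwards [Ioi_mem_nhds hpos] with y hy
    rw [h.left_inv le_rfl]
    exact h.symm.nonneg hy.le
  have h1 := h.derivWithin_mul_derivWithin_symm le_rfl
  rw [derivWithin_of_mem_nhds (Ici_mem_nhds hpos), hmin.deriv_eq_zero, zero_mul] at h1
  exact zero_ne_one h1

/-- A diffeomorphism of the half-line is multiplication by a smooth positive function. -/
lemma exists_eq_mul (h : IsHalfLineDiffeo κ) :
    ∃ m : ℝ → ℝ, ContDiffOn ℝ ∞ m (Ici 0) ∧ ∀ y, 0 ≤ y → 0 < m y ∧ κ y = y * m y := by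
  obtain ⟨m, hm, hκ, hm0⟩ := exists_eq_mul_of_contDiffOn (convex_Ici 0) (uniqueDiffOn_Ici 0)
    self_mem_Ici h.contDiffOn h.apply_zero
  have hpos : ∀ y, 0 < y → 0 < m y := by
    intro y hy
    have h1 : 0 < κ y := by
      refine lt_of_le_of_ne (h.nonneg hy.le) fun h0 => ?_
      have h2 := h.left_inv hy.le
      rw [← h0, ← h.apply_zero, h.left_inv le_rfl] at h2
      exact hy.ne h2
    rw [hκ y hy.le] at h1
    exact (mul_pos_iff_of_pos_left hy).1 h1
  have hne : m 0 ≠ 0 := fun h0 => by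
    have h1 := h.derivWithin_mul_derivWithin_symm le_rfl
    rw [← hm0, h0, mul_zero] at h1
    exact zero_ne_one h1
  have hnn : 0 ≤ m 0 := by
    have h1 : Tendsto m (𝓝[>] 0) (𝓝 (m 0)) :=
      (hm.continuousOn 0 self_mem_Ici).mono_left (nhdsWithin_mono _ Ioi_subset_Ici_self)
    refine ge_of_tendsto h1 ?_
    filter_upwards [self_mem_nhdsWithin] with y hy using (hpos y hy).le
  refine ⟨m, hm, fun y hy => ⟨?_, hκ y hy⟩⟩
  rcases eq_or_lt_of_le hy with rfl | hy'
  · exact lt_of_le_of_ne hnn (Ne.symm hne)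
  · exact hpos y hy'

end IsHalfLineDiffeo

namespace IsProfile

variable {f f₁ f₂ : PartialEquiv ℝ ℝ}

/-- A change of variable at the target of a profile with smooth generator `f / f'` is absorbed by
a change of variable at the source: `f⁻¹ ∘ κ ∘ f` moves each point along the scaling flow. -/
lemma contDiffOn_symm_comp_diffeo (hf : IsProfile f) (hq : QuotientSmooth f)
    {κ : PartialEquiv ℝ ℝ} (hκ : IsHalfLineDiffeo κ) :
    ContDiffOn ℝ ∞ (fun w => f.symm (κ (f w))) (Ici 0) := by
  obtain ⟨m, hm, hκm⟩ := hκ.exists_eq_mul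
  have h1 : ContDiffOn ℝ ∞ (fun w => m (f w)) (Ici 0) :=
    hm.comp hf.contDiffOn fun w hw => hf.mapsTo hw
  have h2 : ContDiffOn ℝ ∞ (fun w => scaleFlow f (Real.log (m (f w)), w)) (Ici 0) :=
    (hf.contDiffOn_scaleFlow hq).comp
      ((h1.log fun w hw => (hκm _ (hf.mapsTo hw)).1.ne').prodMk contDiffOn_id)
      fun w hw => ⟨mem_univ _, hw⟩
  refine h2.congr fun w hw => ?_
  obtain ⟨h3, h4⟩ := hκm _ (hf.mapsTo hw)
  rw [scaleFlow, Real.exp_log h3, h4, mul_comm]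

lemma sourceConjugate_iff (h₁ : IsProfile f₁) (h₂ : IsProfile f₂) :
    SourceConjugate f₁ f₂ ↔ ContDiffOn ℝ ∞ (fun w => f₂.symm (f₁ w)) (Ici 0) ∧
      ContDiffOn ℝ ∞ (fun w => f₁.symm (f₂ w)) (Ici 0) := by
  constructor
  · rintro ⟨h, hh, heq⟩
    have h3 : ∀ w, 0 ≤ w → f₂.symm (f₁ w) = h w := fun w hw => by
      rw [heq hw, Function.comp_apply, h₂.left_inv (hh.nonneg hw)]
    refine ⟨hh.contDiffOn.congr fun w hw => h3 w hw, hh.contDiffOn_symm.congr fun w hw => ?_⟩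
    have h4 := hh.symm.nonneg hw
    have h5 := heq h4
    rw [Function.comp_apply, hh.right_inv hw] at h5
    change f₁.symm (f₂ w) = _
    rw [← h5, h₁.left_inv h4]
  · rintro ⟨hs, hs'⟩
    refine ⟨{ toFun := fun w => f₂.symm (f₁ w), invFun := fun w => f₁.symm (f₂ w)
              source := Ici 0, target := Ici 0
              map_source' := fun w hw => h₂.mapsTo_symm (h₁.mapsTo hw)
              map_target' := fun w hw => h₁.mapsTo_symm (h₂.mapsTo hw)
              left_inv' := fun w hw => by rw [h₂.right_inv (h₁.mapsTo hw), h₁.left_inv hw]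
              right_inv' := fun w hw => by rw [h₁.right_inv (h₂.mapsTo hw), h₂.left_inv hw] },
      ⟨rfl, rfl, hs, hs'⟩, fun w hw => ?_⟩
    exact (h₂.right_inv (h₁.mapsTo hw)).symm

lemma smoothlyConjugate_iff (h₁ : IsProfile f₁) (h₂ : IsProfile f₂) (hq₁ : QuotientSmooth f₁)
    (hq₂ : QuotientSmooth f₂) : SmoothlyConjugate f₁ f₂ ↔ SourceConjugate f₁ f₂ := by
  constructor
  · rintro ⟨h, k, hh, hk, heq⟩
    rw [h₁.sourceConjugate_iff h₂]
    constructor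
    · refine ((h₂.contDiffOn_symm_comp_diffeo hq₂ hk.symm).comp hh.contDiffOn
        fun w hw => hh.nonneg hw).congr fun w hw => ?_
      have h3 := heq hw
      simp only [Function.comp_apply] at h3 ⊢
      rw [← h3, hk.left_inv (h₁.mapsTo hw)]
    · refine ((h₁.contDiffOn_symm_comp_diffeo hq₁ hk).comp hh.contDiffOn_symm
        fun w hw => hh.symm.nonneg hw).congr fun w hw => ?_
      have h3 := heq (hh.symm.nonneg hw)
      simp only [Function.comp_apply] at h3 ⊢
      rw [h3, hh.right_inv hw]
  · rintro ⟨h, hh, heq⟩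
    exact ⟨h, PartialEquiv.ofSet (Ici 0), hh, ⟨rfl, rfl, contDiffOn_id, contDiffOn_id⟩, heq⟩

end IsProfile

/-! ### Conjugacy of compactifications -/

section Conjugacy

variable {n : ℕ}

open IsSmoothCompactification

lemma sdiff_mem_nhdsWithin {p v : Eucl n} (hv : v ≠ p) : cball n \ {p} ∈ 𝓝[cball n] v :=
  inter_mem self_mem_nhdsWithin (mem_nhdsWithin_of_mem_nhds (isOpen_compl_singleton.mem_nhds hv))

lemma proj_eq_zero_of_flip (hn : 2 ≤ n) {v : Eucl n}
    (hv : ∀ i j : Fin n, i ≠ j → proj (flip i j) v = v) : v = 0 := by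
  have : Nontrivial (Fin n) := Fin.nontrivial_iff_two_le.2 hn
  ext i
  obtain ⟨j, hj⟩ := exists_ne i
  have h1 := congrArg (fun w : Eucl n => w i) (hv i j hj.symm)
  simp only [proj_flip, true_or, if_true] at h1
  change v i = 0
  linarith

lemma proj_flip_zero (i j : Fin n) : proj (flip i j) (0 : Eucl n) = 0 := by
  ext k
  rw [proj_flip]
  simp

variable [NeZero n]

/-- The group acts transitively on the open ball, through horizontal translations and
dilations. -/
lemma exists_proj_trans_dil_zero {u : Eucl n} (hu : ‖u‖ < 1) :
    ∃ (a : Horiz n) (s : ℝ), proj (trans a) (proj (dil n s) 0) = u := by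
  have hpos := kleinChart_top_pos hu
  refine ⟨fun i => kleinChart u i, Real.log (kleinChart u ⊤) / 2, ?_⟩
  set s := Real.log (kleinChart u ⊤) / 2 with hs
  have h0 : ‖(0 : Eucl n)‖ < 1 := by simp
  have h1 := proj_mem_oball (dil_mem (n := n) s) h0
  have h2 := proj_mem_oball (trans_mem (n := n) fun i => kleinChart u i) h1
  refine kleinChart_inj h2.le (ne_pole_of_norm_lt h2) hu.le (ne_pole_of_norm_lt hu) ?_
  rw [kleinChart_trans _ h1.le, if_neg (ne_pole_of_norm_lt h1)]
  ext i
  rw [PiLp.add_apply, kleinChart_dil s h0.le]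
  by_cases hi : i = ⊤
  · subst hi
    rw [if_pos rfl, horEmb_top, HypCompact.kleinChart_top 0, hs, mul_div_cancel₀ _ two_ne_zero,
      Real.exp_log hpos]
    simp
  · rw [if_neg hi, horEmb_apply _ hi, HypCompact.kleinChart_apply 0 hi]
    simp

/-- A map that intertwines two compactified actions is `φ₂⁻¹ ∘ φ₁`, because a continuous map of the
closed ball that commutes with the projective action fixes the centre, hence is the identity. -/
lemma areConjugate_iff (hn : 2 ≤ n) {k : WithTop ℕ∞} {φ₁ φ₂ : PartialEquiv (Eucl n) (Eucl n)}
    (h₁ : IsHomeo φ₁ (cball n) (cball n)) (h₂ : IsHomeo φ₂ (cball n) (cball n)) :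
    AreConjugate k φ₁ φ₂ ↔ ∃ ψ : PartialEquiv (Eucl n) (Eucl n),
      IsDiffeo k ψ (cball n) (cball n) ∧ ∀ v ∈ cball n, φ₂ (ψ v) = φ₁ v := by
  constructor
  · rintro ⟨ψ, hψ, hA⟩
    refine ⟨ψ, hψ, ?_⟩
    have hψm : ∀ v ∈ cball n, ψ v ∈ cball n := fun v hv => by
      have := ψ.map_source (x := v) (by rw [hψ.source_eq]; exact hv)
      rwa [hψ.target_eq] at this
    set Φ : Eucl n → Eucl n := fun u => φ₂ (ψ (φ₁.symm u)) with hΦ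
    have hsymm : ∀ u ∈ cball n, φ₁.symm u ∈ cball n := fun u hu =>
      mem_cball.2 (h₁.norm_symm_le (mem_cball.1 hu))
    have hcomm : ∀ A ∈ SO₀ n, ∀ u ∈ cball n, Φ (proj A u) = proj A (Φ u) := by
      intro A hAm u hu
      have h3 := hA A hAm _ (hsymm u hu)
      rw [conjAct, h₁.right_inv (mem_cball.1 hu)] at h3
      simp only [hΦ]
      rw [h3, apply_conjAct h₂ hAm (mem_cball.1 (hψm _ (hsymm u hu)))]
    have hΦ0 : Φ 0 = 0 := by
      refine proj_eq_zero_of_flip hn fun i j hij => ?_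
      rw [← hcomm _ (flip_mem hij) 0 (by simp), proj_flip_zero]
    have hΦu : EqOn Φ id (oball n) := by
      intro u hu
      obtain ⟨a, s, rfl⟩ := exists_proj_trans_dil_zero (mem_oball.1 hu)
      rw [hcomm _ (trans_mem a) _ (mem_cball.2 (proj_mem_cball (dil_mem s) (by simp))),
        hcomm _ (dil_mem s) _ (by simp), hΦ0]
      rfl
    have hΦc : EqOn Φ id (cball n) := by
      refine hΦu.of_subset_closure ?_ continuousOn_id Metric.ball_subset_closedBall
        cball_subset_closure
      exact h₂.continuousOn.comp (hψ.contDiffOn.continuousOn.comp h₁.continuousOn_symm hsymm)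
        fun u hu => hψm _ (hsymm u hu)
    intro v hv
    have h3 := hΦc (mem_cball.2 (h₁.norm_le (mem_cball.1 hv)))
    simp only [hΦ, h₁.left_inv (mem_cball.1 hv)] at h3
    exact h3
  · rintro ⟨ψ, hψ, heq⟩
    refine ⟨ψ, hψ, fun A hA v hv => ?_⟩
    have hψm : ∀ v ∈ cball n, ‖ψ v‖ ≤ 1 := fun v hv => by
      have := ψ.map_source (x := v) (by rw [hψ.source_eq]; exact hv)
      rw [hψ.target_eq] at this
      exact mem_cball.1 this
    have hv' := mem_cball.2 (norm_conjAct_le h₁ hA (mem_cball.1 hv))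
    refine h₂.inj (hψm _ hv') (norm_conjAct_le h₂ hA (hψm v hv)) ?_
    rw [heq _ hv', apply_conjAct h₁ hA (mem_cball.1 hv), apply_conjAct h₂ hA (hψm v hv), heq v hv]

variable {f₁ f₂ : PartialEquiv ℝ ℝ} {φ₁ φ₂ : PartialEquiv (Eucl n) (Eucl n)}

lemma contDiffOn_profile_symm_comp (hf₂ : IsProfile f₂)
    (hg₁ : IsGivenBy f₁ φ₁) (hg₂ : IsGivenBy f₂ φ₂) {ψ : Eucl n → Eucl n}
    (hψ : ContDiffOn ℝ ∞ ψ (cball n)) (hψm : MapsTo ψ (cball n) (cball n))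
    (heq : ∀ v ∈ cball n, φ₂ (ψ v) = φ₁ v) :
    ContDiffOn ℝ ∞ (fun w => f₂.symm (f₁ w)) (Ici 0) := by
  obtain ⟨χ₁, hχ₁⟩ := hg₁.exists_chartFor
  obtain ⟨χ₂, hχ₂⟩ := hg₂.exists_chartFor
  have hz : ∀ w ∈ Ici (0 : ℝ), 0 ≤ vertical n w ⊤ := fun w hw => by rwa [vertical_top]
  have hm : ∀ w ∈ Ici (0 : ℝ),
      ψ (χ₁.symm (vertical n w)) ∈ cball n \ {poleInv φ₂} := by
    intro w hw
    have h1 := hχ₁.symm_mem (hz w hw)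
    refine ⟨hψm h1.1, fun h2 => apply_ne_pole hg₁.1 (mem_cball.1 h1.1) h1.2 ?_⟩
    rw [← heq _ h1.1, mem_singleton_iff.1 h2, apply_poleInv hg₂.1]
  have h1 : ContDiffOn ℝ ∞ (fun w => χ₂ (ψ (χ₁.symm (vertical n w)))) (Ici 0) :=
    hχ₂.diffeo.contDiffOn.comp (hψ.comp hχ₁.contDiffOn_axis
      fun w hw => (hχ₁.symm_mem (hz w hw)).1) hm
  refine ((contDiffOn_euclidean.1 h1) ⊤).congr fun w hw => ?_
  have h2 := hχ₂.kleinChart_top (hm w hw)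
  rw [heq _ (hχ₁.symm_mem (hz w hw)).1, hχ₁.kleinChart_symm (hz w hw), vertMap_vertical,
    vertical_top] at h2
  rw [h2, hf₂.left_inv (hχ₂.top_nonneg (hm w hw))]

lemma contDiffOn_symm_comp_of_profile (hn : 2 ≤ n) (hf₁ : IsProfile f₁) (hf₂ : IsProfile f₂)
    (hg₁ : IsGivenBy f₁ φ₁) (hg₂ : IsGivenBy f₂ φ₂) (h₁ : IsSmoothCompactification φ₁)
    (h₂ : IsSmoothCompactification φ₂)
    (hs : ContDiffOn ℝ ∞ (fun w => f₂.symm (f₁ w)) (Ici 0)) :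
    ContDiffOn ℝ ∞ (fun v => φ₂.symm (φ₁ v)) (cball n) := by
  obtain ⟨χ₁, hχ₁⟩ := hg₁.exists_chartFor
  obtain ⟨χ₂, hχ₂⟩ := hg₂.exists_chartFor
  set H : ℝ → ℝ := fun w => f₂.symm (f₁ w) with hH
  have hoff : ContDiffOn ℝ ∞ (fun v => φ₂.symm (φ₁ v)) (cball n \ {poleInv φ₁}) := by
    have hvs : ContDiffOn ℝ ∞ (vertMap H) (halfSpace n) := by
      rw [contDiffOn_euclidean]
      intro i
      by_cases hi : i = ⊤
      · subst hi
        have h3 : ContDiffOn ℝ ∞ (fun z : Eucl n => H (z ⊤)) (halfSpace n) :=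
          hs.comp (by fun_prop) fun z hz => hz
        exact h3.congr fun z _ => by simp [vertMap]
      · have h3 : ContDiffOn ℝ ∞ (fun z : Eucl n => z i) (halfSpace n) := by fun_prop
        exact h3.congr fun z _ => by simp [vertMap, hi]
    have hvm : ∀ z ∈ halfSpace n, 0 ≤ vertMap H z ⊤ := fun z hz => by
      simpa [vertMap] using hf₂.mapsTo_symm (hf₁.mapsTo hz)
    have h4 : ContDiffOn ℝ ∞ (fun v => χ₂.symm (vertMap H (χ₁ v))) (cball n \ {poleInv φ₁}) :=
      hχ₂.diffeo.contDiffOn_symm.comp (hvs.comp hχ₁.diffeo.contDiffOn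
        fun v hv => hχ₁.top_nonneg hv) fun v hv => hvm _ (hχ₁.top_nonneg hv)
    refine h4.congr fun v hv => ?_
    have h5 := hvm _ (hχ₁.top_nonneg hv)
    have h6 := hχ₂.symm_mem h5
    have h7 : φ₂ (χ₂.symm (vertMap H (χ₁ v))) = φ₁ v := by
      refine kleinChart_inj (hg₂.1.norm_le (mem_cball.1 h6.1))
        (apply_ne_pole hg₂.1 (mem_cball.1 h6.1) h6.2) (hg₁.1.norm_le (mem_cball.1 hv.1))
        (apply_ne_pole hg₁.1 (mem_cball.1 hv.1) hv.2) ?_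
      rw [hχ₂.kleinChart_symm h5, hχ₁.eq v hv]
      ext i
      by_cases hi : i = ⊤
      · subst hi
        simp [vertMap, hH, hf₂.right_inv (hf₁.mapsTo (hχ₁.top_nonneg hv))]
      · simp [vertMap, hi]
    change φ₂.symm (φ₁ v) = _
    rw [← h7, hg₂.1.left_inv (mem_cball.1 h6.1)]
  intro v hv
  by_cases hp : v = poleInv φ₁
  · -- near the preimage of the pole, conjugate by an element that moves the pole
    have : Nontrivial (Fin n) := Fin.nontrivial_iff_two_le.2 hn
    obtain ⟨j, hj⟩ := exists_ne (⊤ : Fin n)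
    set A := flip ⊤ j
    have hA : A ∈ SO₀ n := flip_mem hj.symm
    have hmaps : MapsTo (conjAct φ₁ A) (cball n) (cball n) := fun v hv =>
      mem_cball.2 (norm_conjAct_le h₁.isHomeo hA (mem_cball.1 hv))
    have hne : conjAct φ₁ A v ≠ poleInv φ₁ := by
      intro h3
      have h4 := congrArg φ₁ h3
      rw [apply_conjAct h₁.isHomeo hA (mem_cball.1 hv), hp, apply_poleInv h₁.isHomeo] at h4
      have h5 := congrArg (fun u : Eucl n => u ⊤) h4
      simp only [A, proj_flip, true_or, if_true, pole_top] at h5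
      norm_num at h5
    have h3 : ContDiffWithinAt ℝ ∞ (fun v => φ₂.symm (φ₁ v)) (cball n) (conjAct φ₁ A v) :=
      (hoff _ ⟨hmaps hv, hne⟩).mono_of_mem_nhdsWithin (sdiff_mem_nhdsWithin hne)
    have h4 := h3.comp v (h₁.contDiffOn_conjAct hA v hv) hmaps
    have h5 : MapsTo ((fun v => φ₂.symm (φ₁ v)) ∘ conjAct φ₁ A) (cball n) (cball n) := fun v hv =>
      mem_cball.2 (h₂.isHomeo.norm_symm_le (h₁.isHomeo.norm_le (mem_cball.1 (hmaps hv))))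
    have h6 := (h₂.contDiffOn_conjAct hA _ (h5 hv)).comp v h4 h5
    have h7 : ∀ v ∈ cball n, φ₂.symm (φ₁ v) =
        (conjAct φ₂ A ∘ (fun v => φ₂.symm (φ₁ v)) ∘ conjAct φ₁ A) v := by
      intro v hv
      have hv' := mem_cball.1 hv
      simp only [Function.comp_apply]
      rw [apply_conjAct h₁.isHomeo hA hv', conjAct,
        h₂.isHomeo.right_inv (proj_mem_cball hA (h₁.isHomeo.norm_le hv')), proj_flip_proj_flip]
    exact h6.congr h7 (h7 v hv)
  · exact (hoff v ⟨hv, hp⟩).mono_of_mem_nhdsWithin (sdiff_mem_nhdsWithin hp)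

theorem areConjugate_iff_sourceConjugate (hn : 2 ≤ n) (hf₁ : IsProfile f₁) (hf₂ : IsProfile f₂)
    (hg₁ : IsGivenBy f₁ φ₁) (hg₂ : IsGivenBy f₂ φ₂) (h₁ : IsSmoothCompactification φ₁)
    (h₂ : IsSmoothCompactification φ₂) :
    AreConjugate ∞ φ₁ φ₂ ↔ SourceConjugate f₁ f₂ := by
  rw [areConjugate_iff hn h₁.isHomeo h₂.isHomeo, hf₁.sourceConjugate_iff hf₂]
  constructor
  · rintro ⟨ψ, hψ, heq⟩
    have hm : MapsTo ψ (cball n) (cball n) := fun v hv => by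
      have := ψ.map_source (x := v) (by rw [hψ.source_eq]; exact hv)
      rwa [hψ.target_eq] at this
    have hm' : MapsTo ψ.symm (cball n) (cball n) := fun v hv => by
      have := ψ.map_target (x := v) (by rw [hψ.target_eq]; exact hv)
      rwa [hψ.source_eq] at this
    refine ⟨contDiffOn_profile_symm_comp hf₂ hg₁ hg₂ hψ.contDiffOn hm heq,
      contDiffOn_profile_symm_comp hf₁ hg₂ hg₁ hψ.contDiffOn_symm hm' fun v hv => ?_⟩
    rw [← heq _ (hm' hv), ψ.right_inv (by rw [hψ.target_eq]; exact hv)]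
  · rintro ⟨hs, hs'⟩
    refine ⟨{ toFun := fun v => φ₂.symm (φ₁ v), invFun := fun v => φ₁.symm (φ₂ v)
              source := cball n, target := cball n
              map_source' := fun v hv => mem_cball.2
                (h₂.isHomeo.norm_symm_le (h₁.isHomeo.norm_le (mem_cball.1 hv)))
              map_target' := fun v hv => mem_cball.2
                (h₁.isHomeo.norm_symm_le (h₂.isHomeo.norm_le (mem_cball.1 hv)))
              left_inv' := fun v hv => by
                rw [h₂.isHomeo.right_inv (h₁.isHomeo.norm_le (mem_cball.1 hv)),
                  h₁.isHomeo.left_inv (mem_cball.1 hv)]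
              right_inv' := fun v hv => by
                rw [h₁.isHomeo.right_inv (h₂.isHomeo.norm_le (mem_cball.1 hv)),
                  h₂.isHomeo.left_inv (mem_cball.1 hv)] },
      ⟨rfl, rfl, contDiffOn_symm_comp_of_profile hn hf₁ hf₂ hg₁ hg₂ h₁ h₂ hs,
        contDiffOn_symm_comp_of_profile hn hf₂ hf₁ hg₂ hg₁ h₂ h₁ hs'⟩, fun v hv => ?_⟩
    exact h₂.isHomeo.right_inv (h₁.isHomeo.norm_le (mem_cball.1 hv))

end Conjugacy

/-! ### Smoothness of the Klein chart of a compactification -/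

section Coordinates

variable {n : ℕ} [NeZero n] {φ : PartialEquiv (Eucl n) (Eucl n)}

open IsSmoothCompactification

/-- The closed ball without the point that `φ` sends to the pole. -/
def punctured (φ : PartialEquiv (Eucl n) (Eucl n)) : Set (Eucl n) := cball n \ {poleInv φ}

/-- The horizontal part of a vector. -/
def hor (z : Eucl n) : Horiz n := fun i => z i

lemma norm_hor_le (z : Eucl n) : ‖hor z‖ ≤ ‖z‖ :=
  (pi_norm_le_iff_of_nonneg (norm_nonneg z)).2 fun i => PiLp.norm_apply_le z i

lemma hor_add_horEmb (z : Eucl n) (a : Horiz n) : hor (z + horEmb a) = hor z + a := by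
  ext i
  simp [hor, horEmb_apply _ i.2]

lemma eq_of_hor_eq {z w : Eucl n} (h : hor z = hor w) (ht : z ⊤ = w ⊤) : z = w := by
  ext i
  by_cases hi : i = ⊤
  · rw [hi, ht]
  · exact congrFun h ⟨i, hi⟩

/-- The Klein chart read through `φ`. -/
def coord (φ : PartialEquiv (Eucl n) (Eucl n)) (v : Eucl n) : Eucl n := kleinChart (φ v)

/-- The inverse of `coord φ`. -/
def param (φ : PartialEquiv (Eucl n) (Eucl n)) (z : Eucl n) : Eucl n := φ.symm (kleinInv z)

lemma punctured_mem_nhdsWithin {v : Eucl n} (hv : v ∈ punctured φ) :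
    punctured φ ∈ 𝓝[cball n] v := sdiff_mem_nhdsWithin hv.2

section IsHomeo

variable (h : IsHomeo φ (cball n) (cball n))
include h

lemma coord_top_nonneg {v : Eucl n} (hv : v ∈ punctured φ) : 0 ≤ coord φ v ⊤ :=
  kleinChart_top_nonneg (h.norm_le (mem_cball.1 hv.1))

lemma continuousOn_coord : ContinuousOn (coord φ) (punctured φ) := fun v hv =>
  ((contDiffAt_kleinChart (top_lt_one (h.norm_le (mem_cball.1 hv.1))
    (apply_ne_pole h (mem_cball.1 hv.1) hv.2))).continuousAt.comp_continuousWithinAt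
      (h.continuousOn v hv.1)).mono sdiff_subset

lemma param_mem {z : Eucl n} (hz : 0 ≤ z ⊤) : param φ z ∈ punctured φ := by
  refine ⟨mem_cball.2 (h.norm_symm_le (kleinInv_mem hz)), fun h1 => kleinInv_ne_pole hz ?_⟩
  have h2 := congrArg φ (mem_singleton_iff.1 h1)
  rwa [param, h.right_inv (kleinInv_mem hz), apply_poleInv h] at h2

lemma coord_param {z : Eucl n} (hz : 0 ≤ z ⊤) : coord φ (param φ z) = z := by
  rw [coord, param, h.right_inv (kleinInv_mem hz), kleinChart_kleinInv hz]

lemma param_coord {v : Eucl n} (hv : v ∈ punctured φ) : param φ (coord φ v) = v := by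
  have hv' := mem_cball.1 hv.1
  rw [coord, param, kleinInv_kleinChart (h.norm_le hv') (apply_ne_pole h hv' hv.2), h.left_inv hv']

lemma coord_inj {u v : Eucl n} (hu : u ∈ punctured φ) (hv : v ∈ punctured φ)
    (huv : coord φ u = coord φ v) : u = v := by
  rw [← param_coord h hu, huv, param_coord h hv]

lemma continuousOn_param : ContinuousOn (param φ) (halfSpace n) :=
  h.continuousOn_symm.comp
    (fun _ hz => (contDiffAt_kleinInv hz).continuousAt.continuousWithinAt)
    fun _ hz => mem_cball.2 (kleinInv_mem hz)

lemma conjAct_trans_mem (a : Horiz n) {v : Eucl n} (hv : v ∈ punctured φ) :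
    conjAct φ (trans a) v ∈ punctured φ := by
  have hv' := mem_cball.1 hv.1
  refine ⟨mem_cball.2 (norm_conjAct_le h (trans_mem a) hv'), fun h1 => ?_⟩
  have h2 := congrArg φ (mem_singleton_iff.1 h1)
  rw [apply_conjAct h (trans_mem a) hv', apply_poleInv h] at h2
  exact proj_trans_ne_pole a (h.norm_le hv') (apply_ne_pole h hv' hv.2) h2

lemma coord_trans (a : Horiz n) {v : Eucl n} (hv : v ∈ punctured φ) :
    coord φ (conjAct φ (trans a) v) = coord φ v + horEmb a := by
  have hv' := mem_cball.1 hv.1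
  rw [coord, apply_conjAct h (trans_mem a) hv', kleinChart_trans a (h.norm_le hv'),
    if_neg (apply_ne_pole h hv' hv.2), coord]

lemma conjAct_trans_eq (a : Horiz n) {v : Eucl n} (hv : v ∈ punctured φ) :
    conjAct φ (trans a) v = param φ (coord φ v + horEmb a) := by
  rw [← coord_trans h a hv, param_coord h (conjAct_trans_mem h a hv)]

lemma coord_trans_top (a : Horiz n) {v : Eucl n} (hv : v ∈ punctured φ) :
    coord φ (conjAct φ (trans a) v) ⊤ = coord φ v ⊤ := by
  rw [coord_trans h a hv, PiLp.add_apply, horEmb_top, add_zero]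

/-- Translations act transitively on the points of a given height. -/
lemma conjAct_trans_sub {u v : Eucl n} (hu : u ∈ punctured φ) (hv : v ∈ punctured φ)
    (ht : coord φ u ⊤ = coord φ v ⊤) :
    conjAct φ (trans (hor (coord φ u) - hor (coord φ v))) v = u := by
  refine coord_inj h (conjAct_trans_mem h _ hv) hu ?_
  rw [coord_trans h _ hv]
  refine eq_of_hor_eq ?_ ?_
  · rw [hor_add_horEmb, add_sub_cancel]
  · rw [PiLp.add_apply, horEmb_top, add_zero, ht]

lemma continuous_conjAct_trans {v : Eucl n} (hv : v ∈ punctured φ) :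
    Continuous fun a : Horiz n => conjAct φ (trans a) v := by
  simp only [conjAct_trans_eq h _ hv]
  rw [← continuousOn_univ]
  refine (continuousOn_param h).comp
    (continuous_const.add contDiff_horEmb.continuous).continuousOn fun a _ => ?_
  rw [halfSpace, mem_ofPred_eq, PiLp.add_apply, horEmb_top, add_zero]
  exact coord_top_nonneg h hv

lemma conjAct_flip_mem {i j : Fin n} (hi : i ≠ ⊤) (hj : j ≠ ⊤) (hij : i ≠ j) {v : Eucl n}
    (hv : v ∈ punctured φ) : conjAct φ (flip i j) v ∈ punctured φ := by
  have hv' := mem_cball.1 hv.1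
  refine ⟨mem_cball.2 (norm_conjAct_le h (flip_mem hij) hv'), fun h1 => ?_⟩
  have h2 := congrArg φ (mem_singleton_iff.1 h1)
  rw [apply_conjAct h (flip_mem hij) hv', apply_poleInv h] at h2
  refine apply_ne_pole h hv' hv.2 ?_
  rw [← proj_flip_proj_flip i j (φ v), h2]
  ext k
  rw [proj_flip]
  split_ifs with hk
  · rw [pole_apply (by rcases hk with rfl | rfl <;> assumption), neg_zero]
  · rfl

lemma coord_flip {i j : Fin n} (hi : i ≠ ⊤) (hj : j ≠ ⊤) (hij : i ≠ j) {v : Eucl n}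
    (hv : v ∈ punctured φ) (k : Fin n) : coord φ (conjAct φ (flip i j) v) k =
      if k = i ∨ k = j then -coord φ v k else coord φ v k := by
  rw [coord, apply_conjAct h (flip_mem hij) (mem_cball.1 hv.1), kleinChart_flip hi hj]
  rfl

end IsHomeo

lemma coord_top_eq_zero (hφ : IsSmoothCompactification φ) {v : Eucl n} (hv : ‖v‖ = 1) :
    coord φ v ⊤ = 0 := kleinChart_top_eq_zero (hφ.norm_eq_one hv)

lemma coord_top_pos (hφ : IsSmoothCompactification φ) {v : Eucl n} (hv : ‖v‖ < 1) :
    0 < coord φ v ⊤ := kleinChart_top_pos (hφ.norm_lt hv)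

lemma mem_punctured_of_norm_lt (hφ : IsSmoothCompactification φ) {v : Eucl n} (hv : ‖v‖ < 1) :
    v ∈ punctured φ :=
  ⟨mem_cball.2 hv.le, fun h => by
    rw [mem_singleton_iff.1 h, norm_poleInv hφ] at hv; exact lt_irrefl _ hv⟩

lemma norm_param_of_eq_zero (hφ : IsSmoothCompactification φ) {z : Eucl n} (hz : z ⊤ = 0) :
    ‖param φ z‖ = 1 := by
  have h1 := param_mem hφ.isHomeo hz.ge
  refine le_antisymm (mem_cball.1 h1.1) (not_lt.1 fun h2 => ?_)
  have h3 := coord_top_pos hφ h2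
  rw [coord_param hφ.isHomeo hz.ge, hz] at h3
  exact lt_irrefl _ h3

lemma contDiffOn_coord_oball (hφ : IsSmoothCompactification φ) :
    ContDiffOn ℝ ∞ (coord φ) (oball n) := fun v hv =>
  ((contDiffAt_kleinChart (top_lt_one (hφ.norm_lt (mem_oball.1 hv)).le
    (ne_pole_of_norm_lt (hφ.norm_lt (mem_oball.1 hv))))).of_le (by simp)).comp_contDiffWithinAt v
      (hφ.contDiffOn v hv)

lemma contDiffOn_param_interior (hφ : IsSmoothCompactification φ) :
    ContDiffOn ℝ ∞ (param φ) {z | 0 < z ⊤} :=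
  hφ.contDiffOn_symm.comp (fun z hz =>
    ((contDiffAt_kleinInv (le_of_lt hz)).of_le (by simp)).contDiffWithinAt)
    fun _ hz => mem_oball.2 (kleinInv_mem_oball hz)

lemma contDiffWithinAt_coord_of_norm_lt (hφ : IsSmoothCompactification φ) {v : Eucl n}
    (hv : ‖v‖ < 1) (s : Set (Eucl n)) : ContDiffWithinAt ℝ ∞ (coord φ) s v :=
  ((contDiffOn_coord_oball hφ).contDiffAt
    (Metric.isOpen_ball.mem_nhds (mem_oball.2 hv))).contDiffWithinAt

/-- A function on the ball, smooth up to the boundary, whose support stays away from the point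
sent to the pole, where the Klein chart is bounded by `R`: along each orbit of the horizontal
translations, it has compact support. -/
structure IsWindow (φ : PartialEquiv (Eucl n) (Eucl n)) (ψ : Eucl n → ℝ) (R : ℝ) : Prop where
  contDiffOn : ContDiffOn ℝ ∞ ψ (cball n)
  norm_coord_le : ∀ v ∈ punctured φ, ψ v ≠ 0 → ‖coord φ v‖ ≤ R

lemma IsWindow.mul {ψ g : Eucl n → ℝ} {R : ℝ} (hψ : IsWindow φ ψ R)
    (hg : ContDiffOn ℝ ∞ g (cball n)) : IsWindow φ (fun v => ψ v * g v) R where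
  contDiffOn := hψ.contDiffOn.mul hg
  norm_coord_le v hv h := hψ.norm_coord_le v hv (left_ne_zero_of_mul h)

/-- The integral of `ψ` along the horizontal translations, with weight `g`. It is meaningful for a
window function `ψ`. -/
def average (φ : PartialEquiv (Eucl n) (Eucl n)) (g : Horiz n → ℝ) (ψ : Eucl n → ℝ)
    (v : Eucl n) : ℝ := ∫ a : Horiz n, g a • ψ (conjAct φ (trans a) v)

namespace IsWindow

variable {ψ : Eucl n → ℝ} {R : ℝ} {g : Horiz n → ℝ}

lemma eq_zero (hψ : IsWindow φ ψ R) (h : IsHomeo φ (cball n) (cball n)) {v : Eucl n}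
    (hv : v ∈ punctured φ) {r : ℝ} (hr : ‖coord φ v‖ ≤ r) {a : Horiz n}
    (ha : a ∉ Metric.closedBall (0 : Horiz n) (R + r)) : ψ (conjAct φ (trans a) v) = 0 := by
  by_contra hne
  refine ha (mem_closedBall_zero_iff.2 ?_)
  have h1 := (norm_hor_le _).trans (hψ.norm_coord_le _ (conjAct_trans_mem h a hv) hne)
  rw [coord_trans h a hv, hor_add_horEmb] at h1
  calc ‖a‖ = ‖(hor (coord φ v) + a) - hor (coord φ v)‖ := by rw [add_sub_cancel_left]
    _ ≤ ‖hor (coord φ v) + a‖ + ‖hor (coord φ v)‖ := norm_sub_le _ _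
    _ ≤ R + r := add_le_add h1 ((norm_hor_le _).trans hr)

lemma average_eq (hψ : IsWindow φ ψ R) (h : IsHomeo φ (cball n) (cball n)) {v : Eucl n}
    (hv : v ∈ punctured φ) {r : ℝ} (hr : ‖coord φ v‖ ≤ r) : average φ g ψ v =
      ∫ a in Metric.closedBall (0 : Horiz n) (R + r), g a • ψ (conjAct φ (trans a) v) :=
  (setIntegral_eq_integral_of_forall_compl_eq_zero fun a ha => by
    rw [hψ.eq_zero h hv hr ha, smul_zero]).symm

lemma continuous_comp (hψ : IsWindow φ ψ R) (h : IsHomeo φ (cball n) (cball n)) {v : Eucl n}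
    (hv : v ∈ punctured φ) : Continuous fun a : Horiz n => ψ (conjAct φ (trans a) v) := by
  rw [← continuousOn_univ]
  exact hψ.contDiffOn.continuousOn.comp (continuous_conjAct_trans h hv).continuousOn
    fun a _ => (conjAct_trans_mem h a hv).1

lemma hasCompactSupport (hψ : IsWindow φ ψ R) (h : IsHomeo φ (cball n) (cball n)) {v : Eucl n}
    (hv : v ∈ punctured φ) : HasCompactSupport fun a : Horiz n => ψ (conjAct φ (trans a) v) :=
  HasCompactSupport.intro (isCompact_closedBall 0 (R + ‖coord φ v‖))
    fun _ ha => hψ.eq_zero h hv le_rfl ha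

lemma integrable (hψ : IsWindow φ ψ R) (h : IsHomeo φ (cball n) (cball n)) (hg : Continuous g)
    {v : Eucl n} (hv : v ∈ punctured φ) :
    Integrable fun a : Horiz n => g a • ψ (conjAct φ (trans a) v) :=
  (hg.smul (hψ.continuous_comp h hv)).integrable_of_hasCompactSupport
    (hψ.hasCompactSupport h hv).smul_left

lemma contDiffOn_average (hψ : IsWindow φ ψ R) (hφ : IsSmoothCompactification φ)
    (hg : Continuous g) : ContDiffOn ℝ ∞ (average φ g ψ) (punctured φ) := by
  intro v hv
  have h := hφ.isHomeo
  have h2 : ContDiffOn ℝ ∞ (fun u => ∫ a in Metric.closedBall (0 : Horiz n)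
      (R + (‖coord φ v‖ + 1)), g a • ψ (conjAct φ (trans a) u)) (cball n) :=
    (smoothAction_trans hφ).contDiffOn_average (isCompact_closedBall _ _) (convex_closedBall _ _)
      nonempty_interior_cball (isCompact_closedBall _ _) hg hψ.contDiffOn
  refine ((h2 v hv.1).mono sdiff_subset).congr_of_eventuallyEq ?_ ?_
  · have h3 : ∀ᶠ u in 𝓝[punctured φ] v, ‖coord φ u‖ < ‖coord φ v‖ + 1 :=
      (continuousOn_coord h v hv).norm.eventually_lt_const (lt_add_one _)
    filter_upwards [h3, self_mem_nhdsWithin] with u hu hum using hψ.average_eq h hum hu.le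
  · exact hψ.average_eq h hv (by linarith)

lemma average_trans (hφ : IsSmoothCompactification φ) {v : Eucl n} (hv : v ∈ punctured φ)
    (b : Horiz n) :
    average φ g ψ (conjAct φ (trans b) v) = average φ (fun a => g (a - b)) ψ v := by
  rw [average, average,
    ← integral_add_right_eq_self (fun a : Horiz n => g (a - b) • ψ (conjAct φ (trans a) v)) b]
  refine integral_congr_ae (Eventually.of_forall fun a => ?_)
  simp only [add_sub_cancel_right]
  rw [(smoothAction_trans hφ).add a b v hv.1]

lemma average_one_eq (hφ : IsSmoothCompactification φ) {u v : Eucl n}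
    (hu : u ∈ punctured φ) (hv : v ∈ punctured φ) (ht : coord φ u ⊤ = coord φ v ⊤) :
    average φ (fun _ => 1) ψ u = average φ (fun _ => 1) ψ v := by
  conv_lhs => rw [← conjAct_trans_sub hφ.isHomeo hu hv ht, average_trans hφ hv]

/-- The moments of `ψ` along the orbits of the translations are equivariant. -/
lemma average_coord_eq (hψ : IsWindow φ ψ R) (hφ : IsSmoothCompactification φ) {u v : Eucl n}
    (hu : u ∈ punctured φ) (hv : v ∈ punctured φ) (ht : coord φ u ⊤ = coord φ v ⊤)
    (i : {i : Fin n // i ≠ ⊤}) : average φ (fun a => a i) ψ u = average φ (fun a => a i) ψ v -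
      (coord φ u i - coord φ v i) * average φ (fun _ => 1) ψ v := by
  conv_lhs => rw [← conjAct_trans_sub hφ.isHomeo hu hv ht, average_trans hφ hv]
  have h1 := hψ.integrable hφ.isHomeo (continuous_apply i) hv
  have h2 := hψ.integrable hφ.isHomeo (g := fun _ => 1) continuous_const hv
  rw [average, average, average, ← integral_const_mul, ← integral_sub h1 (h2.const_mul _)]
  refine integral_congr_ae (Eventually.of_forall fun a => ?_)
  simp only [Pi.sub_apply, hor, smul_eq_mul]
  ring

lemma average_pos (hψ : IsWindow φ ψ R) (h : IsHomeo φ (cball n) (cball n))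
    (h0 : ∀ v, 0 ≤ ψ v) {u v : Eucl n} (hu : u ∈ punctured φ) (hv : v ∈ punctured φ)
    (ht : coord φ u ⊤ = coord φ v ⊤) (hpos : 0 < ψ u) : 0 < average φ (fun _ => 1) ψ v := by
  simp only [average, one_smul]
  refine (hψ.continuous_comp h hv).integral_pos_of_hasCompactSupport_nonneg_nonzero
    (hψ.hasCompactSupport h hv) (fun a => h0 _)
    (x := hor (coord φ u) - hor (coord φ v)) ?_
  rw [conjAct_trans_sub h hu hv ht]
  exact hpos.ne'

end IsWindow

lemma exists_isWindow (hφ : IsSmoothCompactification φ) : ∃ (ξ : Eucl n → ℝ) (R : ℝ),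
    IsWindow φ ξ R ∧ (∀ v, 0 ≤ ξ v) ∧
      ∀ v ∈ punctured φ, ‖v‖ = 1 → 0 < average φ (fun _ => 1) ξ v := by
  have h := hφ.isHomeo
  have h0 : (0 : ℝ) ≤ (0 : Eucl n) ⊤ := le_rfl
  set q := param φ 0 with hq
  have hqm : q ∈ punctured φ := param_mem h h0
  have hd : 0 < dist q (poleInv φ) := dist_pos.2 hqm.2
  let b : ContDiffBump q := ⟨dist q (poleInv φ) / 4, dist q (poleInv φ) / 2, by linarith,
    by linarith⟩
  have hK : IsCompact (cball n ∩ Metric.closedBall q (dist q (poleInv φ) / 2)) :=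
    (isCompact_closedBall _ _).inter_right Metric.isClosed_closedBall
  have hKm : cball n ∩ Metric.closedBall q (dist q (poleInv φ) / 2) ⊆ punctured φ := by
    rintro v ⟨hv, hvq⟩
    refine ⟨hv, fun h1 => ?_⟩
    rw [mem_singleton_iff.1 h1, Metric.mem_closedBall, dist_comm] at hvq
    linarith
  obtain ⟨R, hR⟩ := hK.exists_bound_of_continuousOn ((continuousOn_coord h).mono hKm)
  have hw : IsWindow φ b R := ⟨b.contDiff.contDiffOn, fun v hv hne => hR v ⟨hv.1, by
    have h1 : v ∈ Function.support b := hne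
    rw [b.support_eq] at h1
    exact Metric.ball_subset_closedBall h1⟩⟩
  refine ⟨b, R, hw, fun v => b.nonneg, fun v hv hv1 => hw.average_pos h (fun v => b.nonneg) hqm hv
    ?_ (b.pos_of_mem_ball (Metric.mem_ball_self b.rOut_pos))⟩
  rw [coord_top_eq_zero hφ hv1, hq, coord_param h h0]
  rfl

/-- The horizontal coordinates are smooth up to the boundary: they are recovered from the first
moments of a window function by comparing a point with its image under a rotation that reverses
the coordinate and preserves the height. The rotation has to fix the pole, which leaves room only
for `n ≥ 3`. -/
lemma contDiffOn_coord_apply (hn : 3 ≤ n) (hφ : IsSmoothCompactification φ) {i : Fin n}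
    (hi : i ≠ ⊤) : ContDiffOn ℝ ∞ (fun v => coord φ v i) (punctured φ) := by
  obtain ⟨j, hji, hj⟩ := Fin.exists_ne_and_ne_of_two_lt i ⊤ hn
  have h := hφ.isHomeo
  intro v hv
  rcases lt_or_eq_of_le (mem_cball.1 hv.1) with hlt | hv1
  · exact (contDiffWithinAt_euclidean.1 (contDiffWithinAt_coord_of_norm_lt hφ hlt _)) i
  obtain ⟨ξ, R, hw, h0, hpos⟩ := exists_isWindow hφ
  have hN : ContDiffOn ℝ ∞ (average φ (fun _ => 1) ξ) (punctured φ) :=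
    hw.contDiffOn_average hφ continuous_const
  have hNi : ContDiffOn ℝ ∞ (average φ (fun a => a ⟨i, hi⟩) ξ) (punctured φ) :=
    hw.contDiffOn_average hφ (continuous_apply _)
  have hρ : ContDiffOn ℝ ∞ (conjAct φ (flip i j)) (punctured φ) :=
    (hφ.contDiffOn_conjAct (flip_mem hji.symm)).mono sdiff_subset
  have hρm : MapsTo (conjAct φ (flip i j)) (punctured φ) (punctured φ) := fun u hu =>
    conjAct_flip_mem h hi hj hji.symm hu
  have hkey : ∀ u ∈ punctured φ, average φ (fun a => a ⟨i, hi⟩) ξ (conjAct φ (flip i j) u) =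
      average φ (fun a => a ⟨i, hi⟩) ξ u + 2 * coord φ u i * average φ (fun _ => 1) ξ u := by
    intro u hu
    have ht : coord φ (conjAct φ (flip i j) u) ⊤ = coord φ u ⊤ := by
      rw [coord_flip h hi hj hji.symm hu, if_neg (by simp [hi.symm, hj.symm])]
    rw [hw.average_coord_eq hφ (hρm hu) hu ht, coord_flip h hi hj hji.symm hu, if_pos (Or.inl rfl)]
    ring
  have hN0 := hpos v hv hv1
  have h1 := (((hNi.comp hρ hρm) v hv).sub (hNi v hv)).div
    (contDiffWithinAt_const (c := (2 : ℝ)) |>.mul (hN v hv)) (by positivity)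
  refine h1.congr_of_eventuallyEq ?_ ?_
  · filter_upwards [(hN.continuousOn v hv).eventually_const_lt hN0, self_mem_nhdsWithin]
      with u hu0 hu
    simp only [Function.comp_apply, Pi.div_apply]
    rw [hkey u hu, eq_div_iff (by positivity)]
    ring
  · simp only [Function.comp_apply, Pi.div_apply]
    rw [hkey v hv, eq_div_iff (by positivity)]
    ring

/-- The height is smooth up to the boundary: the element that reverses the pole acts on the
coordinates by an inversion, which relates the height to the horizontal coordinates away from the
origin. -/
lemma contDiffOn_coord_top (hn : 3 ≤ n) (hφ : IsSmoothCompactification φ) :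
    ContDiffOn ℝ ∞ (fun v => coord φ v ⊤) (punctured φ) := by
  have h := hφ.isHomeo
  obtain ⟨j, -, hj⟩ := Fin.exists_ne_and_ne_of_two_lt ⊤ ⊤ hn
  have hA : flip ⊤ j ∈ SO₀ n := flip_mem hj.symm
  have hX : ∀ k, k ≠ ⊤ → ContDiffOn ℝ ∞ (fun v => coord φ v k) (punctured φ) := fun k hk =>
    contDiffOn_coord_apply hn hφ hk
  have hstep : ∀ v ∈ punctured φ, coord φ v j ≠ 0 →
      ContDiffWithinAt ℝ ∞ (fun v => coord φ v ⊤) (punctured φ) v := by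
    intro v hv hvj
    have hm : ∀ u ∈ punctured φ, coord φ u j ≠ 0 →
        conjAct φ (flip ⊤ j) u ∈ punctured φ ∧ coord φ (conjAct φ (flip ⊤ j) u) j *
          (‖coord φ u‖ ^ 2 - coord φ u ⊤ ^ 2 + coord φ u ⊤) = -coord φ u j := by
      intro u hu huj
      have hu' := mem_cball.1 hu.1
      have hup := apply_ne_pole h hu' hu.2
      have h1 := kleinChart_flip_top (j := j) (h.norm_le hu') hup hj
      rw [if_pos rfl] at h1
      refine ⟨⟨mem_cball.2 (norm_conjAct_le h hA hu'), fun h2 => huj ?_⟩, ?_⟩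
      · have h3 := congrArg φ (mem_singleton_iff.1 h2)
        rw [apply_conjAct h hA hu', apply_poleInv h] at h3
        rw [h3, HypCompact.kleinChart_apply _ hj, pole_apply hj, zero_div, zero_mul] at h1
        exact neg_eq_zero.1 h1.symm
      · simp only [coord]
        rw [apply_conjAct h hA hu']
        exact h1
    have hne : ∀ u ∈ punctured φ, coord φ u j ≠ 0 →
        coord φ (conjAct φ (flip ⊤ j) u) j ≠ 0 := fun u hu huj h0 => huj (by
      have := (hm u hu huj).2
      rw [h0, zero_mul] at this
      exact neg_eq_zero.1 this.symm)
    have hform : ∀ u ∈ punctured φ, coord φ u j ≠ 0 → coord φ u ⊤ =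
        -coord φ u j / coord φ (conjAct φ (flip ⊤ j) u) j -
          ∑ i ∈ Finset.univ.erase ⊤, coord φ u i ^ 2 := by
      intro u hu huj
      rw [← (hm u hu huj).2, mul_div_cancel_left₀ _ (hne u hu huj), norm_sq_eq_top_add]
      ring
    have h1 : ContDiffWithinAt ℝ ∞ (fun u => coord φ (conjAct φ (flip ⊤ j) u) j)
        (punctured φ) v := by
      have h2 : ContDiffWithinAt ℝ ∞ (fun u => coord φ u j) (cball n)
          (conjAct φ (flip ⊤ j) v) :=
        (hX j hj _ (hm v hv hvj).1).mono_of_mem_nhdsWithin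
          (punctured_mem_nhdsWithin (hm v hv hvj).1)
      exact (h2.comp v (hφ.contDiffOn_conjAct hA v hv.1) fun u hu =>
        mem_cball.2 (norm_conjAct_le h hA (mem_cball.1 hu))).mono sdiff_subset
    have h3 := ((hX j hj v hv).neg.div h1 (hne v hv hvj)).sub
      (ContDiffWithinAt.sum (s := Finset.univ.erase ⊤) (f := fun i u => coord φ u i ^ 2)
        fun i hi => (hX i (Finset.ne_of_mem_erase hi) v hv).pow 2)
    refine h3.congr_of_eventuallyEq ?_ (hform v hv hvj)
    have h4 := ((hX j hj).continuousOn v hv).eventually_ne hvj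
    filter_upwards [h4, self_mem_nhdsWithin] with u hu1 hu2 using hform u hu2 hu1
  intro v hv
  -- translate so that the `j`-th coordinate does not vanish
  set b : Horiz n := fun _ => 1 - coord φ v j with hb
  have hbm : MapsTo (conjAct φ (trans b)) (punctured φ) (punctured φ) := fun u hu =>
    conjAct_trans_mem h b hu
  have h1 : coord φ (conjAct φ (trans b) v) j = 1 := by
    rw [coord_trans h b hv, PiLp.add_apply, horEmb_apply _ hj, hb]
    ring
  have h2 := (hstep _ (hbm hv) (by rw [h1]; exact one_ne_zero)).comp v
    (((hφ.contDiffOn_conjAct (trans_mem b)).mono sdiff_subset) v hv) hbm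
  exact h2.congr (fun u hu => (coord_trans_top h b hu).symm) (coord_trans_top h b hv).symm

end Coordinates

/-! ### A height that is transverse to the boundary -/

/-- An increasing smooth change of variable of the half-line that may fail to be smooth at `0` has
an inverse with the same properties. -/
lemma exists_partialEquiv_of_deriv_pos {h : ℝ → ℝ} (hc : ContinuousOn h (Ici 0))
    (hs : ContDiffOn ℝ ∞ h (Ioi 0)) (hd : ∀ y > 0, 0 < deriv h y) (h0 : h 0 = 0) {C : ℝ}
    (hC : 0 < C) (hCh : ∀ y ≥ 0, C * y ≤ h y) :
    ∃ e : PartialEquiv ℝ ℝ, (∀ y, e y = h y) ∧ IsHomeo e (Ici 0) (Ici 0) ∧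
      e '' Ioi 0 = Ioi 0 ∧ ContDiffOn ℝ ∞ e.symm (Ioi 0) := by
  have hmono : StrictMonoOn h (Ici 0) :=
    strictMonoOn_of_deriv_pos (convex_Ici 0) hc fun y hy => hd y (by simpa using hy)
  have hmaps : MapsTo h (Ici 0) (Ici 0) := fun y hy =>
    le_trans (mul_nonneg hC.le hy) (hCh y hy)
  have hsurj : SurjOn h (Ici 0) (Ici 0) := by
    intro z hz
    have hz' : 0 ≤ z / C := div_nonneg hz hC.le
    have h1 : z ≤ h (z / C) := by
      have := hCh _ hz'
      rwa [mul_div_cancel₀ _ hC.ne'] at this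
    obtain ⟨y, hy, rfl⟩ := intermediate_value_Icc hz' (hc.mono Icc_subset_Ici_self)
      (show z ∈ Icc (h 0) (h (z / C)) from ⟨by rw [h0]; exact hz, h1⟩)
    exact ⟨y, hy.1, rfl⟩
  let e : PartialEquiv ℝ ℝ := BijOn.toPartialEquiv h (Ici 0) (Ici 0) ⟨hmaps, hmono.injOn, hsurj⟩
  have he : ∀ y, e y = h y := fun y => rfl
  have hes : ∀ z ∈ Ici (0 : ℝ), e.symm z ∈ Ici (0 : ℝ) := fun z hz => e.map_target hz
  have her : ∀ z ∈ Ici (0 : ℝ), h (e.symm z) = z := fun z hz => e.right_inv hz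
  have hel : ∀ y ∈ Ici (0 : ℝ), e.symm (h y) = y := fun y hy => e.left_inv hy
  have hsmono : StrictMonoOn e.symm (Ici 0) := fun z hz w hw hzw => by
    by_contra hle
    have := hmono.monotoneOn (hes w hw) (hes z hz) (not_lt.1 hle)
    rw [her z hz, her w hw] at this
    exact absurd hzw (not_lt.2 this)
  have himg : e.symm '' Ici 0 = Ici 0 := e.symm.image_source_eq_target
  have hsymm0 : e.symm 0 = 0 := by
    have := hel 0 self_mem_Ici
    rwa [h0] at this
  have hpos : ∀ z > 0, 0 < e.symm z := fun z hz => by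
    have := hsmono self_mem_Ici (le_of_lt hz : (0 : ℝ) ≤ z) hz
    rwa [hsymm0] at this
  have hcs : ContinuousOn e.symm (Ici 0) := by
    intro z hz
    rcases eq_or_lt_of_le (show (0 : ℝ) ≤ z from hz) with rfl | hz'
    · refine hsmono.continuousWithinAt_right_of_image_mem_nhdsWithin self_mem_nhdsWithin ?_
      rw [himg, hsymm0]
      exact self_mem_nhdsWithin
    · refine (hsmono.continuousAt_of_image_mem_nhds (Ici_mem_nhds hz') ?_).continuousWithinAt
      rw [himg]
      exact Ici_mem_nhds (hpos z hz')
  have hhpos : ∀ y > 0, 0 < h y := fun y hy => by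
    have := hmono self_mem_Ici (le_of_lt hy : (0 : ℝ) ≤ y) hy
    rwa [h0] at this
  refine ⟨e, he, ⟨rfl, rfl, hc, hcs⟩, ?_, ?_⟩
  · ext z
    constructor
    · rintro ⟨y, hy, rfl⟩
      exact hhpos y hy
    · exact fun hz => ⟨e.symm z, hpos z hz, her z (Ioi_subset_Ici_self hz)⟩
  · let e' : PartialEquiv ℝ ℝ :=
      { toFun := h, invFun := e.symm, source := Ioi 0, target := Ioi 0
        map_source' := fun y hy => hhpos y hy
        map_target' := fun z hz => hpos z hz
        left_inv' := fun y hy => hel y (Ioi_subset_Ici_self hy)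
        right_inv' := fun z hz => her z (Ioi_subset_Ici_self hz) }
    refine contDiffOn_symm_of_fderivWithin e' (uniqueDiffOn_Ioi 0) (uniqueDiffOn_Ioi 0) hs
      (hcs.mono Ioi_subset_Ici_self) fun y hy => ?_
    refine ⟨ContinuousLinearEquiv.unitsEquivAut ℝ (Units.mk0 (deriv h y) (hd y hy).ne'), ?_⟩
    change fderivWithin ℝ h (Ioi 0) y = _
    rw [fderivWithin_of_isOpen isOpen_Ioi hy]
    ext
    simp

section Height

variable {n : ℕ} [NeZero n] {φ : PartialEquiv (Eucl n) (Eucl n)}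

open IsSmoothCompactification

/-- A function that vanishes at a boundary point, and dominates a multiple of `1 - |v|²` near it,
has a positive derivative along the inward radius. -/
lemma pos_of_hasDerivWithinAt_radius {w : Eucl n → ℝ} {v₀ : Eucl n} (hφ : IsSmoothCompactification φ)
    (h1 : ‖v₀‖ = 1) (hw0 : w v₀ = 0) {c : ℝ} (hc : 0 < c)
    (hw : ∀ᶠ v in 𝓝[punctured φ] v₀, c * defect v ≤ w v) {d : ℝ}
    (hd : HasDerivWithinAt (fun t : ℝ => w ((1 - t) • v₀)) d (Ici 0) 0) : 0 < d := by
  have h2 := (hasDerivWithinAt_iff_tendsto_slope' (by simp)).1 hd.Ioi_of_Ici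
  refine lt_of_lt_of_le hc (ge_of_tendsto h2 ?_)
  have hn : ∀ t ∈ Ioo (0 : ℝ) 1, ‖(1 - t) • v₀‖ = 1 - t := fun t ht => by
    rw [norm_smul, h1, mul_one, Real.norm_of_nonneg (by linarith [ht.2])]
  have h3 : Tendsto (fun t : ℝ => (1 - t) • v₀) (𝓝[>] 0) (𝓝[punctured φ] v₀) := by
    refine tendsto_nhdsWithin_iff.2 ⟨?_, ?_⟩
    · have : Continuous fun t : ℝ => (1 - t) • v₀ := by fun_prop
      simpa using (this.tendsto 0).mono_left nhdsWithin_le_nhds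
    · filter_upwards [Ioo_mem_nhdsGT one_pos] with t ht
      exact mem_punctured_of_norm_lt hφ (by rw [hn t ht]; linarith [ht.1])
  filter_upwards [h3.eventually hw, Ioo_mem_nhdsGT one_pos] with t ht ht1
  rw [slope_def_field, sub_zero, sub_zero, one_smul, hw0, sub_zero, le_div_iff₀ ht1.1]
  refine le_trans ?_ ht
  rw [defect, hn t ht1]
  have : t ≤ 1 - (1 - t) ^ 2 := by nlinarith [ht1.1, ht1.2]
  exact mul_le_mul_of_nonneg_left this hc.le

/-- The average of `1 - |v|²`, cut off by a window, along the horizontal translations: it is a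
smooth function that only depends on the height, and it vanishes exactly to first order on the
boundary. -/
lemma exists_average_defect (hφ : IsSmoothCompactification φ) : ∃ (w : Eucl n → ℝ) (R : ℝ),
    ContDiffOn ℝ ∞ w (punctured φ) ∧ (∀ v ∈ punctured φ, 0 ≤ w v) ∧
    (∀ v ∈ punctured φ, ‖v‖ = 1 → w v = 0) ∧
    (∀ u ∈ punctured φ, ∀ v ∈ punctured φ, coord φ u ⊤ = coord φ v ⊤ → w u = w v) ∧
    (∀ v ∈ punctured φ, R < coord φ v ⊤ → w v = 0) ∧
    ∀ v₀ ∈ punctured φ, ‖v₀‖ = 1 → ∃ c > 0, ∀ᶠ v in 𝓝[punctured φ] v₀, c * defect v ≤ w v := by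
  have h := hφ.isHomeo
  obtain ⟨ξ, R, hξ, hξ0, hpos⟩ := exists_isWindow hφ
  have hw : IsWindow φ (fun v => ξ v * defect v) R := hξ.mul contDiff_defect.contDiffOn
  have hle : ∀ v ∈ punctured φ, ∀ a : Horiz n, ‖conjAct φ (trans a) v‖ ≤ 1 := fun v hv a =>
    mem_cball.1 (conjAct_trans_mem h a hv).1
  refine ⟨average φ (fun _ => 1) fun v => ξ v * defect v, R,
    hw.contDiffOn_average hφ continuous_const, fun v hv => ?_, fun v hv hv1 => ?_,
    fun u hu v hv ht => IsWindow.average_one_eq hφ hu hv ht, fun v hv hR => ?_, fun v₀ hv₀ hv1 => ?_⟩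
  · refine integral_nonneg fun a => ?_
    simp only [one_smul]
    exact mul_nonneg (hξ0 _) (defect_nonneg (hle v hv a))
  · have h1 : ∀ a : Horiz n, defect (conjAct φ (trans a) v) = 0 := fun a => by
      rw [defect, hφ.norm_conjAct_eq_one (trans_mem a) hv1]; norm_num
    simp [average, h1]
  · have h1 : ∀ a : Horiz n, ξ (conjAct φ (trans a) v) = 0 := fun a => by
      by_contra hne
      have h2 := hξ.norm_coord_le _ (conjAct_trans_mem h a hv) hne
      have h3 := (le_abs_self _).trans (PiLp.norm_apply_le (coord φ (conjAct φ (trans a) v)) ⊤)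
      rw [coord_trans_top h a hv] at h3
      linarith
    simp [average, h1]
  · obtain ⟨k, hk, hkT⟩ := (smoothAction_trans hφ).exists_mul_defect_le
      (fun a v hv => hφ.norm_conjAct_eq_one (trans_mem a) hv)
      (fun v hv => conjAct_eq_self h (fun v hv => proj_trans_zero hv) (mem_cball.1 hv))
      (isCompact_closedBall (0 : Horiz n) (R + (‖coord φ v₀‖ + 1)))
    have hN := hξ.contDiffOn_average hφ (g := fun _ => 1) continuous_const
    have hN0 := hpos v₀ hv₀ hv1
    refine ⟨k * (average φ (fun _ => 1) ξ v₀ / 2), by positivity, ?_⟩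
    filter_upwards [(hN.continuousOn v₀ hv₀).eventually_const_lt (half_lt_self hN0),
      (continuousOn_coord h v₀ hv₀).norm.eventually_lt_const (lt_add_one _), self_mem_nhdsWithin]
      with v hv2 hvR hv
    have h1 : k * defect v * average φ (fun _ => 1) ξ v ≤
        average φ (fun _ => 1) (fun v => ξ v * defect v) v := by
      rw [average, average, ← integral_const_mul]
      refine integral_mono ((hξ.integrable h continuous_const hv).const_mul _)
        (hw.integrable h continuous_const hv) fun a => ?_
      simp only [one_smul]
      by_cases ha : a ∈ Metric.closedBall (0 : Horiz n) (R + (‖coord φ v₀‖ + 1))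
      · calc k * defect v * ξ (conjAct φ (trans a) v)
            ≤ defect (conjAct φ (trans a) v) * ξ (conjAct φ (trans a) v) :=
              mul_le_mul_of_nonneg_right (hkT a ha v hv.1) (hξ0 _)
          _ = _ := mul_comm _ _
      · rw [hξ.eq_zero h hv hvR.le ha, mul_zero, zero_mul]
    refine le_trans ?_ h1
    have h2 : 0 ≤ k * defect v := mul_nonneg hk.le (defect_nonneg (mem_cball.1 hv.1))
    calc k * (average φ (fun _ => 1) ξ v₀ / 2) * defect v
        = k * defect v * (average φ (fun _ => 1) ξ v₀ / 2) := by ring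
      _ ≤ _ := mul_le_mul_of_nonneg_left hv2.le h2

/-- The change of height `y ↦ C y + ω y`, where `ω` is the average of `1 - |v|²` as a function of
the height: the first term is smooth but may be flat on the boundary, the second vanishes to first
order there, and `C` is so large that the sum is increasing. -/
lemma exists_height (hn : 3 ≤ n) (hφ : IsSmoothCompactification φ) : ∃ e : PartialEquiv ℝ ℝ,
    IsHomeo e (Ici 0) (Ici 0) ∧ e 0 = 0 ∧ e '' Ioi 0 = Ioi 0 ∧ ContDiffOn ℝ ∞ e.symm (Ioi 0) ∧
    ContDiffOn ℝ ∞ (fun v => e (coord φ v ⊤)) (punctured φ) ∧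
    ∀ v₀ ∈ punctured φ, ‖v₀‖ = 1 →
      ∃ c > 0, ∀ᶠ v in 𝓝[punctured φ] v₀, c * defect v ≤ e (coord φ v ⊤) := by
  have h := hφ.isHomeo
  obtain ⟨w, R, hws, hw0, hwb, hwt, hwR, hwc⟩ := exists_average_defect hφ
  have hY := contDiffOn_coord_top hn hφ
  have hvt : ∀ y : ℝ, 0 ≤ y → 0 ≤ vertical n y ⊤ := fun y hy => by rwa [vertical_top]
  set c : ℝ → Eucl n := fun y => param φ (vertical n y) with hcdef
  have hcm : ∀ y, 0 ≤ y → c y ∈ punctured φ := fun y hy => param_mem h (hvt y hy)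
  have hct : ∀ y, 0 ≤ y → coord φ (c y) ⊤ = y := fun y hy => by
    rw [hcdef]; simp only; rw [coord_param h (hvt y hy), vertical_top]
  set ω' : ℝ → ℝ := fun y => w (c y) with hω
  have hwω : ∀ v ∈ punctured φ, w v = ω' (coord φ v ⊤) := fun v hv =>
    hwt v hv _ (hcm _ (coord_top_nonneg h hv)) (hct _ (coord_top_nonneg h hv)).symm
  have hωc : ContinuousOn ω' (Ici 0) :=
    hws.continuousOn.comp ((continuousOn_param h).comp
      ((contDiff_vertical (n := n)).continuous.continuousOn) fun y hy => hvt y hy)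
      fun y hy => hcm y hy
  have hωs : ContDiffOn ℝ ∞ ω' (Ioi 0) :=
    hws.comp ((contDiffOn_param_interior hφ).comp
      ((contDiff_vertical (n := n)).of_le (by simp)).contDiffOn
        fun y hy => by rw [mem_ofPred_eq, vertical_top]; exact hy) fun y hy => hcm y (le_of_lt hy)
  have hω0 : ω' 0 = 0 := hwb _ (hcm 0 le_rfl) (norm_param_of_eq_zero hφ (vertical_top 0))
  have hωd : ∀ y > 0, HasDerivAt ω' (deriv ω' y) y := fun y hy =>
    ((hωs.differentiableOn (by simp)).differentiableAt (Ioi_mem_nhds hy)).hasDerivAt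
  -- along a radius, `ω` composed with the height has a positive derivative
  obtain ⟨ε, hε, hne⟩ : ∃ ε > 0, ∀ y ∈ Ioo 0 ε, deriv ω' y ≠ 0 := by
    set v₀ := c 0 with hv₀def
    have hv₀ : v₀ ∈ punctured φ := hcm 0 le_rfl
    have hv1 : ‖v₀‖ = 1 := norm_param_of_eq_zero hφ (vertical_top 0)
    have hn : ∀ t ∈ Ico (0 : ℝ) 1, ‖(1 - t) • v₀‖ = 1 - t := fun t ht => by
      rw [norm_smul, hv1, mul_one, Real.norm_of_nonneg (by linarith [ht.2])]
    have hlt : ∀ t ∈ Ioo (0 : ℝ) 1, ‖(1 - t) • v₀‖ < 1 := fun t ht => by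
      rw [hn t ⟨ht.1.le, ht.2⟩]; linarith [ht.1]
    have hβ : MapsTo (fun t : ℝ => (1 - t) • v₀) (Ico 0 1) (punctured φ) := by
      intro t ht
      rcases eq_or_lt_of_le ht.1 with rfl | ht0
      · simpa using hv₀
      · exact mem_punctured_of_norm_lt hφ (hlt t ⟨ht0, ht.2⟩)
    have hβs : ContDiff ℝ ∞ fun t : ℝ => (1 - t) • v₀ := by fun_prop
    have hθ : ContDiffOn ℝ ∞ (fun t : ℝ => w ((1 - t) • v₀)) (Ico 0 1) :=
      hws.comp hβs.contDiffOn hβ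
    have hYβ : ContDiffOn ℝ ∞ (fun t : ℝ => coord φ ((1 - t) • v₀) ⊤) (Ico 0 1) :=
      hY.comp hβs.contDiffOn hβ
    have hθ' : ContinuousOn (derivWithin (fun t : ℝ => w ((1 - t) • v₀)) (Ico 0 1)) (Ico 0 1) :=
      hθ.continuousOn_derivWithin (uniqueDiffOn_Ico 0 1) (by simp)
    have h00 : (0 : ℝ) ∈ Ico (0 : ℝ) 1 := ⟨le_rfl, one_pos⟩
    have hpos : 0 < derivWithin (fun t : ℝ => w ((1 - t) • v₀)) (Ico 0 1) 0 := by
      obtain ⟨k, hk, hkw⟩ := hwc v₀ hv₀ hv1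
      refine pos_of_hasDerivWithinAt_radius hφ hv1 (hwb v₀ hv₀ hv1) hk hkw ?_
      exact ((hθ.differentiableOn (by simp) 0 h00).hasDerivWithinAt).mono_of_mem_nhdsWithin
        (Ico_mem_nhdsGE one_pos)
    have hev := (hθ' 0 h00).eventually_const_lt hpos
    rw [nhdsWithin_Ico_eq_nhdsGE one_pos] at hev
    obtain ⟨δ, hδ, hδs⟩ := mem_nhdsGE_iff_exists_Ico_subset.1
      (inter_mem hev (Ico_mem_nhdsGE (one_pos (α := ℝ))))
    have hδ0 : (0 : ℝ) < δ := hδ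
    have hδ2 : δ / 2 ∈ Ico 0 δ := ⟨by linarith, by linarith⟩
    have hsub : Icc 0 (δ / 2) ⊆ Ico 0 δ := fun t ht => ⟨ht.1, by linarith [ht.2]⟩
    refine ⟨coord φ ((1 - δ / 2) • v₀) ⊤, coord_top_pos hφ
      (hlt _ ⟨by linarith, (hδs hδ2).2.2⟩), fun y hy => ?_⟩
    have hY0 : coord φ ((1 - (0 : ℝ)) • v₀) ⊤ = 0 := by
      rw [sub_zero, one_smul, coord_top_eq_zero hφ hv1]
    obtain ⟨t, ht, hty⟩ := intermediate_value_Icc hδ2.1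
      (hYβ.continuousOn.mono (hsub.trans fun t ht => (hδs ht).2))
      (show y ∈ Icc (coord φ ((1 - (0 : ℝ)) • v₀) ⊤) (coord φ ((1 - δ / 2) • v₀) ⊤) from
        ⟨by rw [hY0]; exact hy.1.le, hy.2.le⟩)
    simp only at hty
    have ht0 : 0 < t := lt_of_le_of_ne ht.1 fun h0 => by
      rw [← h0, hY0] at hty
      exact hy.1.ne hty
    have ht1 := hδs (hsub ht)
    have hnh : Ico (0 : ℝ) 1 ∈ 𝓝 t := Ico_mem_nhds ht0 ht1.2.2
    have hd1 : HasDerivAt (fun t : ℝ => w ((1 - t) • v₀))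
        (derivWithin (fun t : ℝ => w ((1 - t) • v₀)) (Ico 0 1) t) t :=
      ((hθ.differentiableOn (by simp) t ht1.2).hasDerivWithinAt).hasDerivAt hnh
    have hd2 := (((hYβ.differentiableOn (by simp)) t ht1.2).differentiableAt hnh).hasDerivAt
    have hd3 := HasDerivAt.comp (h₂ := ω') t (by rw [hty]; exact hωd y hy.1) hd2
    have hd4 : HasDerivAt (fun t : ℝ => w ((1 - t) • v₀))
        (deriv ω' y * deriv (fun t : ℝ => coord φ ((1 - t) • v₀) ⊤) t) t := by
      refine hd3.congr_of_eventuallyEq ?_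
      filter_upwards [hnh] with s hs using hwω _ (hβ hs)
    intro h0
    have h5 := hd1.unique hd4
    rw [h0, zero_mul] at h5
    exact absurd ht1.1 (by simp only [mem_ofPred_eq, h5, lt_irrefl, not_false_iff])
  have hpos : ∀ y ∈ Ioo 0 ε, 0 < deriv ω' y := by
    rcases hasDerivWithinAt_forall_lt_or_forall_gt_of_forall_ne (convex_Ioo 0 ε)
      (fun y hy => (hωd y hy.1).hasDerivWithinAt) hne with h1 | h1
    · exfalso
      have hanti : StrictAntiOn ω' (Icc 0 (ε / 2)) := by
        refine strictAntiOn_of_deriv_neg (convex_Icc _ _)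
          (hωc.mono Icc_subset_Ici_self) fun y hy => h1 y ?_
        rw [interior_Icc] at hy
        exact ⟨hy.1, by linarith [hy.2]⟩
      have h2 := hanti (left_mem_Icc.2 (by linarith)) (right_mem_Icc.2 (by linarith))
        (half_pos hε)
      rw [hω0] at h2
      exact absurd h2 (not_lt.2 (hw0 _ (hcm _ (half_pos hε).le)))
    · exact h1
  have hfar : ∀ y > 0, R < y → deriv ω' y = 0 := by
    intro y hy hR
    have h1 : ω' =ᶠ[𝓝 y] fun _ => 0 := by
      filter_upwards [Ioi_mem_nhds hy, Ioi_mem_nhds hR] with z hz hzR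
      exact hwR _ (hcm z (le_of_lt hz)) (by rw [hct z (le_of_lt hz)]; exact hzR)
    rw [h1.deriv_eq, deriv_const]
  obtain ⟨B, hB⟩ := (isCompact_Icc (a := ε) (b := R)).exists_bound_of_continuousOn
    ((hωs.continuousOn_deriv_of_isOpen isOpen_Ioi (by simp)).mono
      fun y hy => lt_of_lt_of_le hε hy.1)
  have hCpos : 0 < |B| + 1 := by positivity
  obtain ⟨e, he, heh, hei, hes⟩ := exists_partialEquiv_of_deriv_pos
    (h := fun y => (|B| + 1) * y + ω' y) (C := |B| + 1)
    ((continuousOn_const.mul continuousOn_id).add hωc)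
    ((contDiffOn_const.mul contDiffOn_id).add hωs)
    (fun y hy => by
      have h1 : HasDerivAt (fun y => (|B| + 1) * y + ω' y) ((|B| + 1) * 1 + deriv ω' y) y :=
        ((hasDerivAt_id y).const_mul _).add (hωd y hy)
      rw [h1.deriv]
      by_cases h2 : y < ε
      · linarith [hpos y ⟨hy, h2⟩]
      · by_cases h3 : R < y
        · linarith [hfar y hy h3]
        · have h4 := abs_le.1 (hB y ⟨not_lt.1 h2, not_lt.1 h3⟩)
          linarith [h4.1, le_abs_self B])
    (by simp [hω0]) hCpos (fun y hy => by linarith [hw0 _ (hcm y hy)])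
  have heY : ∀ v ∈ punctured φ, e (coord φ v ⊤) = (|B| + 1) * coord φ v ⊤ + w v := fun v hv => by
    rw [he, hwω v hv]
  refine ⟨e, heh, by rw [he]; simp [hω0], hei, hes, ?_, fun v₀ hv₀ hv1 => ?_⟩
  · exact ((contDiffOn_const.mul hY).add hws).congr heY
  · obtain ⟨k, hk, hkw⟩ := hwc v₀ hv₀ hv1
    refine ⟨k, hk, ?_⟩
    filter_upwards [hkw, self_mem_nhdsWithin] with v hv hvm
    rw [heY v hvm]
    have := mul_nonneg hCpos.le (coord_top_nonneg h hvm)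
    linarith

end Height

/-! ### Every compactification has a half-space chart -/

section Chart

variable {n : ℕ} {φ : PartialEquiv (Eucl n) (Eucl n)}

lemma areConjugate_refl (k : WithTop ℕ∞) (φ : PartialEquiv (Eucl n) (Eucl n)) :
    AreConjugate k φ φ :=
  ⟨PartialEquiv.ofSet (cball n), ⟨rfl, rfl, contDiffOn_id, contDiffOn_id⟩, fun _ _ _ _ => rfl⟩

open IsSmoothCompactification

/-- The radial projection to the sphere (with value `0` at `0`). -/
def radialProj (v : Eucl n) : Eucl n := ‖v‖⁻¹ • v

lemma norm_radialProj {v : Eucl n} (hv : v ≠ 0) : ‖radialProj v‖ = 1 := by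
  rw [radialProj, norm_smul, norm_inv, norm_norm, inv_mul_cancel₀ (norm_ne_zero_iff.2 hv)]

lemma radialProj_of_norm_eq_one {v : Eucl n} (hv : ‖v‖ = 1) : radialProj v = v := by
  rw [radialProj, hv, inv_one, one_smul]

lemma radialProj_smul {r : ℝ} (hr : 0 < r) {v : Eucl n} (hv : ‖v‖ = 1) :
    radialProj (r • v) = v := by
  rw [radialProj, norm_smul, hv, mul_one, Real.norm_of_nonneg hr.le, smul_smul,
    inv_mul_cancel₀ hr.ne', one_smul]

lemma norm_smul_radialProj (v : Eucl n) : ‖v‖ • radialProj v = v := by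
  by_cases hv : v = 0
  · simp [hv]
  · rw [radialProj, smul_smul, mul_inv_cancel₀ (norm_ne_zero_iff.2 hv), one_smul]

lemma ne_zero_of_norm_eq_one {v : Eucl n} (hv : ‖v‖ = 1) : v ≠ 0 := fun h => by
  rw [h, norm_zero] at hv; exact zero_ne_one hv

lemma contDiffAt_radialProj {v : Eucl n} (hv : v ≠ 0) : ContDiffAt ℝ ∞ radialProj v :=
  ((contDiffAt_norm ℝ hv).inv (norm_ne_zero_iff.2 hv)).smul contDiffAt_id

/-- At a point of the sphere, the radial projection has the tangential projection as its
derivative. -/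
lemma hasFDerivAt_radialProj {v : Eucl n} (hv : ‖v‖ = 1) :
    ∃ P : Eucl n →L[ℝ] Eucl n, HasFDerivAt radialProj P v ∧
      ∀ u, P u = u - fderiv ℝ (fun x : Eucl n => ‖x‖) v u • v := by
  have h0 := ne_zero_of_norm_eq_one hv
  have h1 : HasFDerivAt (fun x : Eucl n => ‖x‖) (fderiv ℝ (fun x : Eucl n => ‖x‖) v) v :=
    ((contDiffAt_norm ℝ h0).differentiableAt one_ne_zero).hasFDerivAt
  have h2 := ((hasDerivAt_inv (norm_ne_zero_iff.2 h0)).comp_hasFDerivAt v h1).smul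
    (hasFDerivAt_id v)
  refine ⟨_, h2, fun u => ?_⟩
  simp [hv, sub_eq_add_neg]

variable [NeZero n]

lemma isOpen_regular : IsOpen {v : Eucl n | v ≠ 0 ∧ radialProj v ≠ poleInv φ} := by
  rw [isOpen_iff_mem_nhds]
  rintro v ⟨h1, h2⟩
  exact Filter.inter_mem (isOpen_compl_singleton.mem_nhds h1)
    ((contDiffAt_radialProj h1).continuousAt.eventually_ne h2)

lemma radialProj_mem {v : Eucl n} (hv : v ≠ 0 ∧ radialProj v ≠ poleInv φ) :
    radialProj v ∈ punctured φ := ⟨mem_cball.2 (norm_radialProj hv.1).le, hv.2⟩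

/-- A function that is differentiable up to the boundary gives a differentiable function of the
radial projection. -/
lemma hasFDerivAt_comp_radialProj {F : Type*} [NormedAddCommGroup F] [NormedSpace ℝ F]
    {g : Eucl n → F} {v : Eucl n} (hv : v ≠ 0 ∧ radialProj v ≠ poleInv φ)
    {g' : Eucl n →L[ℝ] F} (hg : HasFDerivWithinAt g g' (punctured φ) (radialProj v))
    {P : Eucl n →L[ℝ] Eucl n} (hP : HasFDerivAt radialProj P v) :
    HasFDerivAt (fun u => g (radialProj u)) (g'.comp P) v := by
  have h1 : HasFDerivWithinAt (fun u => g (radialProj u)) (g'.comp P)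
      {v : Eucl n | v ≠ 0 ∧ radialProj v ≠ poleInv φ} v :=
    hg.comp v hP.hasFDerivWithinAt fun u hu => radialProj_mem hu
  exact h1.hasFDerivAt (isOpen_regular.mem_nhds hv)

/-- The horizontal coordinates of the radial projection, together with the radius: polar
coordinates adapted to `φ`. -/
def polar (φ : PartialEquiv (Eucl n) (Eucl n)) (v : Eucl n) : Eucl n :=
  WithLp.toLp 2 fun i => if i = ⊤ then ‖v‖ else coord φ (radialProj v) i

lemma polar_top (v : Eucl n) : polar φ v ⊤ = ‖v‖ := by simp [polar]

lemma polar_apply (v : Eucl n) {i : Fin n} (hi : i ≠ ⊤) :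
    polar φ v i = coord φ (radialProj v) i := by simp [polar, hi]

lemma differentiableAt_polar (hn : 3 ≤ n) (hφ : IsSmoothCompactification φ) {v : Eucl n}
    (hv : v ≠ 0 ∧ radialProj v ≠ poleInv φ) : DifferentiableAt ℝ (polar φ) v := by
  rw [differentiableAt_euclidean]
  intro i
  by_cases hi : i = ⊤
  · subst hi
    simp only [polar_top]
    exact (contDiffAt_norm ℝ hv.1).differentiableAt one_ne_zero
  · simp only [polar_apply _ hi]
    have h1 := ((contDiffOn_coord_apply hn hφ hi).differentiableOn (by simp) _
      (radialProj_mem hv)).hasFDerivWithinAt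
    exact (hasFDerivAt_comp_radialProj hv h1 ((contDiffAt_radialProj hv.1).differentiableAt
      (by simp)).hasFDerivAt).differentiableAt

/-- The polar coordinates are a local diffeomorphism: they conjugate translations and homotheties
to affine maps, so that their Jacobian would vanish everywhere as soon as it vanishes somewhere,
which Sard's theorem excludes. -/
lemma det_fderiv_polar_ne_zero (hn : 3 ≤ n) (hφ : IsSmoothCompactification φ) {v₀ : Eucl n}
    (hv₀ : v₀ ≠ 0 ∧ radialProj v₀ ≠ poleInv φ) : (fderiv ℝ (polar φ) v₀).det ≠ 0 := by
  intro h0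
  have h := hφ.isHomeo
  set U := {v : Eucl n | v ≠ 0 ∧ radialProj v ≠ poleInv φ} with hU
  have hall : ∀ v ∈ U, (fderiv ℝ (polar φ) v).det = 0 := by
    intro v hv
    set b := hor (coord φ (radialProj v₀)) - hor (coord φ (radialProj v)) with hb
    set ρ := ‖v₀‖ / ‖v‖ with hρ
    have hv0 : 0 < ‖v‖ := norm_pos_iff.2 hv.1
    have hρ0 : 0 < ρ := div_pos (norm_pos_iff.2 hv₀.1) hv0
    -- the translation and the homothety that move `v` to `v₀`; `B` undoes them in the coordinates
    let Θ : Eucl n → Eucl n := fun u => (ρ * ‖u‖) • conjAct φ (trans b) (radialProj u)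
    have hΘv : Θ v = v₀ := by
      simp only [Θ]
      rw [conjAct_trans_sub h (radialProj_mem hv₀) (radialProj_mem hv)
        (by rw [coord_top_eq_zero hφ (norm_radialProj hv₀.1),
          coord_top_eq_zero hφ (norm_radialProj hv.1)]),
        hρ, div_mul_cancel₀ _ hv0.ne', norm_smul_radialProj]
    let B : Eucl n → Eucl n := fun z => WithLp.toLp 2 fun i =>
      if hi : i = ⊤ then ρ⁻¹ * z i else z i - b ⟨i, hi⟩
    have hB : Differentiable ℝ B := by
      rw [differentiable_euclidean]
      intro i
      by_cases hi : i = ⊤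
      · simp only [B, hi, dif_pos]; fun_prop
      · simp only [B, hi, dif_neg, not_false_iff]; fun_prop
    have hBΘ : ∀ u ∈ U, polar φ u = B (polar φ (Θ u)) := by
      intro u hu
      have hu0 : 0 < ‖u‖ := norm_pos_iff.2 hu.1
      have h1 : ‖conjAct φ (trans b) (radialProj u)‖ = 1 :=
        hφ.norm_conjAct_eq_one (trans_mem b) (norm_radialProj hu.1)
      have h2 : ‖Θ u‖ = ρ * ‖u‖ := by
        simp only [Θ]
        rw [norm_smul, h1, mul_one, Real.norm_of_nonneg (by positivity)]
      have h3 : radialProj (Θ u) = conjAct φ (trans b) (radialProj u) :=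
        radialProj_smul (by positivity) h1
      ext i
      by_cases hi : i = ⊤
      · subst hi
        simp only [B, dif_pos, polar_top, h2]
        rw [inv_mul_cancel_left₀ hρ0.ne']
      · simp only [B, hi, dif_neg, not_false_iff, polar_apply _ hi, h3]
        rw [coord_trans h b (radialProj_mem hu), PiLp.add_apply, horEmb_apply _ hi]
        ring
    have hΘd : DifferentiableAt ℝ Θ v := by
      have h1 : DifferentiableAt ℝ (fun u => conjAct φ (trans b) (radialProj u)) v :=
        (hasFDerivAt_comp_radialProj hv ((((hφ.contDiffOn_conjAct (trans_mem b)).mono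
          sdiff_subset).differentiableOn (by simp) _ (radialProj_mem hv)).hasFDerivWithinAt)
          ((contDiffAt_radialProj hv.1).differentiableAt (by simp)).hasFDerivAt).differentiableAt
      exact (((contDiffAt_norm ℝ hv.1).differentiableAt one_ne_zero).const_mul ρ).smul h1
    have h4 : HasFDerivAt (fun u => B (polar φ (Θ u))) ((fderiv ℝ B (polar φ v₀)).comp
        ((fderiv ℝ (polar φ) v₀).comp (fderiv ℝ Θ v))) v := by
      have h5 : HasFDerivAt (polar φ) (fderiv ℝ (polar φ) v₀) (Θ v) := by
        rw [hΘv]; exact (differentiableAt_polar hn hφ hv₀).hasFDerivAt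
      have h6 := h5.comp v hΘd.hasFDerivAt
      have h7 : HasFDerivAt B (fderiv ℝ B (polar φ v₀)) ((polar φ ∘ Θ) v) := by
        rw [Function.comp_apply, hΘv]; exact (hB _).hasFDerivAt
      exact h7.comp v h6
    have h8 : fderiv ℝ (polar φ) v = (fderiv ℝ B (polar φ v₀)).comp
        ((fderiv ℝ (polar φ) v₀).comp (fderiv ℝ Θ v)) := by
      refine (h4.congr_of_eventuallyEq ?_).fderiv
      filter_upwards [isOpen_regular.mem_nhds hv] with u hu using hBΘ u hu
    rw [h8]
    have h9 : LinearMap.det ((fderiv ℝ (polar φ) v₀ : Eucl n →L[ℝ] Eucl n) :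
      Eucl n →ₗ[ℝ] Eucl n) = 0 := h0
    change LinearMap.det (((fderiv ℝ B (polar φ v₀) : Eucl n →L[ℝ] Eucl n) :
      Eucl n →ₗ[ℝ] Eucl n) ∘ₗ (((fderiv ℝ (polar φ) v₀ : Eucl n →L[ℝ] Eucl n) :
      Eucl n →ₗ[ℝ] Eucl n) ∘ₗ (fderiv ℝ Θ v : Eucl n →L[ℝ] Eucl n))) = 0
    rw [LinearMap.det_comp, LinearMap.det_comp, h9, zero_mul, mul_zero]
  have hnull := addHaar_image_eq_zero_of_det_fderivWithin_eq_zero (μ := volume)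
    (fun v hv => (differentiableAt_polar hn hφ hv).hasFDerivAt.hasFDerivWithinAt) hall
  have hsub : {z : Eucl n | 0 < z ⊤} ⊆ polar φ '' U := by
    intro z hz
    have hz0 : horEmb (hor z) ⊤ = 0 := horEmb_top _
    have hq := param_mem h hz0.ge
    have hq1 := norm_param_of_eq_zero hφ hz0
    have hz' : 0 < z ⊤ := hz
    have h1 : radialProj (z ⊤ • param φ (horEmb (hor z))) = param φ (horEmb (hor z)) :=
      radialProj_smul hz' hq1
    refine ⟨z ⊤ • param φ (horEmb (hor z)),
      ⟨smul_ne_zero hz'.ne' (ne_zero_of_norm_eq_one hq1), ?_⟩, ?_⟩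
    · rw [h1]; exact hq.2
    · ext i
      by_cases hi : i = ⊤
      · subst hi
        rw [polar_top, norm_smul, hq1, mul_one, Real.norm_of_nonneg hz'.le]
      · rw [polar_apply _ hi, h1, coord_param h hz0.ge, horEmb_apply _ hi]
        rfl
  have hopen : IsOpen {z : Eucl n | 0 < z ⊤} := isOpen_lt continuous_const (by fun_prop)
  have hpos := hopen.measure_pos volume ⟨vertical n 1, by
    rw [mem_ofPred_eq, vertical_top]; exact one_pos⟩
  exact hpos.ne' (measure_mono_null hsub hnull)

lemma uniqueDiffOn_punctured : UniqueDiffOn ℝ (punctured φ) :=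
  uniqueDiffOn_cball.inter isOpen_compl_singleton

lemma uniqueDiffOn_halfSpace : UniqueDiffOn ℝ (halfSpace n) := by
  have hconv : Convex ℝ (halfSpace n) := by
    intro x hx y hy a b ha hb _
    simp only [halfSpace, mem_ofPred_eq, PiLp.add_apply, PiLp.smul_apply, smul_eq_mul] at *
    positivity
  have hopen : IsOpen {z : Eucl n | 0 < z ⊤} := isOpen_lt continuous_const (by fun_prop)
  have h1 : vertical n 1 ∈ {z : Eucl n | 0 < z ⊤} := by
    rw [mem_ofPred_eq, vertical_top]; exact one_pos
  have h2 : {z : Eucl n | 0 < z ⊤} ⊆ halfSpace n := fun z hz =>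
    show 0 ≤ z ⊤ from le_of_lt (show 0 < z ⊤ from hz)
  exact uniqueDiffOn_convex hconv ⟨vertical n 1, mem_interior.2 ⟨_, h2, hopen, h1⟩⟩

/-- At the boundary, the coordinates `(X, e Y)` have an injective derivative: on the boundary this
is the regularity of polar coordinates, and the last coordinate increases in the normal
direction. -/
lemma injective_of_norm_eq_one (hn : 3 ≤ n) (hφ : IsSmoothCompactification φ) {e : ℝ → ℝ}
    (he0 : e 0 = 0) {v₀ : Eucl n} (hv₀ : v₀ ∈ punctured φ) (hv1 : ‖v₀‖ = 1)
    (hc : ∃ c > 0, ∀ᶠ v in 𝓝[punctured φ] v₀, c * defect v ≤ e (coord φ v ⊤))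
    {L : Eucl n →L[ℝ] Eucl n}
    (hL : HasFDerivWithinAt (fun v => vertMap e (coord φ v)) L (punctured φ) v₀) :
    Function.Injective L := by
  obtain ⟨P, hP, hPu⟩ := hasFDerivAt_radialProj hv1
  have hreg : v₀ ≠ 0 ∧ radialProj v₀ ≠ poleInv φ := by
    refine ⟨ne_zero_of_norm_eq_one hv1, ?_⟩
    rw [radialProj_of_norm_eq_one hv1]
    exact hv₀.2
  have hLi := hasFDerivWithinAt_euclidean.1 hL
  have hLr : ∀ i, HasFDerivAt (fun u => vertMap e (coord φ (radialProj u)) i)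
      ((PiLp.proj 2 (fun _ : Fin n => ℝ) i ∘L L).comp P) v₀ := fun i => by
    refine hasFDerivAt_comp_radialProj (g := fun u => vertMap e (coord φ u) i) hreg ?_ hP
    rw [radialProj_of_norm_eq_one hv1]
    exact hLi i
  rw [injective_iff_map_eq_zero]
  intro u hu
  -- the last coordinate vanishes on the sphere
  have htan : L (P u) ⊤ = 0 := by
    have h1 : HasFDerivAt (fun u => vertMap e (coord φ (radialProj u)) ⊤)
        (0 : Eucl n →L[ℝ] ℝ) v₀ := by
      refine (hasFDerivAt_const (0 : ℝ) v₀).congr_of_eventuallyEq ?_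
      filter_upwards [isOpen_regular.mem_nhds hreg] with w hw
      rw [vertMap_top, coord_top_eq_zero hφ (norm_radialProj hw.1), he0]
    have h2 := (hLr ⊤).unique h1
    simpa using congrArg (fun M : Eucl n →L[ℝ] ℝ => M u) h2
  have hnor : 0 < -(L v₀ ⊤) := by
    obtain ⟨c, hc0, hcw⟩ := hc
    refine pos_of_hasDerivWithinAt_radius (w := fun v => e (coord φ v ⊤)) hφ hv1
      (by rw [coord_top_eq_zero hφ hv1, he0]) hc0 hcw ?_
    have h1 : HasDerivWithinAt (fun t : ℝ => (1 - t) • v₀) (-v₀) (Ico 0 1) 0 := by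
      have h2 := (((hasDerivAt_id (0 : ℝ)).const_sub 1).smul_const v₀).hasDerivWithinAt
        (s := Ico 0 1)
      simpa using h2
    have hmaps : MapsTo (fun t : ℝ => (1 - t) • v₀) (Ico 0 1) (punctured φ) := by
      intro t ht
      rcases eq_or_lt_of_le ht.1 with rfl | ht0
      · simpa using hv₀
      · refine mem_punctured_of_norm_lt hφ ?_
        rw [norm_smul, hv1, mul_one, Real.norm_of_nonneg (by linarith [ht.2])]
        linarith
    have h3 : HasFDerivWithinAt (fun v => vertMap e (coord φ v) ⊤)
        (PiLp.proj 2 (fun _ : Fin n => ℝ) ⊤ ∘L L) (punctured φ) ((1 - (0 : ℝ)) • v₀) := by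
      rw [sub_zero, one_smul]
      exact hLi ⊤
    have h4 := h3.comp_hasDerivWithinAt (0 : ℝ) h1 hmaps
    have h5 := h4.mono_of_mem_nhdsWithin (Ico_mem_nhdsGE (one_pos (α := ℝ)))
    refine (h5.congr_deriv ?_).congr (fun t _ => ?_) ?_
    · simp
    · simp [vertMap_top]
    · simp [vertMap_top]
  have hν : fderiv ℝ (fun x : Eucl n => ‖x‖) v₀ u = 0 := by
    rw [hPu, map_sub, hu, map_smul, zero_sub, PiLp.neg_apply, PiLp.smul_apply, smul_eq_mul,
      neg_eq_zero] at htan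
    rcases mul_eq_zero.1 htan with h1 | h1
    · exact h1
    · rw [h1, neg_zero] at hnor
      exact absurd hnor (lt_irrefl _)
  have hPu' : P u = u := by rw [hPu, hν, zero_smul, sub_zero]
  have hpol : fderiv ℝ (polar φ) v₀ u = 0 := by
    have h1 := (differentiableAt_polar hn hφ hreg).hasFDerivAt
    rw [← hasFDerivWithinAt_univ, hasFDerivWithinAt_euclidean] at h1
    ext i
    have h2 := (hasFDerivWithinAt_univ.1 (h1 i))
    by_cases hi : i = ⊤
    · subst hi
      simp only [polar_top] at h2
      rw [h2.fderiv] at hν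
      exact hν
    · have h3 := hLr i
      simp only [polar_apply _ hi] at h2
      simp only [vertMap_apply _ _ hi] at h3
      have h4 := congrArg (fun M : Eucl n →L[ℝ] ℝ => M u) (h2.unique h3)
      simp only [ContinuousLinearMap.comp_apply, hPu', hu] at h4
      simpa using h4
  have hdet : LinearMap.det ((fderiv ℝ (polar φ) v₀ : Eucl n →L[ℝ] Eucl n) :
      Eucl n →ₗ[ℝ] Eucl n) ≠ 0 := det_fderiv_polar_ne_zero hn hφ hreg
  have hinj := (LinearMap.equivOfDetNeZero _ hdet).injective
  exact hinj ((show _ = (0 : Eucl n) from hpol).trans (map_zero _).symm)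

/-- In dimension at least `3`, every smooth compactification is given by a profile. -/
theorem exists_isGivenBy (hn : 3 ≤ n) (hφ : IsSmoothCompactification φ) :
    ∃ f : PartialEquiv ℝ ℝ, IsProfile f ∧ IsGivenBy f φ := by
  have h := hφ.isHomeo
  obtain ⟨e, heh, he0, hei, hes, heY, hec⟩ := exists_height hn hφ
  have hem : ∀ y, 0 ≤ y → 0 ≤ e y := fun y hy => by
    have := e.map_source (x := y) (by rw [heh.source_eq]; exact hy)
    rwa [heh.target_eq] at this
  have hsm : ∀ y, 0 ≤ y → 0 ≤ e.symm y := fun y hy => by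
    have := e.map_target (x := y) (by rw [heh.target_eq]; exact hy)
    rwa [heh.source_eq] at this
  have hel : ∀ y, 0 ≤ y → e.symm (e y) = y := fun y hy =>
    e.left_inv (by rw [heh.source_eq]; exact hy)
  have her : ∀ y, 0 ≤ y → e (e.symm y) = y := fun y hy =>
    e.right_inv (by rw [heh.target_eq]; exact hy)
  have hepos : ∀ y, 0 < y → 0 < e y := fun y hy => by
    have : e y ∈ e '' Ioi 0 := mem_image_of_mem _ hy
    rwa [hei] at this
  have hst : ∀ z ∈ halfSpace n, 0 ≤ vertMap e.symm z ⊤ := fun z hz => by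
    rw [vertMap_top]; exact hsm _ hz
  let χ : PartialEquiv (Eucl n) (Eucl n) :=
    { toFun := fun v => vertMap e (coord φ v)
      invFun := fun z => param φ (vertMap e.symm z)
      source := punctured φ
      target := halfSpace n
      map_source' := fun v hv => by
        rw [halfSpace, mem_ofPred_eq, vertMap_top]
        exact hem _ (coord_top_nonneg h hv)
      map_target' := fun z hz => param_mem h (hst z hz)
      left_inv' := fun v hv => by
        rw [vertMap_vertMap (hel _ (coord_top_nonneg h hv)), param_coord h hv]
      right_inv' := fun z hz => by
        rw [coord_param h (hst z hz), vertMap_vertMap (her _ hz)] }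
  have hχ : ContDiffOn ℝ ∞ χ (punctured φ) := by
    rw [contDiffOn_euclidean]
    intro i
    by_cases hi : i = ⊤
    · subst hi
      exact heY.congr fun v _ => vertMap_top _ _
    · exact (contDiffOn_coord_apply hn hφ hi).congr fun v _ => vertMap_apply _ _ hi
  have hχc : ContinuousOn χ.symm (halfSpace n) := by
    refine (continuousOn_param h).comp ?_ fun z hz => hst z hz
    have h1 : ContinuousOn (fun z : Eucl n => fun i => vertMap e.symm z i) (halfSpace n) := by
      refine continuousOn_pi.2 fun i => ?_
      by_cases hi : i = ⊤
      · subst hi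
        simp only [vertMap_top]
        exact heh.continuousOn_symm.comp (by fun_prop) fun z hz => hz
      · simp only [vertMap_apply _ _ hi]
        fun_prop
    exact (PiLp.continuous_toLp 2 fun _ : Fin n => ℝ).comp_continuousOn h1
  have hinj : ∀ v ∈ punctured φ,
      Function.Injective (fderivWithin ℝ χ (punctured φ) v) := by
    intro v hv
    have hL := (hχ.differentiableOn (by simp) v hv).hasFDerivWithinAt
    rcases lt_or_eq_of_le (mem_cball.1 hv.1) with hlt | hv1
    · have hpos : 0 < χ v ⊤ := by
        change 0 < vertMap e (coord φ v) ⊤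
        rw [vertMap_top]
        exact hepos _ (coord_top_pos hφ hlt)
      have h1 : ContDiffOn ℝ ∞ χ.symm {z | 0 < z ⊤} := by
        refine (contDiffOn_param_interior hφ).comp (f := vertMap e.symm) ?_ fun z hz => ?_
        · rw [contDiffOn_euclidean]
          intro i
          by_cases hi : i = ⊤
          · subst hi
            simp only [vertMap_top]
            exact hes.comp (s := {z : Eucl n | 0 < z ⊤}) (f := fun z : Eucl n => z ⊤)
              (by fun_prop) fun z hz => hz
          · simp only [vertMap_apply _ _ hi]
            fun_prop
        · rw [mem_ofPred_eq, vertMap_top]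
          have hz' : z ⊤ ∈ e '' Ioi 0 := by rw [hei]; exact hz
          obtain ⟨y, hy, hyz⟩ := hz'
          rw [← hyz, hel y (le_of_lt hy)]
          exact hy
      have hopen : IsOpen {z : Eucl n | 0 < z ⊤} := isOpen_lt continuous_const (by fun_prop)
      have h2 := ((h1.differentiableOn (by simp)).differentiableAt
        (hopen.mem_nhds hpos)).hasFDerivAt.comp_hasFDerivWithinAt v hL
      have h3 : HasFDerivWithinAt (χ.symm ∘ χ) (ContinuousLinearMap.id ℝ (Eucl n))
          (punctured φ) v :=
        (hasFDerivWithinAt_id v _).congr (fun u hu => χ.left_inv hu) (χ.left_inv hv)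
      have h4 := (uniqueDiffOn_punctured v hv).eq h2 h3
      intro u w huw
      have h5 := congrArg (fun M : Eucl n →L[ℝ] Eucl n => M u) h4
      have h6 := congrArg (fun M : Eucl n →L[ℝ] Eucl n => M w) h4
      simp only [ContinuousLinearMap.comp_apply, ContinuousLinearMap.id_apply] at h5 h6
      rw [← h5, huw, h6]
    · exact injective_of_norm_eq_one hn hφ he0 hv hv1 (hec v hv hv1) hL
  have hχs : ContDiffOn ℝ ∞ χ.symm (halfSpace n) := by
    refine contDiffOn_symm_of_fderivWithin χ uniqueDiffOn_punctured uniqueDiffOn_halfSpace hχ hχc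
      fun v hv => ?_
    let E := LinearEquiv.ofInjectiveEndo
      (fderivWithin ℝ χ (punctured φ) v : Eucl n →ₗ[ℝ] Eucl n) (hinj v hv)
    exact ⟨E.toContinuousLinearEquiv, by ext; rfl⟩
  have hf : ContDiffOn ℝ ∞ e.symm (Ici 0) := by
    have h1 : ContDiffOn ℝ ∞ (fun y => coord φ (χ.symm (vertical n y)) ⊤) (Ici 0) :=
      (contDiffOn_coord_top hn hφ).comp (hχs.comp
        ((contDiff_vertical (n := n)).of_le (by simp)).contDiffOn fun y hy => vertical_mem hy)
        fun y hy => χ.map_target (vertical_mem hy)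
    refine h1.congr fun y hy => ?_
    change e.symm y = coord φ (param φ (vertMap e.symm (vertical n y))) ⊤
    rw [coord_param h (hst _ (vertical_mem hy)), vertMap_top, vertical_top]
  refine ⟨e.symm, ⟨⟨heh.target_eq, heh.source_eq, heh.continuousOn_symm, heh.continuousOn⟩, hf,
    ?_, ?_⟩, h, poleInv φ, χ, ⟨norm_poleInv hφ, rfl, rfl, hχ, hχs⟩, apply_poleInv h,
    fun v hv => ?_⟩
  · nth_rewrite 1 [← hei]
    rw [← image_comp]
    exact (image_congr fun y hy => hel y (le_of_lt hy)).trans (image_id _)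
  · change ContDiffOn ℝ ∞ e (Ioi 0)
    have hvt : ∀ y ∈ Ioi (0 : ℝ), param φ (vertical n y) ∈ punctured φ := fun y hy =>
      param_mem h (vertical_mem (le_of_lt hy))
    have h1 : ContDiffOn ℝ ∞ (fun y => e (coord φ (param φ (vertical n y)) ⊤)) (Ioi 0) :=
      heY.comp ((contDiffOn_param_interior hφ).comp
        ((contDiff_vertical (n := n)).of_le (by simp)).contDiffOn
          fun y hy => by rw [mem_ofPred_eq, vertical_top]; exact hy) hvt
    refine h1.congr fun y hy => ?_
    rw [coord_param h (vertical_mem (le_of_lt hy)), vertical_top]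
  · exact (vertMap_vertMap (hel _ (coord_top_nonneg h hv))).symm

end Chart

end HypCompact

end

theorem theorem2 (n : ℕ) [NeZero n] (hn : 2 ≤ n) :
    -- `φ_f` gives a smooth compactification, in some half-space chart, iff `f / f'` is smooth
    (∀ f : PartialEquiv ℝ ℝ, HypCompact.IsProfile f →
      ((∃ φ : PartialEquiv (HypCompact.Eucl n) (HypCompact.Eucl n),
          HypCompact.IsGivenBy f φ ∧ HypCompact.IsSmoothCompactification φ) ↔
        HypCompact.QuotientSmooth f)) ∧
    -- the condition holds for all non-flat `f`
    (∀ f : PartialEquiv ℝ ℝ, HypCompact.IsProfile f → HypCompact.NonFlat f →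
      HypCompact.QuotientSmooth f) ∧
    -- for `n ≥ 3` every smooth compactification is conjugate to one of these
    (3 ≤ n → ∀ φ : PartialEquiv (HypCompact.Eucl n) (HypCompact.Eucl n),
      HypCompact.IsSmoothCompactification φ →
      ∃ (f : PartialEquiv ℝ ℝ) (φ' : PartialEquiv (HypCompact.Eucl n) (HypCompact.Eucl n)),
        HypCompact.IsProfile f ∧ HypCompact.QuotientSmooth f ∧
        HypCompact.IsGivenBy f φ' ∧ HypCompact.IsSmoothCompactification φ' ∧
        HypCompact.AreConjugate ω φ φ') ∧
    -- two of these are conjugate iff the maps `f` are smoothly conjugate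
    (∀ f₁ f₂ : PartialEquiv ℝ ℝ, HypCompact.IsProfile f₁ → HypCompact.IsProfile f₂ →
      ∀ φ₁ φ₂ : PartialEquiv (HypCompact.Eucl n) (HypCompact.Eucl n),
        HypCompact.IsGivenBy f₁ φ₁ → HypCompact.IsSmoothCompactification φ₁ →
        HypCompact.IsGivenBy f₂ φ₂ → HypCompact.IsSmoothCompactification φ₂ →
        (HypCompact.AreConjugate ∞ φ₁ φ₂ ↔ HypCompact.SmoothlyConjugate f₁ f₂) ∧
        (HypCompact.AreConjugate ∞ φ₁ φ₂ ↔ HypCompact.SourceConjugate f₁ f₂)) := by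
  refine ⟨fun f hf => ⟨?_, fun hq => ?_⟩, fun f hf hn => HypCompact.quotientSmooth_of_nonFlat hf hn,
    fun h3 φ hφ => ?_, fun f₁ f₂ hf₁ hf₂ φ₁ φ₂ hg₁ h₁ hg₂ h₂ => ?_⟩
  · rintro ⟨φ, hG, hφ⟩
    exact HypCompact.quotientSmooth_of_isGivenBy hf hG hφ
  · obtain ⟨c, a, φ, h⟩ := HypCompact.exists_isRadial n hf
    exact ⟨φ, h.isGivenBy hf hq, h.isSmoothCompactification hf hq⟩
  · obtain ⟨f, hf, hG⟩ := HypCompact.exists_isGivenBy h3 hφ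
    exact ⟨f, φ, hf, HypCompact.quotientSmooth_of_isGivenBy hf hG hφ, hG, hφ,
      HypCompact.areConjugate_refl ω φ⟩
  · have h := HypCompact.areConjugate_iff_sourceConjugate hn hf₁ hf₂ hg₁ hg₂ h₁ h₂
    refine ⟨h.trans (hf₁.smoothlyConjugate_iff hf₂ ?_ ?_).symm, h⟩
    · exact HypCompact.quotientSmooth_of_isGivenBy hf₁ hg₁ h₁
    · exact HypCompact.quotientSmooth_of_isGivenBy hf₂ hg₂ h₂
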